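/- Let $(M,Q)$ be an even integral lattice, that is, a free $\mathbb Z$-module of finite (even) rank with a non-degenerate $\mathbb Z$-valued quadratic form $Q$, with bilinear form $(x,y)=Q(x+y)-Q(x)-Q(y)$, signature $(b^+,b^-)$ and dual lattice $M'\subset M\otimes\mathbb Q$. Let $S_M$ be the space of functions $M'/M\to\mathbb C$, $S_M^\vee$ its dual, and $\{\cdot,\cdot\}:S_M\times S_M^\vee\to\mathbb C$ the tautological pairing. Write $e(x)=e^{2\pi i x}$, $\tau=u+iv\in\mathbb H$, $q^m=e(m\tau)$. Let $\omega_M$ be the Weil representation of $\mathrm{SL}_2(\mathbb Z)$ on $S_M$, determined by $$\omega_M\begin{pmatrix}1&1\\0&1\end{pmatrix}\varphi(\mu)=e(-Q(\mu))\varphi(\mu),\qquad \omega_M\begin{pmatrix}0&-1\\1&0\end{pmatrix}\varphi(\nu)=\frac{e((b^+-b^-)/8)}{\sqrt{|M'/M|}}\sum_{\mu\in M'/M}e((\mu,\nu))\varphi(\mu),$$ and $\omega_M^\vee(\gamma)\ell=\ell\circ\omega_M(\gamma)^{-1}$ its dual. Let $k\ge 0$ be an integer. Let $f\in H_{-k}(\omega_M)$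 be a harmonic Maass form: $f:\mathbb H\to S_M$ is smooth, $f(\gamma\tau)=(c\tau+d)^{-k}\omega_M(\gamma)f(\tau)$ for all $\gamma=\begin{pmatrix}a&b\\c&d\end{pmatrix}\in\mathrm{SL}_2(\mathbb Z)$, $\Delta_{-k}f=0$ with $\Delta_\kappa=-v^2(\partial_u^2+\partial_v^2)+i\kappa v(\partial_u+i\partial_v)$, and there are a finite sum $P=\sum_{m\le 0}a(m)q^m$ ($m\in\mathbb Q$, $a(m)\in S_M$) and $\varepsilon>0$ with $f-P=O(e^{-\varepsilon v})$ as $v\to\infty$. Let $g\in M_k(\omega_M^\vee)$ be a holomorphic modular form: $g:\mathbb H\to S_M^\vee$ is holomorphic, bounded as $v\to\infty$, and $g(\gamma\tau)=(c\tau+d)^k\omega_M^\vee(\gamma)g(\tau)$. Then $f$ and $g$ have Fourier expansions, with coefficients supported on rational numbers of bounded denominator, $$f(\tau)=\sum_{m\gg-\infty}c^+(m)q^m+\sum_{m<0}c^-(m)\,\Gamma(1+k,4\pi|m|v)\,q^m,\qquad g(\tau)=\sum_{m\ge0}b(m)q^m,$$ where $c^\pm(m)\in S_M$, $b(m)\in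 S_M^\vee$ and $\Gamma(s,x)=\int_x^\infty e^{-t}t^{s-1}\,dt$. Put $f^+=\sum_m c^+(m)q^m$ and $\vartheta(g)=\sum_m m\,b(m)q^m$, let $\mathrm{CT}$ denote the constant term of a formal $q$-series, let $\sigma_1(m)$ be the sum of the positive divisors of $m$ for $m>0$ and $\sigma_1(0)=-\tfrac1{24}$, and let $E_2=-24\sum_{m\ge0}\sigma_1(m)q^m$. Let $$(f,g)^{\mathrm{reg}}=\lim_{T\to\infty}\int_{\mathcal F_T}\{f(\tau),g(\tau)\}\,\frac{du\,dv}{v^2},\qquad \mathcal F_T=\{\tau\in\mathbb H:\ |u|\le\tfrac12,\ |\tau|\ge1,\ v\le T\}.$$ This limit exists, and: 1. If $k>0$, then $$(f,g)^{\mathrm{reg}}=\frac{4\pi}{k}\,\mathrm{CT}\big[\{f^+,\vartheta(g)\}\big]=\frac{4\pi}{k}\sum_{m>0}m\cdot\{c^+(-m),b(m)\},$$ where $m$ runs over the positive rational numbers. 2. If $k=0$, then $g$ is constant and $$(f,g)^{\mathrm{reg}}=\frac{\pi}{3}\,\mathrm{CT}\big[\{f^+,gE_2\}\big]=-8\pi\sum_{m\ge0}\sigma_1(m)\cdot\{c^+(-m),g\},$$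 where $m$ runs over the non-negative integers. -/

import Mathlib

open UpperHalfPlane MeasureTheory
open scoped MatrixGroups Modular ContDiff

noncomputable section

/-! ## Even lattices and their discriminant groups -/

/-- An even integral lattice, given inside its rational span `V`: a full lattice `M` in the rational
quadratic space `(V, Q)`, with `Q` non-degenerate and integer valued on `M`. (Every free `ℤ`-module
`M` of finite rank with a non-degenerate `ℤ`-valued quadratic form is of this kind, with
`V = M ⊗ ℚ`, and `M` is automatically free over `ℤ` of rank `dim V`.) -/
structure EvenLattice (V : Type*) [AddCommGroup V] [Module ℚ V] where
  /-- the quadratic form -/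
  Q : QuadraticForm ℚ V
  /-- the lattice -/
  M : Submodule ℤ V
  fg : M.FG
  span_eq_top : Submodule.span ℚ (M : Set V) = ⊤
  integral : ∀ x ∈ M, ∃ n : ℤ, Q x = n
  nondegenerate : LinearMap.BilinForm.Nondegenerate (QuadraticMap.polarBilin Q)

/-- `e(x) = exp(2πix)` for rational `x`. -/
def expRat (x : ℚ) : ℂ := Complex.exp (2 * Real.pi * Complex.I * (x : ℂ))

lemma expRat_add (x y : ℚ) : expRat (x + y) = expRat x * expRat y := by
  simp only [expRat, ← Complex.exp_add]
  congr 1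
  push_cast
  ring

lemma expRat_int (n : ℤ) : expRat (n : ℚ) = 1 := by
  rw [expRat, Complex.exp_eq_one_iff]
  exact ⟨n, by push_cast; ring⟩

lemma expRat_eq_one {x : ℚ} (h : expRat x = 1) : ∃ n : ℤ, x = n := by
  rw [expRat, Complex.exp_eq_one_iff] at h
  obtain ⟨n, hn⟩ := h
  refine ⟨n, ?_⟩
  have h2 : (2 * Real.pi * Complex.I : ℂ) ≠ 0 := Complex.two_pi_I_ne_zero
  have h3 : (x : ℂ) = (n : ℂ) := by
    apply mul_left_cancel₀ h2
    rw [hn]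
    ring
  exact_mod_cast h3

namespace EvenLattice

variable {V : Type*} [AddCommGroup V] [Module ℚ V] (L : EvenLattice V)

/-- The bilinear form `(x, y) = Q(x + y) - Q(x) - Q(y)`. -/
def B : LinearMap.BilinForm ℚ V := QuadraticMap.polarBilin L.Q

lemma Q_add (x y : V) : L.Q (x + y) = L.Q x + L.Q y + L.B x y := by
  simp [B, QuadraticMap.polar]

lemma B_symm (x y : V) : L.B x y = L.B y x := by
  simp [B, QuadraticMap.polar_comm]

/-- The dual lattice `M' = {x ∈ V : (x, y) ∈ ℤ for all y ∈ M}`. -/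
def dual : Submodule ℤ V := L.B.dualSubmodule L.M

lemma mem_dual {x : V} : x ∈ L.dual ↔ ∀ y ∈ L.M, ∃ n : ℤ, L.B x y = n := by
  simp only [dual, LinearMap.BilinForm.mem_dualSubmodule, Submodule.mem_one]
  simp [eq_comm]

lemma M_le_dual : L.M ≤ L.dual := by
  intro x hx
  rw [mem_dual]
  intro y hy
  obtain ⟨a, ha⟩ := L.integral _ (L.M.add_mem hx hy)
  obtain ⟨b, hb⟩ := L.integral _ hx
  obtain ⟨c, hc⟩ := L.integral _ hy
  refine ⟨a - b - c, ?_⟩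
  have := L.Q_add x y
  push_cast
  linarith

/-- The discriminant group `M'/M`. -/
abbrev Disc : Type _ := L.dual ⧸ L.M.submoduleOf L.dual

instance isLattice : Submodule.IsLattice ℚ L.M := ⟨L.fg, L.span_eq_top⟩

/-- A `ℤ`-basis of the lattice, as a `ℚ`-basis of the ambient space. -/
lemma exists_basis : ∃ (n : ℕ) (b : Module.Basis (Fin n) ℚ V),
    Submodule.span ℤ (Set.range b) = L.M := by
  let b := Module.finBasis ℤ L.M
  refine ⟨_, b.extendOfIsLattice ℚ, ?_⟩
  have h : (b.extendOfIsLattice ℚ : _ → V) = L.M.subtype ∘ b := by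
    ext i
    simp
  rw [h, Set.range_comp, ← Submodule.map_span, b.span_eq]
  simp

lemma isSymm : L.B.IsSymm := ⟨L.B_symm⟩

lemma dual_dual : L.B.dualSubmodule L.dual = L.M := by
  obtain ⟨n, b, hb⟩ := L.exists_basis
  rw [dual, ← hb]
  exact LinearMap.BilinForm.dualSubmodule_dualSubmodule_of_basis L.B L.nondegenerate L.isSymm b

lemma dual_fg : L.dual.FG := by
  classical
  obtain ⟨n, b, hb⟩ := L.exists_basis
  rw [dual, ← hb, LinearMap.BilinForm.dualSubmodule_span_of_basis L.B L.nondegenerate b]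
  exact Submodule.fg_span (Set.finite_range _)

/-- Every vector of `V` has a nonzero integral multiple in the lattice. -/
lemma exists_smul_mem (x : V) : ∃ n : ℤ, n ≠ 0 ∧ n • x ∈ L.M := by
  have hx : x ∈ Submodule.span ℚ (L.M : Set V) := by rw [L.span_eq_top]; trivial
  induction hx using Submodule.span_induction with
  | mem x h => exact ⟨1, one_ne_zero, by simpa using h⟩
  | zero => exact ⟨1, one_ne_zero, by simp⟩
  | add x y _ _ hx hy =>
    obtain ⟨a, ha, hax⟩ := hx
    obtain ⟨b, hb, hby⟩ := hy
    refine ⟨a * b, mul_ne_zero ha hb, ?_⟩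
    rw [smul_add]
    refine L.M.add_mem ?_ ?_
    · rw [mul_comm, mul_smul]
      exact L.M.smul_mem b hax
    · rw [mul_smul]
      exact L.M.smul_mem a hby
  | smul c x _ hx =>
    obtain ⟨a, ha, hax⟩ := hx
    refine ⟨c.den * a, mul_ne_zero (by exact_mod_cast c.den_nz) ha, ?_⟩
    have h : ((c.den : ℤ) * a) • c • x = c.num • a • x := by
      simp only [← Int.cast_smul_eq_zsmul ℚ, smul_smul]
      congr 1
      push_cast
      have := Rat.den_mul_eq_num c
      linear_combination (a : ℚ) * this
    rw [h]
    exact L.M.smul_mem _ hax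

instance finite_disc : Finite L.Disc := by
  have : Module.Finite ℤ L.dual := Module.Finite.iff_fg.mpr L.dual_fg
  apply Module.finite_of_fg_torsion
  intro x
  induction x using Submodule.Quotient.induction_on with
  | _ x =>
  obtain ⟨n, hn, hx⟩ := L.exists_smul_mem (x : V)
  refine ⟨⟨n, mem_nonZeroDivisors_of_ne_zero hn⟩, ?_⟩
  rw [Submonoid.mk_smul, ← Submodule.Quotient.mk_smul, Submodule.Quotient.mk_eq_zero]
  simpa [Submodule.submoduleOf] using hx

instance fintype_disc : Fintype L.Disc := Fintype.ofFinite _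

/-- `e(Q(μ))` for `μ ∈ M'/M`. -/
def eQ : L.Disc → ℂ := Quotient.lift (fun x : L.dual => expRat (L.Q (x : V))) (by
  intro x y h
  have h' : (y : V) - x ∈ L.M := by
    have h1 := (Submodule.quotientRel_def _).mp h
    have h2 : (x : V) - y ∈ L.M := by simpa [Submodule.submoduleOf] using h1
    simpa using L.M.neg_mem h2
  obtain ⟨a, ha⟩ := L.integral _ h'
  obtain ⟨b, hb⟩ := L.mem_dual.mp x.2 _ h'
  have h3 : L.Q (y : V) = L.Q (x : V) + ((a + b : ℤ) : ℚ) := by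
    have := L.Q_add (x : V) ((y : V) - x)
    rw [add_sub_cancel] at this
    rw [this, ha, hb]
    push_cast
    ring
  change expRat (L.Q (x : V)) = expRat (L.Q (y : V))
  rw [h3, expRat_add, expRat_int, mul_one])

lemma eQ_mk (x : L.dual) : L.eQ (Submodule.Quotient.mk x) = expRat (L.Q (x : V)) := rfl

lemma eQ_ne_zero (μ : L.Disc) : L.eQ μ ≠ 0 := by
  induction μ using Submodule.Quotient.induction_on with
  | _ x => exact Complex.exp_ne_zero _

/-- `e((μ, ν))` for `μ, ν ∈ M'/M`, written as `e(Q(μ + ν)) / (e(Q(μ)) e(Q(ν)))`. -/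
def eB (μ ν : L.Disc) : ℂ := L.eQ (μ + ν) / (L.eQ μ * L.eQ ν)

lemma eB_mk (x y : L.dual) :
    L.eB (Submodule.Quotient.mk x) (Submodule.Quotient.mk y) = expRat (L.B (x : V) (y : V)) := by
  rw [eB, ← Submodule.Quotient.mk_add, eQ_mk, eQ_mk, eQ_mk, Submodule.coe_add, L.Q_add, expRat_add,
    expRat_add]
  have h1 : expRat (L.Q (x : V)) ≠ 0 := Complex.exp_ne_zero _
  have h2 : expRat (L.Q (y : V)) ≠ 0 := Complex.exp_ne_zero _
  field_simp

lemma eB_add (μ ν ρ : L.Disc) : L.eB μ (ν + ρ) = L.eB μ ν * L.eB μ ρ := by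
  induction μ using Submodule.Quotient.induction_on with
  | _ x =>
  induction ν using Submodule.Quotient.induction_on with
  | _ y =>
  induction ρ using Submodule.Quotient.induction_on with
  | _ z =>
  rw [← Submodule.Quotient.mk_add, eB_mk, eB_mk, eB_mk, Submodule.coe_add, map_add, expRat_add]

lemma eB_comm (μ ν : L.Disc) : L.eB μ ν = L.eB ν μ := by
  rw [eB, eB, add_comm, mul_comm (L.eQ μ)]

lemma eB_zero (μ : L.Disc) : L.eB μ 0 = 1 := by
  have h : L.eQ (0 : L.Disc) = 1 := by
    rw [← Submodule.Quotient.mk_zero, eQ_mk]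
    simp [expRat]
  rw [eB, add_zero, h, mul_one, div_self (L.eQ_ne_zero μ)]

/-- Non-degeneracy of the discriminant form. -/
lemma eq_zero_of_eB (μ : L.Disc) (h : ∀ ν, L.eB μ ν = 1) : μ = 0 := by
  induction μ using Submodule.Quotient.induction_on with
  | _ x =>
  rw [Submodule.Quotient.mk_eq_zero]
  have hx : (x : V) ∈ L.B.dualSubmodule L.dual := by
    rw [LinearMap.BilinForm.mem_dualSubmodule]
    intro y hy
    have := h (Submodule.Quotient.mk ⟨y, hy⟩)
    rw [eB_mk] at this
    obtain ⟨n, hn⟩ := expRat_eq_one this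
    rw [Submodule.mem_one]
    exact ⟨n, by simpa using hn.symm⟩
  rw [dual_dual] at hx
  simpa [Submodule.submoduleOf] using hx

open scoped Classical in
/-- Orthogonality of characters on the discriminant group. -/
lemma sum_eB (μ : L.Disc) :
    ∑ ν, L.eB μ ν = if μ = 0 then (Fintype.card L.Disc : ℂ) else 0 := by
  split_ifs with h
  · subst h
    simp [L.eB_comm 0, eB_zero]
  · obtain ⟨ρ, hρ⟩ : ∃ ρ, L.eB μ ρ ≠ 1 := by
      by_contra hc
      push Not at hc
      exact h (L.eq_zero_of_eB μ hc)
    have h1 : L.eB μ ρ * ∑ ν, L.eB μ ν = ∑ ν, L.eB μ ν := by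
      rw [Finset.mul_sum]
      exact Fintype.sum_equiv (Equiv.addLeft ρ) _ _ fun ν => by simp [eB_add]
    by_contra hne
    exact hρ (mul_right_cancel₀ hne (by rw [h1, one_mul]))

/-! ## The Weil representation -/

/-- The space `S_M` of functions `M'/M → ℂ`. -/
abbrev S : Type _ := L.Disc → ℂ

/-- The constant `√i^(b⁺ - b⁻) / √|M'/M|`, where `(b⁺, b⁻)` is the signature of `M`. -/
def weilConst : ℂ :=
  Complex.exp (2 * Real.pi * Complex.I *
      (((sigPos L.Q : ℂ) - (sigNeg L.Q : ℂ)) / 8)) /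
    (Real.sqrt (Fintype.card L.Disc) : ℂ)

lemma weilConst_ne_zero : L.weilConst ≠ 0 := by
  refine div_ne_zero (Complex.exp_ne_zero _) ?_
  have : (0 : ℝ) < Fintype.card L.Disc := by exact_mod_cast Fintype.card_pos
  exact_mod_cast (Real.sqrt_pos.mpr this).ne'

/-- `ω_M(T)`: multiplication by `e(-Q(μ))`. -/
def weilT : L.S ≃ₗ[ℂ] L.S where
  toFun φ μ := (L.eQ μ)⁻¹ * φ μ
  invFun φ μ := L.eQ μ * φ μ
  map_add' φ ψ := by ext μ; simp [mul_add]
  map_smul' c φ := by ext μ; simp; ring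
  left_inv φ := by ext μ; simp [L.eQ_ne_zero μ]
  right_inv φ := by ext μ; simp [L.eQ_ne_zero μ]

/-- `ω_M(S)`: the finite Fourier transform
`(ω_M(S)φ)(ν) = √i^(b⁺ - b⁻) / √|M'/M| · ∑_μ e((μ, ν)) φ(μ)`. -/
def weilS : L.S ≃ₗ[ℂ] L.S where
  toFun φ ν := L.weilConst * ∑ μ, L.eB μ ν * φ μ
  invFun φ ν := (L.weilConst * Fintype.card L.Disc)⁻¹ * ∑ μ, L.eB (-μ) ν * φ μ
  map_add' φ ψ := by ext ν; simp [mul_add, Finset.sum_add_distrib]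
  map_smul' c φ := by
    ext ν
    simp only [Pi.smul_apply, smul_eq_mul, RingHom.id_apply, Finset.mul_sum]
    exact Finset.sum_congr rfl fun μ _ => by ring
  left_inv φ := by
    classical
    ext ν
    have hc : (Fintype.card L.Disc : ℂ) ≠ 0 := by exact_mod_cast Fintype.card_ne_zero
    have h : ∀ μ, L.eB (-μ) ν * (L.weilConst * ∑ ρ, L.eB ρ μ * φ ρ) =
        L.weilConst * ∑ ρ, L.eB (ρ - ν) μ * φ ρ := by
      intro μ
      rw [Finset.mul_sum, Finset.mul_sum, Finset.mul_sum]
      refine Finset.sum_congr rfl fun ρ _ => ?_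
      have h1 : L.eB (-μ) ν = L.eB (-ν) μ := by
        have a1 : L.eB (-μ) ν * L.eB μ ν = 1 := by
          rw [L.eB_comm, L.eB_comm μ, ← eB_add, neg_add_cancel, eB_zero]
        have a2 : L.eB (-ν) μ * L.eB μ ν = 1 := by
          rw [L.eB_comm, ← eB_add, neg_add_cancel, eB_zero]
        have a3 : L.eB μ ν ≠ 0 := right_ne_zero_of_mul_eq_one a1
        exact mul_right_cancel₀ a3 (a1.trans a2.symm)
      rw [h1, sub_eq_add_neg, L.eB_comm (ρ + -ν), eB_add, L.eB_comm μ, L.eB_comm μ]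
      ring
    simp only [h]
    rw [← Finset.mul_sum, Finset.sum_comm]
    simp only [← Finset.sum_mul, sum_eB, sub_eq_zero]
    simp only [ite_mul, zero_mul, Finset.sum_ite_eq', Finset.mem_univ, if_true]
    field_simp [L.weilConst_ne_zero]
  right_inv φ := by
    classical
    ext ν
    have hc : (Fintype.card L.Disc : ℂ) ≠ 0 := by exact_mod_cast Fintype.card_ne_zero
    have h : ∀ μ, L.eB μ ν * ((L.weilConst * Fintype.card L.Disc)⁻¹ *
        ∑ ρ, L.eB (-ρ) μ * φ ρ) =
        (L.weilConst * Fintype.card L.Disc)⁻¹ * ∑ ρ, L.eB (ν - ρ) μ * φ ρ := by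
      intro μ
      rw [Finset.mul_sum, Finset.mul_sum, Finset.mul_sum]
      refine Finset.sum_congr rfl fun ρ _ => ?_
      rw [sub_eq_add_neg, L.eB_comm (ν + -ρ), eB_add, L.eB_comm (-ρ)]
      ring
    simp only [h]
    rw [← Finset.mul_sum, Finset.sum_comm]
    simp only [← Finset.sum_mul, sum_eB, sub_eq_zero]
    simp only [ite_mul, zero_mul, Finset.sum_ite_eq, Finset.mem_univ, if_true]
    field_simp [L.weilConst_ne_zero]

/-- The Weil representation `ω_M` of `SL₂(ℤ)` on `S_M`, given by its graph: the subgroup of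
`SL₂(ℤ) × GL(S_M)` generated by `(S, ω_M(S))` and `(T, ω_M(T))`, where `S = (0 -1; 1 0)` and
`T = (1 1; 0 1)` generate `SL₂(ℤ)`. -/
def weilRep : Subgroup (SL(2, ℤ) × (L.S ≃ₗ[ℂ] L.S)) :=
  Subgroup.closure {(ModularGroup.S, L.weilS), (ModularGroup.T, L.weilT)}

/-- Every element of `SL₂(ℤ)` occurs in the graph. -/
lemma exists_mem_weilRep (γ : SL(2, ℤ)) : ∃ A, (γ, A) ∈ L.weilRep := by
  have h : Subgroup.map (MonoidHom.fst _ _) L.weilRep = ⊤ := by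
    rw [weilRep, MonoidHom.map_closure, Set.image_pair]
    exact SpecialLinearGroup.SL2Z_generators
  obtain ⟨⟨γ', A⟩, hA, rfl⟩ := (h ▸ Subgroup.mem_top γ : γ ∈ Subgroup.map _ L.weilRep)
  exact ⟨A, hA⟩

end EvenLattice

/-! ## Vector valued modular forms

A representation `σ` of `SL₂(ℤ)` on a complex vector space `W` enters through its graph, the
subgroup of all `(γ, σ(γ))` in `SL₂(ℤ) × GL(W)`. Analytic conditions on functions with values in
the finite dimensional space `W` are tested by the linear functionals on `W`, that is, coordinate
by coordinate. -/

section Forms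

variable {W : Type*} [AddCommGroup W] [Module ℂ W]

/-- The contragredient `A ↦ (ℓ ↦ ℓ ∘ A⁻¹)`. -/
def contragredient : (W ≃ₗ[ℂ] W) →* (Module.Dual ℂ W ≃ₗ[ℂ] Module.Dual ℂ W) where
  toFun A := A.symm.dualMap
  map_one' := by ext ℓ w; rfl
  map_mul' A A' := by ext ℓ w; rfl

lemma contragredient_apply (A : W ≃ₗ[ℂ] W) (ℓ : Module.Dual ℂ W) (w : W) :
    contragredient A ℓ w = ℓ (A.symm w) := rfl

/-- The graph of the dual representation `σ^∨(γ)(ℓ) = ℓ ∘ σ(γ⁻¹) = ℓ ∘ σ(γ)⁻¹`. -/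
def dualRep (σ : Subgroup (SL(2, ℤ) × (W ≃ₗ[ℂ] W))) :
    Subgroup (SL(2, ℤ) × (Module.Dual ℂ W ≃ₗ[ℂ] Module.Dual ℂ W)) :=
  σ.map (MonoidHom.prodMap (MonoidHom.id _) contragredient)

/-- The transformation law `f(γτ) = (cτ + d)^k σ(γ) f(τ)` for all `γ = (a b; c d) ∈ SL₂(ℤ)`. -/
def IsModular (σ : Subgroup (SL(2, ℤ) × (W ≃ₗ[ℂ] W))) (k : ℤ) (f : ℍ → W) : Prop :=
  ∀ (γ : SL(2, ℤ)) (A : W ≃ₗ[ℂ] W), (γ, A) ∈ σ → ∀ τ : ℍ,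
    f (γ • τ) = (((γ 1 0 : ℤ) : ℂ) * (τ : ℂ) + ((γ 1 1 : ℤ) : ℂ)) ^ k • A (f τ)

/-- `q^m = e^(2πimτ)` for `m ∈ ℚ`. -/
def qPow (m : ℚ) (τ : ℍ) : ℂ := Complex.exp (2 * Real.pi * Complex.I * (m : ℂ) * (τ : ℂ))

/-- The partial derivative `∂/∂u`, where `z = u + iv`. -/
def partialU (F : ℂ → ℂ) (z : ℂ) : ℂ := fderiv ℝ F z 1

/-- The partial derivative `∂/∂v`, where `z = u + iv`. -/
def partialV (F : ℂ → ℂ) (z : ℂ) : ℂ := fderiv ℝ F z Complex.I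

/-- The hyperbolic Laplacian of weight `k`,
`Δ_k = -v² (∂²/∂u² + ∂²/∂v²) + ikv (∂/∂u + i ∂/∂v)`, applied to `h : ℍ → ℂ`. -/
def hypLaplacian (k : ℤ) (h : ℍ → ℂ) (τ : ℍ) : ℂ :=
  let H : ℂ → ℂ := (fun z => h (ofComplex z));
  (-(τ.im : ℂ) ^ 2) * (partialU (partialU H) (τ : ℂ) + partialV (partialV H) (τ : ℂ)) +
    Complex.I * (k : ℂ) * (τ.im : ℂ) * (partialU H (τ : ℂ) + Complex.I * partialV H (τ : ℂ))

/-- Membership in `H_k(σ)`: `f` is a smooth function that transforms like a modular form of weight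
`k` with representation `σ`, is annihilated by `Δ_k`, and agrees with a Fourier polynomial
`P = ∑_{m ≤ 0} P(m) q^m` (a finite sum) up to an error `O(e^(-εv))` as `v → ∞`, for some `ε > 0`. -/
structure IsHarmonicMaassForm (σ : Subgroup (SL(2, ℤ) × (W ≃ₗ[ℂ] W))) (k : ℤ) (f : ℍ → W) :
    Prop where
  modular : IsModular σ k f
  smooth : ∀ ℓ : Module.Dual ℂ W,
    ContDiffOn ℝ ∞ (fun z : ℂ => ℓ (f (ofComplex z))) {z : ℂ | 0 < z.im}
  harmonic : ∀ (ℓ : Module.Dual ℂ W) (τ : ℍ), hypLaplacian k (fun τ' => ℓ (f τ')) τ = 0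
  growth : ∃ P : ℚ →₀ W, (∀ m, 0 < m → P m = 0) ∧ ∃ ε : ℝ, 0 < ε ∧
    ∀ ℓ : Module.Dual ℂ W,
      (fun τ : ℍ => ℓ (f τ - P.sum fun m a => qPow m τ • a)) =O[atImInfty]
        (fun τ : ℍ => Real.exp (-ε * τ.im))

/-- Membership in `M_k(σ)`: `g` is holomorphic on `ℍ`, transforms with weight `k` and
representation `σ`, and is holomorphic (i.e. bounded) at the cusp `i∞`. -/
structure IsHolomorphicForm (σ : Subgroup (SL(2, ℤ) × (W ≃ₗ[ℂ] W))) (k : ℤ) (g : ℍ → W) :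
    Prop where
  modular : IsModular σ k g
  holomorphic : ∀ ℓ : Module.Dual ℂ W,
    DifferentiableOn ℂ (fun z : ℂ => ℓ (g (ofComplex z))) {z : ℂ | 0 < z.im}
  bounded : ∀ ℓ : Module.Dual ℂ W, IsBoundedAtImInfty fun τ => ℓ (g τ)

/-- The incomplete Gamma function `Γ(s, x) = ∫_x^∞ e^(-t) t^(s-1) dt`, for real `s` and `x > 0`. -/
def incGamma (s x : ℝ) : ℝ := ∫ t in Set.Ioi x, Real.exp (-t) * t ^ (s - 1)

/-- The coefficients `c(m)`, `m ∈ ℚ`, are supported on rational numbers with a common denominator. -/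
def BoundedDenominators (c : ℚ → W) : Prop :=
  ∃ N : ℕ, 0 < N ∧ ∀ m, c m ≠ 0 → ∃ n : ℤ, (N : ℚ) * m = n

/-- `f` has the Fourier expansion
`f(τ) = ∑_{m ≫ -∞} c⁺(m) q^m + ∑_{m < 0} c⁻(m) Γ(1 - k, 4π|m|v) q^m`, both series converging
absolutely; `f⁺ = ∑ c⁺(m) q^m` is the holomorphic part. -/
structure HasMaassExpansion (k : ℤ) (f : ℍ → W) (cp cm : ℚ → W) : Prop where
  denom_cp : BoundedDenominators cp
  denom_cm : BoundedDenominators cm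
  cp_bddBelow : ∃ m₀ : ℚ, ∀ m < m₀, cp m = 0
  cm_neg : ∀ m, 0 ≤ m → cm m = 0
  summable_cp : ∀ (ℓ : Module.Dual ℂ W) (τ : ℍ), Summable fun m : ℚ => qPow m τ * ℓ (cp m)
  summable_cm : ∀ (ℓ : Module.Dual ℂ W) (τ : ℍ), Summable fun m : ℚ =>
    (incGamma (1 - k) (4 * Real.pi * |(m : ℝ)| * τ.im) : ℂ) * qPow m τ * ℓ (cm m)
  eq : ∀ (ℓ : Module.Dual ℂ W) (τ : ℍ), ℓ (f τ) = (∑' m : ℚ, qPow m τ * ℓ (cp m)) +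
    ∑' m : ℚ, (incGamma (1 - k) (4 * Real.pi * |(m : ℝ)| * τ.im) : ℂ) * qPow m τ * ℓ (cm m)

/-- `g` has the Fourier expansion `g(τ) = ∑_{m ≥ 0} b(m) q^m`. -/
structure HasQExpansion (g : ℍ → W) (b : ℚ → W) : Prop where
  denom : BoundedDenominators b
  nonneg : ∀ m < 0, b m = 0
  hasSum : ∀ (ℓ : Module.Dual ℂ W) (τ : ℍ), HasSum (fun m : ℚ => qPow m τ * ℓ (b m)) (ℓ (g τ))

/-! ## Formal `q`-series

A formal `q`-series `∑ a(m) q^m` with rational exponents is the function `a` on `ℚ`. -/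

/-- The theta operator `ϑ = q d/dq`. -/
def thetaOp (a : ℚ → W) : ℚ → W := fun m => (m : ℂ) • a m

/-- The formal series `{c, b} = ∑_r (∑_{m + m' = r} {c(m'), b(m)}) q^r`. -/
def pairSeries (c : ℚ → W) (b : ℚ → Module.Dual ℂ W) : ℚ → ℂ :=
  fun r => ∑ᶠ m : ℚ, b m (c (r - m))

/-- The constant term `CT`. -/
def constTerm (h : ℚ → ℂ) : ℂ := h 0

/-- `σ₁(m)` is the sum of the positive divisors of `m > 0`, and `σ₁(0) = -1/24`. -/
def sigmaOne (m : ℕ) : ℂ := if m = 0 then -1 / 24 else ((ArithmeticFunction.sigma 1 m : ℕ) : ℂ)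

/-- The `q`-series of `E₂ = -24 ∑_{m ≥ 0} σ₁(m) q^m`. -/
def eisensteinTwo : ℚ → ℂ :=
  fun m => if m.den = 1 ∧ 0 ≤ m then -24 * sigmaOne m.num.toNat else 0

/-! ## The regularized pairing -/

/-- The standard fundamental domain `|u| ≤ 1/2`, `|τ| ≥ 1` of `SL₂(ℤ)`, truncated at height `T`. -/
def truncatedDomain (T : ℝ) : Set ℍ := {τ | τ ∈ 𝒟 ∧ τ.im ≤ T}

/-- The regularized Petersson pairing `(f, g)^reg = lim_{T → ∞} ∫_{ℱ_T} {f, g} dμ` exists and equals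
`I`. The measure on `ℍ` is the invariant measure `dμ = du dv / v²`. -/
def HasRegPairing (f : ℍ → W) (g : ℍ → Module.Dual ℂ W) (I : ℂ) : Prop :=
  Filter.Tendsto (fun T : ℝ => ∫ τ in truncatedDomain T, g τ (f τ)) Filter.atTop (nhds I)

end Forms

end

/-! ### Wirtinger operators and Stokes' theorem on the truncated fundamental domain -/

noncomputable section

/-! Write D̄ = ∂_u + i∂_v (`wirtingerBar`) and D = ∂_u - i∂_v (`wirtinger`). Then D D̄ is the
euclidean Laplacian, and harmonicity of weight -k reads v·D D̄f = -ik·D̄f. The pairing F = {f, g} is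
an SL₂(ℤ)-invariant function.

For k > 0 let H = {f, g'} with g' = dg/dz = 2πi ϑ(g), and complete it to q = H + (k/2iv)F, which
transforms with weight two. The product rule gives k v⁻²F = D D̄F - 2 D̄q
(`wirtinger_wirtingerBar_sub`), so that F dμ is exact, with a primitive built from the invariant
one-forms D̄F dz̄ and q dz. In Stokes' theorem the vertical sides cancel by T and the arc
contributes zero by S. What remains is -(i/k)(E(T) + 2Q(T)), where E and Q are the integrals of D̄F
and of q over the edge at height T. Replacing f by its polynomial P costs an exponentially small
error, and the correction (k/2iv)F dies out, so Q tends to 2πi CT{f⁺, ϑ(g)}. The limit E → 0 is less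
obvious, because the growth condition says nothing about derivatives of f. It comes from a Tauberian
argument (`tendsto_zero_of_average`): the same identity on rectangles shows that E varies slowly,
while the mean of E over [T, T+1] is, up to a factor, a difference of edge integrals of F, which
converge.

For k = 0 the Weil representation is unitary, so the norm of g is invariant, and the maximum
principle in the cusp disc makes g constant (`eq_const_of_norm_invariant`). Then F is a holomorphic
function plus the conjugate of a holomorphic function vanishing at the cusp, and invariance kills
the second summand (`antiholomorphic_part_eq_zero`). With E₂* = E₂ - 3/(πv), the invariant form E₂*F
dz satisfies D̄(E₂*F) = (3i/π)v⁻²F, and Stokes' theorem applies once more.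

The expansion of f rests on the holomorphy of the conjugate of v⁻ᵏ D̄f: the coefficient A(v) of q^m
has increments κ∫ t^k e^(4πmt) dt. The growth condition forces κ = 0 for m ≥ 0 and produces the
incomplete Gamma function for m < 0. Comparing modes also gives c⁺(m) = P(m) for m ≤ 0, so the
constant terms above depend on P alone. -/

/-- The operator `∂/∂u + i ∂/∂v`, twice the antiholomorphic Wirtinger derivative. -/
def wirtingerBar (F : ℂ → ℂ) (z : ℂ) : ℂ := fderiv ℝ F z 1 + Complex.I * fderiv ℝ F z Complex.I

/-- The operator `∂/∂u - i ∂/∂v`, twice the holomorphic Wirtinger derivative. -/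
def wirtinger (F : ℂ → ℂ) (z : ℂ) : ℂ := fderiv ℝ F z 1 - Complex.I * fderiv ℝ F z Complex.I

lemma isOpen_im_pos : IsOpen {z : ℂ | 0 < z.im} := isOpen_lt continuous_const Complex.continuous_im

lemma ContDiffOn.differentiableAt_im_pos {F : ℂ → ℂ} {n : WithTop ℕ∞} (hn : n ≠ 0)
    (hF : ContDiffOn ℝ n F {z : ℂ | 0 < z.im}) {z : ℂ} (hz : 0 < z.im) :
    DifferentiableAt ℝ F z :=
  (hF.contDiffAt (isOpen_im_pos.mem_nhds hz)).differentiableAt hn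

lemma ContDiffOn.continuousOn_fderiv_im_pos {F : ℂ → ℂ}
    (hF : ContDiffOn ℝ 1 F {z : ℂ | 0 < z.im}) (w : ℂ) :
    ContinuousOn (fun z => fderiv ℝ F z w) {z : ℂ | 0 < z.im} :=
  (hF.continuousOn_fderiv_of_isOpen isOpen_im_pos le_rfl).clm_apply continuousOn_const

lemma ContDiffOn.continuousOn_wirtingerBar {F : ℂ → ℂ}
    (hF : ContDiffOn ℝ 1 F {z : ℂ | 0 < z.im}) :
    ContinuousOn (wirtingerBar F) {z : ℂ | 0 < z.im} :=
  (hF.continuousOn_fderiv_im_pos 1).add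
    (continuousOn_const.mul (hF.continuousOn_fderiv_im_pos Complex.I))

/-- Green's theorem for a `1`-form `Φ dz` on the region between a graph and a horizontal line. -/
lemma integral_wirtingerBar_above_graph {a b T : ℝ} (hab : a ≤ b) {φ φ' φ'' : ℝ → ℝ}
    (hφ : ∀ u ∈ Set.Icc a b, HasDerivAt φ (φ' u) u)
    (hφ' : ∀ u ∈ Set.Icc a b, HasDerivAt φ' (φ'' u) u)
    (hpos : ∀ u ∈ Set.Icc a b, 0 < φ u) (hT : ∀ u ∈ Set.Icc a b, φ u < T)
    {Φ : ℂ → ℂ} (hΦ : ContDiffOn ℝ 1 Φ {z : ℂ | 0 < z.im}) :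
    ∫ u in a..b, ∫ v in (φ u)..T, wirtingerBar Φ (u + v * Complex.I) =
      Complex.I * (∫ u in a..b, Φ (u + T * Complex.I)) -
      Complex.I * (∫ u in a..b, Φ (u + φ u * Complex.I) * (1 + φ' u * Complex.I)) +
      ((∫ s in (0 : ℝ)..1, Φ (b + ((1 - s) * φ b + s * T : ℝ) * Complex.I) * ((T - φ b : ℝ) : ℂ)) -
       ∫ s in (0 : ℝ)..1, Φ (a + ((1 - s) * φ a + s * T : ℝ) * Complex.I) *
        ((T - φ a : ℝ) : ℂ)) := by
  -- The region is parametrized by a rectangle: s moves linearly from the graph (s = 0) to height T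
  -- (s = 1). The Jacobian is T - φ(u), and the pullback of Φ dz is ΦZ_u du + ΦZ_s ds.
  set Z : ℝ × ℝ → ℂ := fun p => p.1 + ((1 - p.2) * φ p.1 + p.2 * T : ℝ) * Complex.I with hZ
  have hZpos : ∀ p ∈ Set.Icc a b ×ˢ Set.Icc (0 : ℝ) 1, 0 < (Z p).im := by
    rintro ⟨u, s⟩ ⟨hu, hs⟩
    simp only [hZ, Complex.add_im, Complex.ofReal_im, Complex.mul_im, Complex.ofReal_re,
      Complex.I_im, Complex.I_re, mul_one, mul_zero, add_zero, zero_add]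
    have h1 := hpos u hu
    have h2 := hT u hu
    have h3 : φ u ≤ (1 - s) * φ u + s * T := by nlinarith [hs.1]
    linarith
  set Zu : ℝ × ℝ → ℂ := fun p => 1 + ((1 - p.2) * φ' p.1 : ℝ) * Complex.I with hZu
  set Zs : ℝ × ℝ → ℂ := fun p => (T - φ p.1 : ℝ) * Complex.I with hZs
  have hc1 : ContinuousOn (fun p : ℝ × ℝ => φ p.1) (Set.Icc a b ×ˢ Set.Icc (0 : ℝ) 1) := by
    have : ContinuousOn φ (Set.Icc a b) := fun u hu => (hφ u hu).continuousAt.continuousWithinAt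
    exact this.comp continuousOn_fst (fun p hp => hp.1)
  have hc2 : ContinuousOn (fun p : ℝ × ℝ => φ' p.1) (Set.Icc a b ×ˢ Set.Icc (0 : ℝ) 1) := by
    have : ContinuousOn φ' (Set.Icc a b) := fun u hu => (hφ' u hu).continuousAt.continuousWithinAt
    exact this.comp continuousOn_fst (fun p hp => hp.1)
  have hZc : ContinuousOn Z (Set.Icc a b ×ˢ Set.Icc (0 : ℝ) 1) := by
    refine ContinuousOn.add (by fun_prop) (ContinuousOn.mul ?_ continuousOn_const)
    exact Complex.continuous_ofReal.comp_continuousOn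
      (((continuousOn_const.sub continuousOn_snd).mul hc1).add
      (continuousOn_snd.mul continuousOn_const))
  have hZuc : ContinuousOn Zu (Set.Icc a b ×ˢ Set.Icc (0 : ℝ) 1) := by
    refine ContinuousOn.add (by fun_prop) (ContinuousOn.mul ?_ continuousOn_const)
    exact Complex.continuous_ofReal.comp_continuousOn
      ((continuousOn_const.sub continuousOn_snd).mul hc2)
  have hZsc : ContinuousOn Zs (Set.Icc a b ×ˢ Set.Icc (0 : ℝ) 1) := by
    refine ContinuousOn.mul ?_ continuousOn_const
    exact Complex.continuous_ofReal.comp_continuousOn (continuousOn_const.sub hc1)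
  have hΦZ : ContinuousOn (fun p => Φ (Z p)) (Set.Icc a b ×ˢ Set.Icc (0 : ℝ) 1) :=
    hΦ.continuousOn.comp hZc hZpos
  have hf1 : ∀ p ∈ Set.Icc a b ×ˢ Set.Icc (0 : ℝ) 1, HasFDerivAt (fun p : ℝ × ℝ => φ p.1)
      (φ' p.1 • ContinuousLinearMap.fst ℝ ℝ ℝ) p := fun p hp =>
    (hφ p.1 hp.1).comp_hasFDerivAt p hasFDerivAt_fst
  have hf2 : ∀ p ∈ Set.Icc a b ×ˢ Set.Icc (0 : ℝ) 1, HasFDerivAt (fun p : ℝ × ℝ => φ' p.1)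
      (φ'' p.1 • ContinuousLinearMap.fst ℝ ℝ ℝ) p := fun p hp =>
    (hφ' p.1 hp.1).comp_hasFDerivAt p hasFDerivAt_fst
  have hdZ : ∀ p ∈ Set.Icc a b ×ˢ Set.Icc (0 : ℝ) 1, ∃ Z' : ℝ × ℝ →L[ℝ] ℂ, HasFDerivAt Z Z' p ∧
      Z' (1, 0) = Zu p ∧ Z' (0, 1) = Zs p := by
    intro p hp
    have h1 := ((((hasFDerivAt_const (1 : ℝ) p).sub (hasFDerivAt_snd (p := p))).mul (hf1 p hp)).add
      ((hasFDerivAt_snd (p := p)).mul_const T))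
    have h2 := (Complex.ofRealCLM.hasFDerivAt.comp p (hasFDerivAt_fst (𝕜 := ℝ) (p := p))).add
      ((Complex.ofRealCLM.hasFDerivAt.comp p h1).mul_const Complex.I)
    refine ⟨_, h2, ?_, ?_⟩
    · simp [hZu]; ring
    · simp [hZs]; ring
  have hdZu : ∀ p ∈ Set.Icc a b ×ˢ Set.Icc (0 : ℝ) 1, ∃ Z' : ℝ × ℝ →L[ℝ] ℂ, HasFDerivAt Zu Z' p ∧
      Z' (0, 1) = - φ' p.1 * Complex.I := by
    intro p hp
    have h1 := (((hasFDerivAt_const (1 : ℝ) p).sub (hasFDerivAt_snd (p := p))).mul (hf2 p hp))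
    have h2 := ((Complex.ofRealCLM.hasFDerivAt.comp p h1).mul_const Complex.I).const_add 1
    refine ⟨_, h2, ?_⟩
    simp [mul_comm]
  have hdZs : ∀ p ∈ Set.Icc a b ×ˢ Set.Icc (0 : ℝ) 1, ∃ Z' : ℝ × ℝ →L[ℝ] ℂ, HasFDerivAt Zs Z' p ∧
      Z' (1, 0) = - φ' p.1 * Complex.I := by
    intro p hp
    have h1 := (hf1 p hp).const_sub T
    have h2 := ((Complex.ofRealCLM.hasFDerivAt.comp p h1).mul_const Complex.I)
    refine ⟨_, h2, ?_⟩
    simp [mul_comm]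
  choose! Z' hZ1 hZ2 hZ3 using hdZ
  choose! Zu' hZu1 hZu2 using hdZu
  choose! Zs' hZs1 hZs2 using hdZs
  have hdΦ : ∀ p ∈ Set.Icc a b ×ˢ Set.Icc (0 : ℝ) 1, HasFDerivAt (fun p => Φ (Z p))
      ((fderiv ℝ Φ (Z p)).comp (Z' p)) p := fun p hp =>
    ((hΦ.differentiableAt_im_pos one_ne_zero (hZpos p hp)).hasFDerivAt).comp p (hZ1 p hp)
  have hI : Set.uIcc a b ×ˢ Set.uIcc (0 : ℝ) 1 = Set.Icc a b ×ˢ Set.Icc (0 : ℝ) 1 := by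
    rw [Set.uIcc_of_le hab, Set.uIcc_of_le zero_le_one]
  have hlin : ∀ (A : ℂ →L[ℝ] ℂ) (x : ℝ), A ((x : ℂ) * Complex.I) = x * A Complex.I := by
    intro A x
    have : (x : ℂ) * Complex.I = x • Complex.I := by simp
    rw [this, map_smul]; simp
  -- This is d of the pullback. The mixed derivatives Z_us cancel and leave the Jacobian times
  -- i·D̄Φ. Both Z_u and Z_s must be differentiable for this, hence the second derivative φ''.
  have hdiv : ∀ p ∈ Set.Icc a b ×ˢ Set.Icc (0 : ℝ) 1,
      (Φ (Z p) • Zs' p + Zs p • (fderiv ℝ Φ (Z p)).comp (Z' p)) (1, 0) +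
      (-(Φ (Z p) • Zu' p + Zu p • (fderiv ℝ Φ (Z p)).comp (Z' p))) (0, 1) =
      Complex.I * ((T - φ p.1 : ℝ) : ℂ) * wirtingerBar Φ (Z p) := by
    intro p hp
    simp only [ContinuousLinearMap.add_apply, ContinuousLinearMap.smul_apply,
      ContinuousLinearMap.neg_apply,
      ContinuousLinearMap.comp_apply, hZ2 p hp, hZ3 p hp, hZs2 p hp, hZu2 p hp, smul_eq_mul, hZu,
      hZs, wirtingerBar, map_add, hlin]
    linear_combination
      (((T - φ p.1 : ℝ) : ℂ)) * (fderiv ℝ Φ (Z p) Complex.I) * ((1 - p.2) * φ' p.1 : ℝ) *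
      (Complex.I_sq) - (((T - φ p.1 : ℝ) : ℂ)) * (fderiv ℝ Φ (Z p) Complex.I) *
        (((1 - p.2) * φ' p.1 : ℝ) + 1) *
      (Complex.I_sq)
  have hint : ContinuousOn (fun p : ℝ × ℝ => Complex.I * ((T - φ p.1 : ℝ) : ℂ) *
      wirtingerBar Φ (Z p)) (Set.Icc a b ×ˢ Set.Icc (0 : ℝ) 1) := by
    refine (continuousOn_const.mul ?_).mul (hΦ.continuousOn_wirtingerBar.comp hZc hZpos)
    exact Complex.continuous_ofReal.comp_continuousOn (continuousOn_const.sub hc1)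
  have hsub : Set.Ioo (min a b) (max a b) ×ˢ Set.Ioo (min (0 : ℝ) 1) (max 0 1) ⊆
      Set.Icc a b ×ˢ Set.Icc (0 : ℝ) 1 := by
    rw [min_eq_left hab, max_eq_right hab, min_eq_left zero_le_one, max_eq_right zero_le_one]
    exact Set.prod_mono Set.Ioo_subset_Icc_self Set.Ioo_subset_Icc_self
  have key := integral2_divergence_prod_of_hasFDerivAt (fun p => Φ (Z p) * Zs p)
    (fun p => -(Φ (Z p) * Zu p))
    (fun p => Φ (Z p) • Zs' p + Zs p • (fderiv ℝ Φ (Z p)).comp (Z' p))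
    (fun p => -(Φ (Z p) • Zu' p + Zu p • (fderiv ℝ Φ (Z p)).comp (Z' p))) a 0 b 1
    (by rw [hI]; exact hΦZ.mul hZsc) (by rw [hI]; exact (hΦZ.mul hZuc).neg)
    (fun p hp => (hdΦ p (hsub hp)).mul (hZs1 p (hsub hp)))
    (fun p hp => ((hdΦ p (hsub hp)).mul (hZu1 p (hsub hp))).neg)
    (by
      rw [hI]
      refine (hint.integrableOn_compact (isCompact_Icc.prod isCompact_Icc)).congr_fun
        (fun p hp => (hdiv p hp).symm) (measurableSet_Icc.prod measurableSet_Icc))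
  -- Undoing the substitution v = (1 - s)φ(u) + sT in each vertical fibre absorbs the Jacobian.
  have hL : ∫ u in a..b, ∫ s in (0 : ℝ)..1,
      ((Φ (Z (u, s)) • Zs' (u, s) + Zs (u, s) • (fderiv ℝ Φ (Z (u, s))).comp (Z' (u, s))) (1, 0) +
      (-(Φ (Z (u, s)) • Zu' (u, s) + Zu (u, s) • (fderiv ℝ Φ (Z (u, s))).comp (Z' (u, s)))) (0, 1))
      = Complex.I * ∫ u in a..b, ∫ v in (φ u)..T, wirtingerBar Φ (u + v * Complex.I) := by
    rw [← intervalIntegral.integral_const_mul]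
    refine intervalIntegral.integral_congr fun u hu => ?_
    rw [Set.uIcc_of_le hab] at hu
    have h1 : ∫ s in (0 : ℝ)..1, ((Φ (Z (u, s)) • Zs' (u, s) +
        Zs (u, s) • (fderiv ℝ Φ (Z (u, s))).comp (Z' (u, s))) (1, 0) +
        (-(Φ (Z (u, s)) • Zu' (u, s) +
          Zu (u, s) • (fderiv ℝ Φ (Z (u, s))).comp (Z' (u, s)))) (0, 1)) =
        ∫ s in (0 : ℝ)..1, Complex.I * ((T - φ u : ℝ) : ℂ) * wirtingerBar Φ (Z (u, s)) := by
      refine intervalIntegral.integral_congr fun s hs => ?_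
      rw [Set.uIcc_of_le zero_le_one] at hs
      exact hdiv (u, s) ⟨hu, hs⟩
    rw [h1, intervalIntegral.integral_const_mul, mul_assoc]
    congr 1
    have hne : T - φ u ≠ 0 := by linarith [hT u hu]
    have h2 := intervalIntegral.integral_comp_mul_add (a := 0) (b := 1)
      (fun v : ℝ => wirtingerBar Φ (u + v * Complex.I)) hne (φ u)
    simp only [mul_zero, zero_add, mul_one, sub_add_cancel] at h2
    rw [← smul_right_injective ℂ (inv_ne_zero hne) |>.eq_iff, ← h2]
    have h3 : (((T - φ u : ℝ) : ℂ)) ≠ 0 := by exact_mod_cast hne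
    rw [Complex.real_smul, ← mul_assoc, Complex.ofReal_inv, inv_mul_cancel₀ h3, one_mul]
    refine intervalIntegral.integral_congr fun s hs => ?_
    simp only [hZ]
    congr 4
    ring
  rw [hL] at key
  have hI2 : Complex.I * Complex.I = -1 := Complex.I_mul_I
  have e1 : ∫ u in a..b, -(Φ (Z (u, 1)) * Zu (u, 1)) = - ∫ u in a..b, Φ (u + T * Complex.I) := by
    rw [← intervalIntegral.integral_neg]
    refine intervalIntegral.integral_congr fun u hu => ?_
    simp [hZ, hZu]
  have e2 : ∫ u in a..b, -(Φ (Z (u, 0)) * Zu (u, 0)) =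
      - ∫ u in a..b, Φ (u + φ u * Complex.I) * (1 + φ' u * Complex.I) := by
    rw [← intervalIntegral.integral_neg]
    refine intervalIntegral.integral_congr fun u hu => ?_
    simp [hZ, hZu]
  have e3 : ∀ c : ℝ, ∫ s in (0 : ℝ)..1, Φ (Z (c, s)) * Zs (c, s) =
      Complex.I * ∫ s in (0 : ℝ)..1, Φ (c + ((1 - s) * φ c + s * T : ℝ) * Complex.I) *
        ((T - φ c : ℝ) : ℂ) := by
    intro c
    rw [← intervalIntegral.integral_const_mul]
    refine intervalIntegral.integral_congr fun u hu => ?_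
    simp only [hZ, hZs]
    ring
  rw [e1, e2, e3, e3] at key
  refine mul_left_cancel₀ Complex.I_ne_zero (key.trans ?_)
  linear_combination (-(∫ u in a..b, Φ (u + T * Complex.I)) +
    (∫ u in a..b, Φ (u + φ u * Complex.I) * (1 + φ' u * Complex.I))) * Complex.I_sq

lemma volume_comap_coe_setIntegral (s : Set ℍ) (G : ℂ → ℂ) :
    ∫ τ in s, G τ ∂((volume : Measure ℂ).comap UpperHalfPlane.coe) =
      ∫ z in UpperHalfPlane.coe '' s, G z := by
  have h := measurableEmbedding_coe.setIntegral_map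
    (μ := (volume : Measure ℂ).comap UpperHalfPlane.coe) G (UpperHalfPlane.coe '' s)
  rw [Set.preimage_image_eq _ UpperHalfPlane.coe_injective, measurableEmbedding_coe.map_comap,
    Measure.restrict_restrict' measurableEmbedding_coe.measurableSet_range,
    Set.inter_eq_self_of_subset_left (Set.image_subset_range _ _)] at h
  exact h.symm

lemma coe_image_truncatedDomain (T : ℝ) : UpperHalfPlane.coe '' truncatedDomain T =
    {z : ℂ | 0 ≤ z.im ∧ z.im ≤ T ∧ |z.re| ≤ 1 / 2 ∧ 1 ≤ ‖z‖} :=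
  ModularGroup.coe_truncatedFundamentalDomain T

/-- Integration over the truncated fundamental domain in cartesian coordinates. -/
lemma setIntegral_truncatedDomain {F : ℂ → ℂ} (hF : ContinuousOn F {z : ℂ | 0 < z.im}) {T : ℝ}
    (hT : 1 ≤ T) :
    ∫ τ in truncatedDomain T, F τ = ∫ u in (-(1 / 2) : ℝ)..(1 / 2),
      ∫ v in (√(1 - u ^ 2))..T, ((v : ℂ) ^ 2)⁻¹ * F (u + v * Complex.I) := by
  have hcomp : IsCompact (truncatedDomain T) := ModularGroup.isCompact_truncatedFundamentalDomain T
  have hmeas : MeasurableSet (truncatedDomain T) := hcomp.measurableSet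
  have h1 : ∫ τ in truncatedDomain T, F τ =
      ∫ z in UpperHalfPlane.coe '' truncatedDomain T, ((z.im : ℂ) ^ 2)⁻¹ * F z := by
    rw [volume_def, setIntegral_withDensity_eq_setIntegral_smul _ _ hmeas,
      ← volume_comap_coe_setIntegral]
    · refine setIntegral_congr_fun hmeas fun τ _ => ?_
      simp only [NNReal.smul_def, Complex.real_smul]
      simp
    · refine Measurable.pow_const (Measurable.div measurable_const ?_) 2
      exact UpperHalfPlane.continuous_im.measurable.subtype_mk
  rw [h1, coe_image_truncatedDomain]
  set K : Set ℂ := {z : ℂ | 0 ≤ z.im ∧ z.im ≤ T ∧ |z.re| ≤ 1 / 2 ∧ 1 ≤ ‖z‖} with hK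
  have hKc : IsCompact K := by
    rw [hK, ← coe_image_truncatedDomain]; exact hcomp.image UpperHalfPlane.continuous_coe
  have hKpos : K ⊆ {z : ℂ | 0 < z.im} := by
    rw [hK, ← coe_image_truncatedDomain]; rintro _ ⟨τ, -, rfl⟩; exact τ.im_pos
  have hint : IntegrableOn (fun z : ℂ => ((z.im : ℂ) ^ 2)⁻¹ * F z) K := by
    refine ContinuousOn.integrableOn_compact hKc (ContinuousOn.mul ?_ (hF.mono hKpos))
    refine ContinuousOn.inv₀ (by fun_prop) fun z hz => ?_
    have : z.im ≠ 0 := (hKpos hz).ne'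
    exact pow_ne_zero _ (by exact_mod_cast this)
  rw [← integral_indicator hKc.measurableSet]
  rw [← Complex.volume_preserving_equiv_real_prod.symm.integral_comp
    Complex.measurableEquivRealProd.symm.measurableEmbedding]
  have hint2 := (Complex.volume_preserving_equiv_real_prod.symm.integrable_comp_emb
    Complex.measurableEquivRealProd.symm.measurableEmbedding).mpr
    ((integrable_indicator_iff hKc.measurableSet).mpr hint)
  rw [Measure.volume_eq_prod]
  refine (integral_prod _ hint2).trans ?_
  rw [intervalIntegral.integral_of_le (by norm_num), ← integral_Icc_eq_integral_Ioc,
    ← integral_indicator measurableSet_Icc]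
  refine integral_congr_ae (Filter.Eventually.of_forall fun u => ?_)
  simp only [Function.comp_apply, Complex.measurableEquivRealProd_symm_apply]
  by_cases hu : u ∈ Set.Icc (-(1 / 2) : ℝ) (1 / 2)
  · rw [Set.indicator_of_mem hu]
    have hsq : √(1 - u ^ 2) ≤ T := by
      refine (Real.sqrt_le_one.mpr ?_).trans hT
      nlinarith [sq_nonneg u]
    rw [intervalIntegral.integral_of_le hsq, ← integral_Icc_eq_integral_Ioc,
      ← integral_indicator measurableSet_Icc]
    refine integral_congr_ae (Filter.Eventually.of_forall fun v => ?_)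
    -- For |u| ≤ 1/2 the vertical slice of the domain is exactly the interval from the unit circle
    -- up to T.
    have hiff : (⟨u, v⟩ : ℂ) ∈ K ↔ v ∈ Set.Icc (√(1 - u ^ 2)) T := by
      have h1 : |u| ≤ 1 / 2 := abs_le.mpr hu
      simp only [hK, Set.mem_ofPred_eq, Set.mem_Icc, h1, true_and]
      have h2 : ‖(⟨u, v⟩ : ℂ)‖ = √(u ^ 2 + v ^ 2) := by
        rw [Complex.norm_def, Complex.normSq_mk]; congr 1; ring
      rw [h2, Real.one_le_sqrt]
      constructor
      · rintro ⟨h3, h4, h5⟩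
        exact ⟨Real.sqrt_le_left h3 |>.mpr (by linarith) , h4⟩
      · rintro ⟨h3, h4⟩
        have h0 : 0 ≤ v := (Real.sqrt_nonneg _).trans h3
        have := (Real.sqrt_le_left h0).mp h3
        exact ⟨h0, h4, by linarith⟩
    beta_reduce
    by_cases hv : v ∈ Set.Icc (√(1 - u ^ 2)) T
    · rw [Set.indicator_of_mem (hiff.mpr hv), Set.indicator_of_mem hv]
      rw [Complex.mk_eq_add_mul_I]; simp
    · rw [Set.indicator_of_notMem (fun h => hv (hiff.mp h)), Set.indicator_of_notMem hv]
  · rw [Set.indicator_of_notMem hu]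
    refine integral_eq_zero_of_ae (Filter.Eventually.of_forall fun v => ?_)
    refine Set.indicator_of_notMem (fun h => hu (abs_le.mp h.2.2.1)) _

lemma one_sub_sq_pos_of_mem {u : ℝ} (hu : u ∈ Set.Icc (-(1 / 2) : ℝ) (1 / 2)) :
    0 < 1 - u ^ 2 := by nlinarith [hu.1, hu.2]

lemma im_ofReal_add_mul_I (u v : ℝ) : ((u : ℂ) + v * Complex.I).im = v := by simp

/-- Stokes' theorem for a modular `1`-form `Φ dz` of weight two on the truncated fundamental
domain: only the upper edge contributes. -/
lemma integral_wirtingerBar_fundamentalDomain {Φ : ℂ → ℂ}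
    (hΦ : ContDiffOn ℝ 1 Φ {z : ℂ | 0 < z.im}) (hT1 : ∀ z : ℂ, 0 < z.im → Φ (z + 1) = Φ z)
    (hS : ∀ z : ℂ, 0 < z.im → Φ (-z⁻¹) = z ^ 2 * Φ z) {T : ℝ} (hT : 1 < T) :
    ∫ u in (-(1 / 2) : ℝ)..(1 / 2), ∫ v in (√(1 - u ^ 2))..T,
      wirtingerBar Φ (u + v * Complex.I) =
      Complex.I * ∫ u in (-(1 / 2) : ℝ)..(1 / 2), Φ (u + T * Complex.I) := by
  have hφ : ∀ u ∈ Set.Icc (-(1 / 2) : ℝ) (1 / 2),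
      HasDerivAt (fun u : ℝ => √(1 - u ^ 2)) (-u / √(1 - u ^ 2)) u := by
    intro u hu
    have h := ((hasDerivAt_pow 2 u).const_sub 1).sqrt (one_sub_sq_pos_of_mem hu).ne'
    convert! h using 1
    have := (Real.sqrt_pos.mpr (one_sub_sq_pos_of_mem hu)).ne'
    field_simp
    simp [mul_comm]
  have hφ' : ∀ u ∈ Set.Icc (-(1 / 2) : ℝ) (1 / 2),
      HasDerivAt (fun u : ℝ => -u / √(1 - u ^ 2)) (deriv (fun u : ℝ => -u / √(1 - u ^ 2)) u) u := by
    intro u hu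
    refine DifferentiableAt.hasDerivAt ?_
    exact differentiableAt_id.neg.div (hφ u hu).differentiableAt
      (Real.sqrt_pos.mpr (one_sub_sq_pos_of_mem hu)).ne'
  rw [integral_wirtingerBar_above_graph (by norm_num) hφ hφ'
    (fun u hu => Real.sqrt_pos.mpr (one_sub_sq_pos_of_mem hu))
    (fun u hu => (Real.sqrt_le_one.mpr (by nlinarith [sq_nonneg u])).trans_lt hT) hΦ]
  -- On the unit circle -z⁻¹ is the reflection u ↦ -u, and weight two turns Φ dz into its negative
  -- under this change of variable. The integral over the symmetric arc therefore equals its own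
  -- negative.
  have harc : ∫ u in (-(1 / 2) : ℝ)..(1 / 2), Φ (u + (√(1 - u ^ 2) : ℝ) * Complex.I) *
      (1 + ((-u / √(1 - u ^ 2) : ℝ) : ℂ) * Complex.I) = 0 := by
    have h := intervalIntegral.integral_comp_neg (a := (-(1 / 2) : ℝ)) (b := 1 / 2)
      (fun u : ℝ => Φ (u + (√(1 - u ^ 2) : ℝ) * Complex.I) *
      (1 + ((-u / √(1 - u ^ 2) : ℝ) : ℂ) * Complex.I))
    rw [neg_neg] at h
    have h2 : ∫ u in (-(1 / 2) : ℝ)..(1 / 2), Φ ((-u : ℝ) + (√(1 - (-u) ^ 2) : ℝ) * Complex.I) *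
        (1 + ((-(-u) / √(1 - (-u) ^ 2) : ℝ) : ℂ) * Complex.I) =
        ∫ u in (-(1 / 2) : ℝ)..(1 / 2), -(Φ (u + (√(1 - u ^ 2) : ℝ) * Complex.I) *
        (1 + ((-u / √(1 - u ^ 2) : ℝ) : ℂ) * Complex.I)) := by
      refine intervalIntegral.integral_congr fun u hu => ?_
      rw [Set.uIcc_of_le (by norm_num)] at hu
      have hp := Real.sqrt_pos.mpr (one_sub_sq_pos_of_mem hu)
      have hsq : (√(1 - u ^ 2)) ^ 2 = 1 - u ^ 2 := Real.sq_sqrt (one_sub_sq_pos_of_mem hu).le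
      simp only [neg_sq, neg_neg]
      set r := √(1 - u ^ 2) with hr
      have hne : (r : ℂ) ≠ 0 := by exact_mod_cast hp.ne'
      have hsqc : (r : ℂ) ^ 2 = 1 - (u : ℂ) ^ 2 := by exact_mod_cast hsq
      have hγ : -((u : ℂ) + r * Complex.I)⁻¹ = ((-u : ℝ) : ℂ) + r * Complex.I := by
        rw [neg_eq_iff_eq_neg]
        refine inv_eq_of_mul_eq_one_right ?_
        push_cast
        linear_combination -(r : ℂ) ^ 2 * Complex.I_sq + hsqc
      rw [← hγ, hS _ (by rw [im_ofReal_add_mul_I]; exact hp)]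
      push_cast
      field_simp
      ring_nf
      simp only [Complex.I_sq, show Complex.I ^ 3 = -Complex.I by
        rw [pow_succ, Complex.I_sq]; ring]
      have h3 : (r : ℂ) ^ 3 = r * (1 - (u : ℂ) ^ 2) := by rw [← hsqc]; ring
      rw [h3, hsqc]
      ring
    rw [h2, intervalIntegral.integral_neg] at h
    exact self_eq_neg.mp h.symm
  rw [harc, mul_zero, sub_zero]
  -- The sides u = ±1/2 differ by the translation T and start at the same height on the circle.
  have hside : ∀ s : ℝ, s ∈ Set.uIcc (0 : ℝ) 1 →
      Φ ((1 / 2 : ℝ) + ((1 - s) * √(1 - (1 / 2) ^ 2) + s * T : ℝ) * Complex.I) *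
        ((T - √(1 - (1 / 2) ^ 2) : ℝ) : ℂ) =
      Φ ((-(1 / 2) : ℝ) + ((1 - s) * √(1 - (-(1 / 2)) ^ 2) + s * T : ℝ) * Complex.I) *
        ((T - √(1 - (-(1 / 2)) ^ 2) : ℝ) : ℂ) := by
    intro s hs
    rw [Set.uIcc_of_le zero_le_one] at hs
    rw [neg_sq, ← hT1 (((-(1 / 2) : ℝ) : ℂ) + _)]
    · congr 2
      push_cast
      ring
    · rw [im_ofReal_add_mul_I]
      have : 0 < √(1 - (1 / 2 : ℝ) ^ 2) := Real.sqrt_pos.mpr (by norm_num)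
      rcases hs.1.eq_or_lt with h | h
      · rw [← h]; simpa using this
      · have h1 : 0 ≤ (1 - s) * √(1 - (1 / 2 : ℝ) ^ 2) := mul_nonneg (by linarith [hs.2]) this.le
        have h2 : 0 < s * T := by positivity
        linarith
  rw [intervalIntegral.integral_congr hside, sub_self, add_zero]

lemma fderiv_conj_comp {F : ℂ → ℂ} {z : ℂ} (hF : DifferentiableAt ℝ F z) (w : ℂ) :
    fderiv ℝ (fun z => (starRingEnd ℂ) (F z)) z w = (starRingEnd ℂ) (fderiv ℝ F z w) := by
  have h := (Complex.conjCLE.toContinuousLinearMap.hasFDerivAt.comp z hF.hasFDerivAt)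
  have h2 : HasFDerivAt (fun z => (starRingEnd ℂ) (F z))
    (Complex.conjCLE.toContinuousLinearMap.comp (fderiv ℝ F z)) z := h
  rw [h2.fderiv]
  rfl

lemma wirtingerBar_conj {F : ℂ → ℂ} {z : ℂ} (hF : DifferentiableAt ℝ F z) :
    wirtingerBar (fun z => (starRingEnd ℂ) (F z)) z = (starRingEnd ℂ) (wirtinger F z) := by
  rw [wirtingerBar, wirtinger, fderiv_conj_comp hF, fderiv_conj_comp hF]
  simp

lemma intervalIntegral_conj (F : ℝ → ℂ) (a b : ℝ) :
    ∫ u in a..b, (starRingEnd ℂ) (F u) = (starRingEnd ℂ) (∫ u in a..b, F u) := by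
  simp only [intervalIntegral, integral_conj, map_sub]

/-- Stokes' theorem for a modular `1`-form `Ψ dz̄` on the truncated fundamental domain. -/
lemma integral_wirtinger_fundamentalDomain {Ψ : ℂ → ℂ}
    (hΨ : ContDiffOn ℝ 1 Ψ {z : ℂ | 0 < z.im}) (hT1 : ∀ z : ℂ, 0 < z.im → Ψ (z + 1) = Ψ z)
    (hS : ∀ z : ℂ, 0 < z.im → Ψ (-z⁻¹) = (starRingEnd ℂ z) ^ 2 * Ψ z) {T : ℝ} (hT : 1 < T) :
    ∫ u in (-(1 / 2) : ℝ)..(1 / 2), ∫ v in (√(1 - u ^ 2))..T,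
      wirtinger Ψ (u + v * Complex.I) =
      -Complex.I * ∫ u in (-(1 / 2) : ℝ)..(1 / 2), Ψ (u + T * Complex.I) := by
  -- Complex conjugation exchanges Ψ dz̄ with a form of type dz and D with D̄.
  have h := integral_wirtingerBar_fundamentalDomain
    (Φ := fun z => (starRingEnd ℂ) (Ψ z))
    (Complex.conjCLE.contDiff.comp_contDiffOn hΨ) (fun z hz => by rw [hT1 z hz])
    (fun z hz => by rw [hS z hz]; simp) hT
  rw [intervalIntegral_conj] at h
  have h2 : ∫ u in (-(1 / 2) : ℝ)..(1 / 2), ∫ v in (√(1 - u ^ 2))..T,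
      wirtingerBar (fun z => (starRingEnd ℂ) (Ψ z)) (u + v * Complex.I) =
      (starRingEnd ℂ) (∫ u in (-(1 / 2) : ℝ)..(1 / 2), ∫ v in (√(1 - u ^ 2))..T,
        wirtinger Ψ (u + v * Complex.I)) := by
    rw [← intervalIntegral_conj]
    refine intervalIntegral.integral_congr fun u hu => ?_
    rw [Set.uIcc_of_le (by norm_num)] at hu
    rw [← intervalIntegral_conj]
    refine intervalIntegral.integral_congr fun v hv => ?_
    have hp := Real.sqrt_pos.mpr (one_sub_sq_pos_of_mem hu)
    rw [Set.uIcc_of_le ((Real.sqrt_le_one.mpr (by nlinarith [sq_nonneg u])).trans hT.le)] at hv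
    refine wirtingerBar_conj (hΨ.differentiableAt_im_pos one_ne_zero ?_)
    rw [im_ofReal_add_mul_I]
    exact hp.trans_le hv.1
  rw [h2] at h
  have h3 := congrArg (starRingEnd ℂ) h
  rw [map_mul, Complex.conj_conj, Complex.conj_conj, Complex.conj_I] at h3
  exact h3

/-! ### Exponential series with rational exponents -/

/-- `q^m = e^(2πimz)` as a function on the complex plane. -/
def qExp (m : ℚ) (z : ℂ) : ℂ := Complex.exp (2 * Real.pi * Complex.I * (m : ℂ) * z)

lemma qPow_eq_qExp (m : ℚ) (τ : ℍ) : qPow m τ = qExp m τ := rfl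

lemma qExp_zero (z : ℂ) : qExp 0 z = 1 := by simp [qExp]

lemma qExp_add (m r : ℚ) (z : ℂ) : qExp (m + r) z = qExp m z * qExp r z := by
  simp only [qExp, ← Complex.exp_add]
  congr 1
  push_cast
  ring

lemma qExp_arg_add (m : ℚ) (z w : ℂ) : qExp m (z + w) = qExp m z * qExp m w := by
  simp only [qExp, ← Complex.exp_add]
  congr 1
  ring

lemma norm_qExp (m : ℚ) (z : ℂ) : ‖qExp m z‖ = Real.exp (-2 * Real.pi * m * z.im) := by
  rw [qExp, Complex.norm_exp]
  congr 1
  have : (2 * Real.pi * Complex.I * (m : ℂ) * z) =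
      ((2 * Real.pi * (m : ℝ) : ℝ) : ℂ) * (Complex.I * z) := by push_cast; ring
  rw [this, Complex.re_ofReal_mul]
  simp

lemma norm_qExp_add_mul_I (m : ℚ) (u v : ℝ) :
    ‖qExp m (u + v * Complex.I)‖ = Real.exp (-2 * Real.pi * m * v) := by
  rw [norm_qExp, im_ofReal_add_mul_I]

lemma hasDerivAt_qExp (m : ℚ) (z : ℂ) :
    HasDerivAt (qExp m) (2 * Real.pi * Complex.I * (m : ℂ) * qExp m z) z := by
  have h := ((hasDerivAt_id z).const_mul (2 * Real.pi * Complex.I * (m : ℂ))).cexp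
  simp only [id, mul_one] at h
  rw [mul_comm]
  exact h

lemma differentiable_qExp (m : ℚ) : Differentiable ℂ (qExp m) := fun z =>
  (hasDerivAt_qExp m z).differentiableAt

lemma continuous_qExp (m : ℚ) : Continuous (qExp m) := (differentiable_qExp m).continuous

lemma qExp_of_mul_int {m : ℚ} {N : ℕ} (h : ∃ n : ℤ, (N : ℚ) * m = n) : qExp m N = 1 := by
  obtain ⟨n, hn⟩ := h
  rw [qExp, Complex.exp_eq_one_iff]
  refine ⟨n, ?_⟩
  have : (N : ℂ) * m = n := by exact_mod_cast hn
  linear_combination (2 * Real.pi * Complex.I) * this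

lemma integral_qExp {m : ℚ} {N : ℕ} (h : ∃ n : ℤ, (N : ℚ) * m = n) (a v : ℝ) :
    ∫ u in a..a + N, qExp m (u + v * Complex.I) = if m = 0 then (N : ℂ) else 0 := by
  split_ifs with h0
  · subst h0
    simp [qExp_zero]
  · have hc : (2 * Real.pi * Complex.I * (m : ℂ)) ≠ 0 :=
      mul_ne_zero Complex.two_pi_I_ne_zero (by exact_mod_cast h0)
    have hd : ∀ u ∈ Set.uIcc a (a + N), HasDerivAt
        (fun u : ℝ => (2 * Real.pi * Complex.I * (m : ℂ))⁻¹ * qExp m (u + v * Complex.I))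
        (qExp m (u + v * Complex.I)) u := by
      intro u _
      have h1 := (hasDerivAt_qExp m (u + v * Complex.I)).comp (u : ℂ)
        ((hasDerivAt_id (u : ℂ)).add_const (v * Complex.I))
      have h2 := (h1.comp_ofReal).const_mul (2 * Real.pi * Complex.I * (m : ℂ))⁻¹
      convert! h2 using 1
      field_simp
    rw [intervalIntegral.integral_eq_sub_of_hasDerivAt hd
      (Continuous.intervalIntegrable ((continuous_qExp m).comp (by fun_prop)) _ _)]
    have : ((a + N : ℝ) : ℂ) + v * Complex.I = (a + v * Complex.I) + N := by push_cast; ring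
    rw [this, qExp_arg_add, qExp_of_mul_int h, mul_one, sub_self]

/-- The constant Fourier coefficient of an absolutely convergent exponential series. -/
lemma integral_of_hasSum_qExp {N : ℕ} {C : ℚ → ℂ} {v : ℝ}
    (hC : Summable fun m : ℚ => ‖C m * qExp m (v * Complex.I)‖)
    (hN : ∀ m, C m ≠ 0 → ∃ n : ℤ, (N : ℚ) * m = n) {h : ℝ → ℂ}
    (hh : ∀ u : ℝ, HasSum (fun m => C m * qExp m (u + v * Complex.I)) (h u)) (a : ℝ) :
    ∫ u in a..a + N, h u = N * C 0 := by
  have h1 : HasSum (fun m : ℚ => ∫ u in a..a + N, C m * qExp m (u + v * Complex.I))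
      (∫ u in a..a + N, h u) := by
    refine intervalIntegral.hasSum_integral_of_dominated_convergence
      (fun m _ => ‖C m * qExp m (v * Complex.I)‖) (fun m => ?_) (fun m => ?_) ?_ ?_ ?_
    · exact (continuous_const.mul ((continuous_qExp m).comp (by fun_prop))).aestronglyMeasurable
    · refine Filter.Eventually.of_forall fun u _ => ?_
      rw [norm_mul, norm_mul, norm_qExp, norm_qExp, im_ofReal_add_mul_I]
      simp
    · exact Filter.Eventually.of_forall fun u _ => hC
    · exact intervalIntegrable_const
    · exact Filter.Eventually.of_forall fun u _ => hh u
  have h2 : ∀ m : ℚ, m ≠ 0 → ∫ u in a..a + N, C m * qExp m (u + v * Complex.I) = 0 := by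
    intro m hm
    rw [intervalIntegral.integral_const_mul]
    by_cases hc : C m = 0
    · rw [hc, zero_mul]
    · rw [integral_qExp (hN m hc), if_neg hm, mul_zero]
  rw [← h1.tsum_eq, tsum_eq_single 0 h2, intervalIntegral.integral_const_mul,
    integral_qExp ⟨0, by simp⟩, if_pos rfl, mul_comm]

section Series

variable {c : ℚ → ℂ}

lemma summable_qExp_of_summable_qPow (h : ∀ τ : ℍ, Summable fun m : ℚ => qPow m τ * c m)
    {z : ℂ} (hz : 0 < z.im) : Summable fun m : ℚ => qExp m z * c m := h ⟨z, hz⟩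

/-- |q^m| is monotone in Im z, in a direction depending on the sign of m, so on a strip one of the
two edges dominates. This supplies the Weierstrass bound for exponents of both signs at once. -/
lemma norm_qExp_mul_le_add {m : ℚ} {x y : ℝ} {z : ℂ} (hx : x ≤ z.im) (hy : z.im ≤ y) (a : ℂ) :
    ‖qExp m z * a‖ ≤ ‖qExp m (x * Complex.I) * a‖ + ‖qExp m (y * Complex.I) * a‖ := by
  rw [norm_mul, norm_mul, norm_mul, ← add_mul]
  refine mul_le_mul_of_nonneg_right ?_ (norm_nonneg _)
  simp only [norm_qExp, Complex.mul_im, Complex.ofReal_re, Complex.I_im, mul_one,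
    Complex.ofReal_im, Complex.I_re, mul_zero, add_zero]
  have hpi := Real.pi_pos
  rcases le_total 0 m with hm | hm
  · have hm' : (0 : ℝ) ≤ m := by exact_mod_cast hm
    have : -2 * Real.pi * m * z.im ≤ -2 * Real.pi * m * x := by
      nlinarith [mul_le_mul_of_nonneg_left hx (mul_nonneg hpi.le hm')]
    exact (Real.exp_le_exp.mpr this).trans (le_add_of_nonneg_right (Real.exp_pos _).le)
  · have hm' : (m : ℝ) ≤ 0 := by exact_mod_cast hm
    have : -2 * Real.pi * m * z.im ≤ -2 * Real.pi * m * y := by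
      nlinarith [mul_le_mul_of_nonpos_left hy (mul_nonpos_of_nonneg_of_nonpos hpi.le hm')]
    exact (Real.exp_le_exp.mpr this).trans (le_add_of_nonneg_left (Real.exp_pos _).le)

lemma isOpen_strip (x y : ℝ) : IsOpen {z : ℂ | x < z.im ∧ z.im < y} :=
  (isOpen_lt continuous_const Complex.continuous_im).inter
    (isOpen_lt Complex.continuous_im continuous_const)

lemma summable_strip_bound (h : ∀ τ : ℍ, Summable fun m : ℚ => qPow m τ * c m) {x y : ℝ}
    (hx : 0 < x) (hy : 0 < y) : Summable fun m : ℚ =>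
      ‖qExp m (x * Complex.I) * c m‖ + ‖qExp m (y * Complex.I) * c m‖ :=
  (summable_qExp_of_summable_qPow h (by simpa using hx)).norm.add
    (summable_qExp_of_summable_qPow h (by simpa using hy)).norm

lemma differentiableOn_tsum_qExp (h : ∀ τ : ℍ, Summable fun m : ℚ => qPow m τ * c m) :
    DifferentiableOn ℂ (fun z => ∑' m : ℚ, qExp m z * c m) {z : ℂ | 0 < z.im} := by
  intro z hz
  have hz' : 0 < z.im := hz
  have hd := Complex.differentiableOn_tsum_of_summable_norm
    (F := fun (m : ℚ) z => qExp m z * c m) (summable_strip_bound h (half_pos hz') (by positivity :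
      0 < 2 * z.im)) (fun m => ((differentiable_qExp m).mul_const _).differentiableOn)
    (isOpen_strip (z.im / 2) (2 * z.im)) (fun m w hw => norm_qExp_mul_le_add hw.1.le hw.2.le _)
  exact (hd.differentiableAt ((isOpen_strip _ _).mem_nhds
    ⟨by linarith, by linarith⟩)).differentiableWithinAt

lemma hasSum_deriv_tsum_qExp (h : ∀ τ : ℍ, Summable fun m : ℚ => qPow m τ * c m) {z : ℂ}
    (hz : 0 < z.im) :
    HasSum (fun m : ℚ => qExp m z * (2 * Real.pi * Complex.I * (m : ℂ) * c m))
      (deriv (fun z => ∑' m : ℚ, qExp m z * c m) z) := by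
  have hd := Complex.hasSum_deriv_of_summable_norm (z := z)
    (F := fun (m : ℚ) z => qExp m z * c m) (summable_strip_bound h (half_pos hz) (by positivity :
      0 < 2 * z.im)) (fun m => ((differentiable_qExp m).mul_const _).differentiableOn)
    (isOpen_strip (z.im / 2) (2 * z.im)) (fun m w hw => norm_qExp_mul_le_add hw.1.le hw.2.le _)
    ⟨by linarith, by linarith⟩
  have he : (fun m : ℚ => qExp m z * (2 * Real.pi * Complex.I * (m : ℂ) * c m)) =
      fun m : ℚ => deriv (fun z => qExp m z * c m) z := by
    funext m
    rw [((hasDerivAt_qExp m z).mul_const (c m)).deriv]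
    ring
  rw [he]
  exact hd

end Series

/-! ### Fourier coefficients of periodic functions on the upper half plane -/

/-- The coefficient of `q^m` at height `v` of a function of period `N`. -/
def fourierMode (N : ℕ) (h : ℂ → ℂ) (m : ℚ) (v : ℝ) : ℂ :=
  (N : ℂ)⁻¹ * ∫ u in (0 : ℝ)..N, h (u + v * Complex.I) * qExp (-m) (u + v * Complex.I)

lemma continuous_horizontal {h : ℂ → ℂ} (hh : ContinuousOn h {z : ℂ | 0 < z.im}) {v : ℝ}
    (hv : 0 < v) : Continuous fun u : ℝ => h (u + v * Complex.I) :=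
  hh.comp_continuous (by fun_prop) fun u => by
    rw [Set.mem_ofPred_eq, im_ofReal_add_mul_I]; exact hv

/-- Multiplying by q^(-m) and shifting the index moves the coefficient of q^m to exponent zero,
where integration over a period isolates it. -/
lemma fourierMode_of_hasSum {N : ℕ} (hN : 0 < N) {C : ℚ → ℂ} {v : ℝ} {h : ℂ → ℂ}
    (hsup : ∀ m, C m ≠ 0 → ∃ n : ℤ, (N : ℚ) * m = n)
    (hh : ∀ u : ℝ, HasSum (fun m => qExp m (u + v * Complex.I) * C m) (h (u + v * Complex.I)))
    {m : ℚ} (hm : ∃ n : ℤ, (N : ℚ) * m = n) : fourierMode N h m v = C m := by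
  have hN' : (N : ℂ) ≠ 0 := by exact_mod_cast hN.ne'
  have hshift : ∀ u : ℝ, HasSum (fun r => C (r + m) * qExp r (u + v * Complex.I))
      (h (u + v * Complex.I) * qExp (-m) (u + v * Complex.I)) := by
    intro u
    have h1 := (hh u).mul_right (qExp (-m) (u + v * Complex.I))
    rw [← (Equiv.addRight m).hasSum_iff] at h1
    refine h1.congr_fun ?_
    intro r
    simp only [Function.comp_apply, Equiv.coe_addRight]
    have : qExp r (u + v * Complex.I) =
        qExp (r + m) (u + v * Complex.I) * qExp (-m) (u + v * Complex.I) := by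
      rw [← qExp_add]; congr 1; ring
    rw [this]; ring
  have h0 := (hshift 0).summable.norm
  simp only [Complex.ofReal_zero, zero_add] at h0
  have := integral_of_hasSum_qExp (N := N) (C := fun r => C (r + m)) (v := v) h0 (fun r hr => by
    obtain ⟨a, ha⟩ := hsup _ hr
    obtain ⟨b, hb⟩ := hm
    refine ⟨a - b, ?_⟩
    push_cast
    rw [← ha, ← hb]; ring) hshift 0
  rw [zero_add] at this
  rw [fourierMode, this, zero_add, inv_mul_cancel_left₀ hN']

lemma fourierMode_finsuppSum {N : ℕ} (hN : 0 < N) (p : ℚ →₀ ℂ)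
    (hsup : ∀ m, p m ≠ 0 → ∃ n : ℤ, (N : ℚ) * m = n) {m : ℚ} (hm : ∃ n : ℤ, (N : ℚ) * m = n)
    (v : ℝ) : fourierMode N (fun z => p.sum fun r a => qExp r z * a) m v = p m := by
  refine fourierMode_of_hasSum hN hsup (fun u => ?_) hm
  refine hasSum_sum_of_ne_finset_zero fun r hr => ?_
  rw [Finsupp.notMem_support_iff.mp hr, mul_zero]

/-- A function which agrees with an exponential polynomial `p` up to `O(e^(-εv))` has Fourier
coefficients close to those of `p`. -/
lemma norm_fourierMode_sub_le {N : ℕ} (hN : 0 < N) {p : ℚ →₀ ℂ}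
    (hsup : ∀ m, p m ≠ 0 → ∃ n : ℤ, (N : ℚ) * m = n) {h : ℂ → ℂ}
    (hh : ContinuousOn h {z : ℂ | 0 < z.im}) {K ε v₀ : ℝ} (hv₀ : 0 < v₀)
    (hg : ∀ z : ℂ, v₀ ≤ z.im → ‖h z - p.sum fun r a => qExp r z * a‖ ≤ K * Real.exp (-ε * z.im))
    {m : ℚ} (hm : ∃ n : ℤ, (N : ℚ) * m = n) {v : ℝ} (hv : v₀ ≤ v) :
    ‖fourierMode N h m v - p m‖ ≤ K * Real.exp ((2 * Real.pi * m - ε) * v) := by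
  have hN' : (N : ℂ) ≠ 0 := by exact_mod_cast hN.ne'
  have hc1 : Continuous fun u : ℝ => h (u + v * Complex.I) * qExp (-m) (u + v * Complex.I) :=
    (continuous_horizontal hh (hv₀.trans_le hv)).mul ((continuous_qExp _).comp (by fun_prop))
  have hc2 : Continuous fun u : ℝ => (p.sum fun r a => qExp r (u + v * Complex.I) * a) *
      qExp (-m) (u + v * Complex.I) := by
    refine Continuous.mul ?_ ((continuous_qExp _).comp (by fun_prop))
    refine continuous_finsetSum _ fun r _ => ?_
    exact ((continuous_qExp _).comp (by fun_prop)).mul continuous_const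
  rw [← fourierMode_finsuppSum hN p hsup hm v, fourierMode, fourierMode, ← mul_sub,
    ← intervalIntegral.integral_sub (hc1.intervalIntegrable _ _) (hc2.intervalIntegrable _ _),
    norm_mul]
  have hb : ‖∫ u in (0 : ℝ)..N, (h (u + v * Complex.I) * qExp (-m) (u + v * Complex.I) -
      (p.sum fun r a => qExp r (u + v * Complex.I) * a) * qExp (-m) (u + v * Complex.I))‖ ≤
      (K * Real.exp ((2 * Real.pi * m - ε) * v)) * |(N : ℝ) - 0| := by
    refine intervalIntegral.norm_integral_le_of_norm_le_const fun u _ => ?_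
    rw [← sub_mul, norm_mul, norm_qExp_add_mul_I]
    have h1 := hg (u + v * Complex.I) (by rw [im_ofReal_add_mul_I]; exact hv)
    rw [im_ofReal_add_mul_I] at h1
    refine (mul_le_mul_of_nonneg_right h1 (Real.exp_pos _).le).trans (le_of_eq ?_)
    rw [mul_assoc, ← Real.exp_add]
    congr 2
    push_cast
    ring
  have hNr : (0 : ℝ) < N := by exact_mod_cast hN
  rw [norm_inv, Complex.norm_natCast, inv_mul_le_iff₀ hNr]
  refine hb.trans (le_of_eq ?_)
  rw [sub_zero, abs_of_pos hNr, mul_comm]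

/-! ### Wirtinger calculus and Green's theorem on horizontal strips -/

lemma wirtingerBar_eq_zero_of_differentiableAt {F : ℂ → ℂ} {z : ℂ} (h : DifferentiableAt ℂ F z) :
    wirtingerBar F z = 0 := by
  have := (differentiableAt_complex_iff_differentiableAt_real.mp h).2
  rw [wirtingerBar, this, smul_eq_mul, ← mul_assoc, Complex.I_mul_I]
  ring

lemma differentiableAt_of_wirtingerBar_eq_zero {F : ℂ → ℂ} {z : ℂ} (h : DifferentiableAt ℝ F z)
    (h0 : wirtingerBar F z = 0) : DifferentiableAt ℂ F z := by
  refine differentiableAt_complex_iff_differentiableAt_real.mpr ⟨h, ?_⟩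
  rw [wirtingerBar] at h0
  rw [smul_eq_mul]
  linear_combination -Complex.I * h0 + (fderiv ℝ F z Complex.I) * Complex.I_sq

lemma wirtingerBar_mul {F G : ℂ → ℂ} {z : ℂ} (hF : DifferentiableAt ℝ F z)
    (hG : DifferentiableAt ℝ G z) :
    wirtingerBar (fun z => F z * G z) z = wirtingerBar F z * G z + F z * wirtingerBar G z := by
  simp only [wirtingerBar, fderiv_fun_mul hF hG, ContinuousLinearMap.add_apply,
    ContinuousLinearMap.smul_apply, smul_eq_mul]
  ring

lemma wirtinger_mul {F G : ℂ → ℂ} {z : ℂ} (hF : DifferentiableAt ℝ F z)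
    (hG : DifferentiableAt ℝ G z) :
    wirtinger (fun z => F z * G z) z = wirtinger F z * G z + F z * wirtinger G z := by
  simp only [wirtinger, fderiv_fun_mul hF hG, ContinuousLinearMap.add_apply,
    ContinuousLinearMap.smul_apply, smul_eq_mul]
  ring

lemma wirtingerBar_congr {F G : ℂ → ℂ} {z : ℂ} (h : F =ᶠ[nhds z] G) :
    wirtingerBar F z = wirtingerBar G z := by
  rw [wirtingerBar, wirtingerBar, h.fderiv_eq]

/-- The real power `v^n` of the imaginary part. -/
def imZpow (n : ℤ) (z : ℂ) : ℂ := ((z.im ^ n : ℝ) : ℂ)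

lemma hasFDerivAt_imZpow (n : ℤ) {z : ℂ} (hz : 0 < z.im) :
    ∃ A : ℂ →L[ℝ] ℂ, HasFDerivAt (imZpow n) A z ∧
      ∀ w : ℂ, A w = ((n * z.im ^ (n - 1) * w.im : ℝ) : ℂ) := by
  have h1 := (hasDerivAt_zpow n z.im (Or.inl hz.ne')).comp_hasFDerivAt z
    Complex.imCLM.hasFDerivAt
  refine ⟨_, Complex.ofRealCLM.hasFDerivAt.comp z h1, fun w => ?_⟩
  simp

lemma differentiableAt_imZpow (n : ℤ) {z : ℂ} (hz : 0 < z.im) : DifferentiableAt ℝ (imZpow n) z :=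
  let ⟨_, h, _⟩ := hasFDerivAt_imZpow n hz
  h.differentiableAt

lemma contDiffOn_imZpow (n : ℤ) {r : WithTop ℕ∞} :
    ContDiffOn ℝ r (imZpow n) {z : ℂ | 0 < z.im} := by
  refine Complex.ofRealCLM.contDiff.comp_contDiffOn ?_
  intro z hz
  refine ContDiffAt.contDiffWithinAt ?_
  have h1 : ContDiffAt ℝ r (fun x : ℝ => x ^ n) z.im := by
    cases n with
    | ofNat n => simpa using (contDiffAt_id.pow n)
    | negSucc n =>
      simp only [zpow_negSucc]
      exact (contDiffAt_id.pow _).inv (pow_ne_zero _ (ne_of_gt hz))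
  exact h1.comp z Complex.imCLM.contDiff.contDiffAt

lemma wirtinger_imZpow (n : ℤ) {z : ℂ} (hz : 0 < z.im) :
    wirtinger (imZpow n) z = -Complex.I * n * imZpow (n - 1) z := by
  obtain ⟨A, hA, h⟩ := hasFDerivAt_imZpow n hz
  rw [wirtinger, hA.fderiv, h, h, imZpow]
  simp
  ring

lemma wirtingerBar_imZpow (n : ℤ) {z : ℂ} (hz : 0 < z.im) :
    wirtingerBar (imZpow n) z = Complex.I * n * imZpow (n - 1) z := by
  obtain ⟨A, hA, h⟩ := hasFDerivAt_imZpow n hz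
  rw [wirtingerBar, hA.fderiv, h, h, imZpow]
  simp
  ring

lemma im_mul_imZpow (n : ℤ) {z : ℂ} (hz : 0 < z.im) :
    (z.im : ℂ) * imZpow (n - 1) z = imZpow n z := by
  rw [imZpow, imZpow, zpow_sub_one₀ hz.ne']
  have : (z.im : ℂ) ≠ 0 := by exact_mod_cast hz.ne'
  push_cast
  field_simp

lemma ContDiffOn.wirtingerBar {F : ℂ → ℂ} {n m : WithTop ℕ∞}
    (hF : ContDiffOn ℝ n F {z : ℂ | 0 < z.im}) (hm : m + 1 ≤ n) :
    ContDiffOn ℝ m (wirtingerBar F) {z : ℂ | 0 < z.im} := by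
  have h := hF.fderiv_of_isOpen isOpen_im_pos hm
  exact (h.clm_apply contDiffOn_const).add (contDiffOn_const.mul (h.clm_apply contDiffOn_const))

/-- The composite of the two Wirtinger operators is the euclidean Laplacian. -/
lemma wirtinger_wirtingerBar {F : ℂ → ℂ} (hF : ContDiffOn ℝ 2 F {z : ℂ | 0 < z.im}) {z : ℂ}
    (hz : 0 < z.im) : wirtinger (wirtingerBar F) z =
      partialU (partialU F) z + partialV (partialV F) z := by
  have hd : DifferentiableAt ℝ (fderiv ℝ F) z :=
    ((hF.fderiv_of_isOpen isOpen_im_pos (m := 1) le_rfl).contDiffAt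
      (isOpen_im_pos.mem_nhds hz)).differentiableAt one_ne_zero
  have hsymm : IsSymmSndFDerivAt ℝ F z := (hF.contDiffAt
    (isOpen_im_pos.mem_nhds hz)).isSymmSndFDerivAt (by simp)
  have h1 : ∀ w w' : ℂ, fderiv ℝ (fun z => fderiv ℝ F z w) z w' =
      fderiv ℝ (fderiv ℝ F) z w' w := by
    intro w w'
    have := (hd.hasFDerivAt.clm_apply (hasFDerivAt_const w z)).fderiv
    rw [this]
    simp
  have h2 : ∀ w : ℂ, DifferentiableAt ℝ (fun z => fderiv ℝ F z w) z := fun w =>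
    (hd.hasFDerivAt.clm_apply (hasFDerivAt_const w z)).differentiableAt
  have h3 : ∀ w', fderiv ℝ (wirtingerBar F) z w' = fderiv ℝ (fderiv ℝ F) z w' 1 +
      Complex.I * fderiv ℝ (fderiv ℝ F) z w' Complex.I := by
    intro w'
    have h4 : wirtingerBar F = fun z => fderiv ℝ F z 1 + Complex.I * fderiv ℝ F z Complex.I := rfl
    rw [h4, fderiv_fun_add (h2 1) ((h2 Complex.I).const_mul _), fderiv_const_mul (h2 Complex.I)]
    simp [h1]
  rw [wirtinger, h3, h3]
  change _ = fderiv ℝ (fun z => fderiv ℝ F z 1) z 1 +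
    fderiv ℝ (fun z => fderiv ℝ F z Complex.I) z Complex.I
  rw [h1, h1, hsymm.eq 1 Complex.I]
  linear_combination -(fderiv ℝ (fderiv ℝ F) z Complex.I Complex.I) * Complex.I_sq

/-- Green's theorem for a function of period `N` on a horizontal strip. -/
lemma integral_sub_integral_of_periodic {Φ : ℂ → ℂ} (hΦ : ContDiffOn ℝ 1 Φ {z : ℂ | 0 < z.im})
    {a b : ℝ} (hper : ∀ v : ℝ, 0 < v → Φ (b + v * Complex.I) = Φ (a + v * Complex.I))
    {v₁ v₂ : ℝ} (h₁ : 0 < v₁) (h₂ : 0 < v₂) :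
    (∫ u in a..b, Φ (u + v₁ * Complex.I)) - ∫ u in a..b, Φ (u + v₂ * Complex.I) =
      Complex.I * ∫ v in v₁..v₂, ∫ u in a..b, wirtingerBar Φ (u + v * Complex.I) := by
  have hpos : ∀ v ∈ Set.uIcc v₁ v₂, 0 < v := fun v hv => lt_of_lt_of_le (lt_min h₁ h₂) hv.1
  have hsub : Set.uIcc a b ×ℂ Set.uIcc v₁ v₂ ⊆ {z : ℂ | 0 < z.im} := fun z hz => hpos _ hz.2
  have hcomp : IsCompact (Set.uIcc a b ×ℂ Set.uIcc v₁ v₂) :=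
    isCompact_uIcc.reProdIm isCompact_uIcc
  have e1 : ∀ x y : ℝ, (⟨x, y⟩ : ℂ).re = x := fun _ _ => rfl
  have e2 : ∀ x y : ℝ, (⟨x, y⟩ : ℂ).im = y := fun _ _ => rfl
  have key := Complex.integral_boundary_rect_of_hasFDerivAt_real_off_countable Φ (fderiv ℝ Φ)
    ⟨a, v₁⟩ ⟨b, v₂⟩ ∅ Set.countable_empty (hΦ.continuousOn.mono hsub) (fun x hx => by
      refine (hΦ.differentiableAt_im_pos one_ne_zero ?_).hasFDerivAt
      exact (lt_min h₁ h₂).trans hx.1.2.1) (by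
      refine ContinuousOn.integrableOn_compact hcomp ?_
      exact (((hΦ.continuousOn_fderiv_im_pos 1).const_smul Complex.I).sub
        (hΦ.continuousOn_fderiv_im_pos Complex.I)).mono hsub)
  simp only [e1, e2] at key
  -- Periodicity cancels the two vertical sides of the rectangle.
  have hside : ∫ y in v₁..v₂, Φ (b + y * Complex.I) = ∫ y in v₁..v₂, Φ (a + y * Complex.I) :=
    intervalIntegral.integral_congr fun v hv => hper v (hpos v hv)
  rw [hside, add_sub_cancel_right] at key
  rw [key, ← intervalIntegral.integral_const_mul]
  have hc : ContinuousOn (fun p : ℝ × ℝ => wirtingerBar Φ (p.1 + p.2 * Complex.I))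
      (Set.uIcc a b ×ˢ Set.uIcc v₁ v₂) := by
    refine hΦ.continuousOn_wirtingerBar.comp (by fun_prop) fun p hp => ?_
    rw [Set.mem_ofPred_eq, im_ofReal_add_mul_I]
    exact hpos _ hp.2
  have hswap := intervalIntegral_intervalIntegral_swap
    (F := fun u v : ℝ => wirtingerBar Φ (u + v * Complex.I)) (a := a) (b := b) (c := v₁) (d := v₂)
    ((hc.integrableOn_compact (isCompact_uIcc.prod isCompact_uIcc)).mono_set
      (Set.prod_mono Set.uIoc_subset_uIcc Set.uIoc_subset_uIcc))
  rw [intervalIntegral.integral_const_mul, ← hswap, ← intervalIntegral.integral_const_mul]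
  refine intervalIntegral.integral_congr fun u _ => ?_
  rw [← intervalIntegral.integral_const_mul]
  refine intervalIntegral.integral_congr fun v _ => ?_
  simp only [wirtingerBar, smul_eq_mul]
  linear_combination -(fderiv ℝ Φ (u + v * Complex.I) Complex.I) * Complex.I_sq

lemma contDiffOn_of_differentiableOn_im_pos {F : ℂ → ℂ} {n : WithTop ℕ∞}
    (hF : DifferentiableOn ℂ F {z : ℂ | 0 < z.im}) : ContDiffOn ℝ n F {z : ℂ | 0 < z.im} :=
  (hF.contDiffOn isOpen_im_pos).restrict_scalars ℝ

/-- Horizontal integrals over a period of a holomorphic function do not depend on the height. -/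
lemma integral_eq_of_periodic {Φ : ℂ → ℂ} (hΦ : DifferentiableOn ℂ Φ {z : ℂ | 0 < z.im})
    {a b : ℝ} (hper : ∀ v : ℝ, 0 < v → Φ (b + v * Complex.I) = Φ (a + v * Complex.I))
    {v₁ v₂ : ℝ} (h₁ : 0 < v₁) (h₂ : 0 < v₂) :
    ∫ u in a..b, Φ (u + v₁ * Complex.I) = ∫ u in a..b, Φ (u + v₂ * Complex.I) := by
  have h := integral_sub_integral_of_periodic (contDiffOn_of_differentiableOn_im_pos hΦ) hper h₁ h₂
  have h0 : ∫ v in v₁..v₂, ∫ u in a..b, wirtingerBar Φ (u + v * Complex.I) = 0 := by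
    rw [intervalIntegral.integral_congr (g := fun _ => (0 : ℂ)), intervalIntegral.integral_zero]
    intro v hv
    beta_reduce
    rw [intervalIntegral.integral_congr (g := fun _ => (0 : ℂ)), intervalIntegral.integral_zero]
    intro u _
    refine wirtingerBar_eq_zero_of_differentiableAt ?_
    refine hΦ.differentiableAt (isOpen_im_pos.mem_nhds ?_)
    rw [Set.mem_ofPred_eq, im_ofReal_add_mul_I]
    exact lt_of_lt_of_le (lt_min h₁ h₂) hv.1
  rw [h0, mul_zero, sub_eq_zero] at h
  exact h

lemma two_le_infty : (2 : WithTop ℕ∞) ≤ ∞ := WithTop.coe_le_coe.mpr le_top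

/-! ### Fourier coefficients of harmonic functions -/

section Harmonic

variable {F : ℂ → ℂ} {k N : ℕ}

/-- For a harmonic function of weight `-k`, the function `v^(-k) ∂F/∂z̄` is antiholomorphic. -/
lemma differentiableOn_conj_wirtingerBar (hF : ContDiffOn ℝ ∞ F {z : ℂ | 0 < z.im})
    (hΔ : ∀ z : ℂ, 0 < z.im →
      z.im * wirtinger (wirtingerBar F) z = -Complex.I * k * wirtingerBar F z) :
    DifferentiableOn ℂ (fun z => (starRingEnd ℂ) (wirtingerBar F z * imZpow (-k) z))
      {z : ℂ | 0 < z.im} := by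
  intro z hz
  have hz' : 0 < z.im := hz
  have hW : DifferentiableAt ℝ (wirtingerBar F) z :=
    (hF.wirtingerBar (m := 1)
      (by rw [one_add_one_eq_two]; exact two_le_infty)).differentiableAt_im_pos one_ne_zero hz
  have hA := differentiableAt_imZpow (-k) hz'
  have hWA : DifferentiableAt ℝ (fun z => wirtingerBar F z * imZpow (-k) z) z := hW.mul hA
  refine (differentiableAt_of_wirtingerBar_eq_zero ?_ ?_).differentiableWithinAt
  · exact Complex.conjCLE.differentiableAt.comp z hWA
  · rw [wirtingerBar_conj hWA, wirtinger_mul hW hA, wirtinger_imZpow _ hz', map_eq_zero]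
    have hne : (z.im : ℂ) ≠ 0 := by exact_mod_cast hz'.ne'
    refine mul_left_cancel₀ hne ?_
    have h1 := hΔ z hz'
    have h2 := im_mul_imZpow (-k) hz'
    push_cast at h2 ⊢
    linear_combination imZpow (-k) z * h1 + wirtingerBar F z * Complex.I * k * h2

lemma conj_qExp (m : ℚ) (u v : ℝ) : (starRingEnd ℂ) (qExp m (u + v * Complex.I)) =
    qExp (-m) (u + v * Complex.I) * Real.exp (-4 * Real.pi * m * v) := by
  rw [qExp, qExp, ← Complex.exp_conj, Complex.ofReal_exp, ← Complex.exp_add]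
  congr 1
  simp only [map_mul, map_add, Complex.conj_ofReal, Complex.conj_I, map_ratCast, map_ofNat]
  push_cast
  linear_combination (4 * Real.pi * m * v : ℂ) * Complex.I_sq

/-- The differential equation satisfied by the Fourier coefficients of a harmonic function of
weight `-k`, in integrated form. -/
lemma exists_fourierMode_sub_eq (hF : ContDiffOn ℝ ∞ F {z : ℂ | 0 < z.im})
    (hper : ∀ z : ℂ, 0 < z.im → F (z + N) = F z)
    (hΔ : ∀ z : ℂ, 0 < z.im →
      z.im * wirtinger (wirtingerBar F) z = -Complex.I * k * wirtingerBar F z)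
    {m : ℚ} (hm : ∃ n : ℤ, (N : ℚ) * m = n) :
    ∃ κ : ℂ, ∀ v₁ v₂ : ℝ, 0 < v₁ → 0 < v₂ → fourierMode N F m v₂ - fourierMode N F m v₁ =
      κ * ((∫ t in v₁..v₂, t ^ k * Real.exp (4 * Real.pi * m * t) : ℝ) : ℂ) := by
  set H : ℂ → ℂ := fun z => (starRingEnd ℂ) (wirtingerBar F z * imZpow (-k) z) with hH
  have hHd : DifferentiableOn ℂ H {z : ℂ | 0 < z.im} := differentiableOn_conj_wirtingerBar hF hΔ
  have hm' : ∃ n : ℤ, (N : ℚ) * (-m) = n := by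
    obtain ⟨n, hn⟩ := hm
    exact ⟨-n, by push_cast; rw [← hn]; ring⟩
  have hshift : ∀ (r : ℚ), (∃ n : ℤ, (N : ℚ) * r = n) → ∀ v : ℝ,
      qExp r (((N : ℝ) : ℂ) + v * Complex.I) = qExp r (((0 : ℝ) : ℂ) + v * Complex.I) := by
    intro r hr v
    rw [qExp_arg_add, Complex.ofReal_natCast, qExp_of_mul_int hr, one_mul, Complex.ofReal_zero,
      zero_add]
  have hbarper : ∀ z : ℂ, 0 < z.im → wirtingerBar F (z + N) = wirtingerBar F z := by
    intro z hz
    have h1 : (fun w => F (w + N)) =ᶠ[nhds z] F := by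
      filter_upwards [isOpen_im_pos.mem_nhds hz] with w hw using hper w hw
    rw [← wirtingerBar_congr h1, wirtingerBar, wirtingerBar, fderiv_comp_add_right]
  have hHper : ∀ v : ℝ, 0 < v → H (((N : ℝ) : ℂ) + v * Complex.I) =
      H (((0 : ℝ) : ℂ) + v * Complex.I) := by
    intro v hv
    have h0 : (((N : ℝ) : ℂ) + v * Complex.I) = ((((0 : ℝ) : ℂ) + v * Complex.I) + N) := by
      push_cast; ring
    simp only [hH]
    rw [h0, hbarper _ (by rw [im_ofReal_add_mul_I]; exact hv)]
    simp [imZpow]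
  have hFper : ∀ v : ℝ, 0 < v → F (((N : ℝ) : ℂ) + v * Complex.I) =
      F (((0 : ℝ) : ℂ) + v * Complex.I) := by
    intro v hv
    have h0 : (((N : ℝ) : ℂ) + v * Complex.I) = ((((0 : ℝ) : ℂ) + v * Complex.I) + N) := by
      push_cast; ring
    rw [h0, hper _ (by rw [im_ofReal_add_mul_I]; exact hv)]
  set C : ℂ := ∫ u in (0 : ℝ)..N, H (u + (1 : ℝ) * Complex.I) * qExp m (u + (1 : ℝ) * Complex.I)
    with hC
  -- Here H is holomorphic and periodic, so the horizontal integral of H q^m is the same at every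
  -- height. Its conjugate will be the constant κ up to the factor -i/N.
  have hconst : ∀ v : ℝ, 0 < v →
      ∫ u in (0 : ℝ)..N, H (u + v * Complex.I) * qExp m (u + v * Complex.I) = C := fun v hv =>
    integral_eq_of_periodic (Φ := fun z => H z * qExp m z)
      (hHd.mul (differentiable_qExp m).differentiableOn)
      (fun v hv => by rw [hHper v hv, hshift m hm]) hv one_pos
  have hFdiff : ContDiffOn ℝ 1 (fun z => F z * qExp (-m) z) {z : ℂ | 0 < z.im} :=
    (hF.of_le (by exact_mod_cast le_top)).mul
      (contDiffOn_of_differentiableOn_im_pos (differentiable_qExp (-m)).differentiableOn)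
  refine ⟨-Complex.I * (N : ℂ)⁻¹ * (starRingEnd ℂ) C, fun v₁ v₂ h₁ h₂ => ?_⟩
  have key := integral_sub_integral_of_periodic hFdiff (a := 0) (b := N)
    (fun v hv => by rw [hFper v hv, hshift (-m) hm']) h₁ h₂
  -- D̄F is v^k times the conjugate of H, and q^(-m) is e^(4πmv) times the conjugate of q^m. The
  -- inner integral is thus the conjugate of C times v^k e^(4πmv).
  have hinner : ∫ v in v₁..v₂, ∫ u in (0 : ℝ)..N,
      wirtingerBar (fun z => F z * qExp (-m) z) (u + v * Complex.I) =
      ∫ v in v₁..v₂, (starRingEnd ℂ) C * ((v ^ k * Real.exp (4 * Real.pi * m * v) : ℝ) : ℂ) := by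
    refine intervalIntegral.integral_congr fun v hv => ?_
    have hv0 : 0 < v := lt_of_lt_of_le (lt_min h₁ h₂) hv.1
    rw [← hconst v hv0, ← intervalIntegral_conj, ← intervalIntegral.integral_mul_const]
    refine intervalIntegral.integral_congr fun u _ => ?_
    have him : 0 < ((u : ℂ) + v * Complex.I).im := by rw [im_ofReal_add_mul_I]; exact hv0
    rw [wirtingerBar_mul (hF.differentiableAt_im_pos (by simp) him)
      ((differentiable_qExp (-m)).restrictScalars ℝ _),
      wirtingerBar_eq_zero_of_differentiableAt (differentiable_qExp (-m) _), mul_zero, add_zero,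
      map_mul, conj_qExp, hH]
    simp only [Complex.conj_conj, imZpow, im_ofReal_add_mul_I]
    have e1 : ((v ^ (-k : ℤ) : ℝ) : ℂ) * ((v ^ k : ℝ) : ℂ) = 1 := by
      rw [← Complex.ofReal_mul, zpow_neg, zpow_natCast, inv_mul_cancel₀ (pow_ne_zero _ hv0.ne')]
      simp
    have e2 : ((Real.exp (-4 * Real.pi * m * v) : ℝ) : ℂ) *
        ((Real.exp (4 * Real.pi * m * v) : ℝ) : ℂ) = 1 := by
      rw [← Complex.ofReal_mul, ← Real.exp_add]
      ring_nf
      simp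
    rw [Complex.ofReal_mul (v ^ k)]
    linear_combination -(wirtingerBar F (u + v * Complex.I) * qExp (-m) (u + v * Complex.I)) *
      (((Real.exp (-4 * Real.pi * m * v) : ℝ) : ℂ) *
        ((Real.exp (4 * Real.pi * m * v) : ℝ) : ℂ) * e1 + e2)
  rw [hinner, intervalIntegral.integral_const_mul, intervalIntegral.integral_ofReal] at key
  rw [fourierMode, fourierMode]
  linear_combination -(N : ℂ)⁻¹ * key

end Harmonic

/-! ### The incomplete Gamma function -/

lemma one_sub_neg_natCast (k : ℕ) : (1 - ((-(k : ℤ) : ℤ) : ℝ)) - 1 = k := by push_cast; ring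

lemma integrableOn_exp_neg_mul_pow (k : ℕ) {x : ℝ} (hx : 0 ≤ x) :
    IntegrableOn (fun t : ℝ => Real.exp (-t) * t ^ k) (Set.Ioi x) := by
  have h := Real.GammaIntegral_convergent (s := k + 1) (by positivity)
  simp only [add_sub_cancel_right, Real.rpow_natCast] at h
  exact h.mono_set (Set.Ioi_subset_Ioi hx)

lemma incGamma_eq (k : ℕ) (x : ℝ) : incGamma (1 - ((-(k : ℤ) : ℤ) : ℝ)) x =
    ∫ t in Set.Ioi x, Real.exp (-t) * t ^ k := by
  simp only [incGamma, one_sub_neg_natCast, Real.rpow_natCast]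

lemma tendsto_incGamma_atTop (k : ℕ) :
    Filter.Tendsto (incGamma (1 - ((-(k : ℤ) : ℤ) : ℝ))) Filter.atTop (nhds 0) := by
  have h := intervalIntegral_tendsto_integral_Ioi (0 : ℝ) (integrableOn_exp_neg_mul_pow k le_rfl)
    Filter.tendsto_id
  have h2 := (tendsto_const_nhds (x := ∫ t in Set.Ioi (0 : ℝ), Real.exp (-t) * t ^ k)).sub h
  rw [sub_self] at h2
  refine h2.congr' ?_
  filter_upwards [Filter.eventually_ge_atTop 0] with x hx
  rw [incGamma_eq, sub_eq_iff_eq_add', id,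
    intervalIntegral.integral_interval_add_Ioi (integrableOn_exp_neg_mul_pow k le_rfl)
      (integrableOn_exp_neg_mul_pow k hx)]

lemma integrableOn_pow_mul_exp (k : ℕ) {r v : ℝ} (hr : 0 < r) (hv : 0 < v) :
    IntegrableOn (fun t : ℝ => t ^ k * Real.exp (-r * t)) (Set.Ioi v) := by
  have h := (integrableOn_Ioi_comp_mul_left_iff (fun t : ℝ => Real.exp (-t) * t ^ k) v hr).mpr
    (integrableOn_exp_neg_mul_pow k (by positivity))
  have h2 := h.const_mul ((r ^ k)⁻¹)
  refine h2.congr (Filter.Eventually.of_forall fun t => ?_)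
  have : r ^ k ≠ 0 := pow_ne_zero _ hr.ne'
  beta_reduce
  rw [mul_pow, neg_mul]
  field_simp

lemma integral_pow_mul_exp (k : ℕ) {r v : ℝ} (hr : 0 < r) :
    ∫ t in Set.Ioi v, t ^ k * Real.exp (-r * t) =
      (r ^ (k + 1))⁻¹ * incGamma (1 - ((-(k : ℤ) : ℤ) : ℝ)) (r * v) := by
  have h := integral_comp_mul_left_Ioi (fun t : ℝ => Real.exp (-t) * t ^ k) v hr
  rw [incGamma_eq, pow_succ, mul_inv, mul_assoc, ← smul_eq_mul r⁻¹, ← h,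
    ← integral_const_mul]
  congr 1
  funext t
  have : r ^ k ≠ 0 := pow_ne_zero _ hr.ne'
  rw [mul_pow, neg_mul]
  field_simp

/-! ### Fourier expansion of smooth periodic functions -/

lemma norm_fourierCoeffOn_le {a b : ℝ} (hab : a < b) {h : ℝ → ℂ} {K : ℝ}
    (hK : ∀ x, ‖h x‖ ≤ K) (n : ℤ) : ‖fourierCoeffOn hab h n‖ ≤ K := by
  have hp : 0 < b - a := sub_pos.mpr hab
  rw [fourierCoeffOn_eq_integral, norm_smul, Real.norm_of_nonneg (by positivity)]
  have h1 : ‖∫ x in a..b, (fourier (-n) (x : AddCircle (b - a)) : ℂ) • h x‖ ≤ K * |b - a| := by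
    refine intervalIntegral.norm_integral_le_of_norm_le_const fun x _ => ?_
    rw [norm_smul, fourier_apply, Circle.norm_coe, one_mul]
    exact hK x
  rw [abs_of_pos hp] at h1
  rw [one_div, inv_mul_le_iff₀ hp, mul_comm]
  exact h1

lemma periodic_deriv {g : ℝ → ℂ} {c : ℝ} (hg : Function.Periodic g c) :
    Function.Periodic (deriv g) c := fun x => by
  rw [← deriv_comp_add_const]
  congr 1
  exact funext hg

/-- Integration by parts; periodicity removes the boundary term. -/
lemma fourierCoeffOn_of_periodic_contDiff {g : ℝ → ℂ} {a N : ℝ} (hab : a < a + N)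
    (hg : ContDiff ℝ 1 g) (hper : Function.Periodic g N) {n : ℤ} (hn : n ≠ 0) :
    fourierCoeffOn hab g n =
      N / (2 * Real.pi * Complex.I * n) * fourierCoeffOn hab (deriv g) n := by
  rw [fourierCoeffOn_of_hasDerivAt hab hn
    (fun x _ => (hg.differentiable one_ne_zero x).hasDerivAt)
    ((hg.continuous_deriv le_rfl).intervalIntegrable _ _), hper a, sub_self, mul_zero, zero_sub]
  push_cast
  rw [add_sub_cancel_left]
  have : (n : ℂ) ≠ 0 := by exact_mod_cast hn
  have := Complex.two_pi_I_ne_zero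
  field_simp

/-- Two integrations by parts make the coefficients O(n⁻²). This is what turns smoothness into
absolute convergence. -/
lemma summable_fourierCoeffOn {g : ℝ → ℂ} {a N : ℝ} (hab : a < a + N) (hN : 0 < N)
    (hg : ContDiff ℝ 2 g) (hper : Function.Periodic g N) :
    Summable (fourierCoeffOn hab g) := by
  have hg1 : ContDiff ℝ 1 (deriv g) := by
    have : ContDiff ℝ (1 + 1) g := by rw [one_add_one_eq_two]; exact hg
    exact (contDiff_succ_iff_deriv.mp this).2.2
  have hc : Continuous (deriv (deriv g)) := hg1.continuous_deriv le_rfl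
  obtain ⟨K, hK⟩ := ((periodic_deriv (periodic_deriv hper)).isBounded_of_continuous
    hN.ne' hc).exists_norm_le
  replace hK : ∀ x, ‖deriv (deriv g) x‖ ≤ K := fun x => hK _ ⟨x, rfl⟩
  refine Summable.of_norm_bounded_eventually (g := fun n : ℤ =>
    (N / (2 * Real.pi)) ^ 2 * K * (1 / (n : ℝ) ^ 2))
    ((Real.summable_one_div_int_pow.mpr one_lt_two).mul_left _) ?_
  have : ∀ᶠ n : ℤ in Filter.cofinite, n ≠ 0 := by
    rw [Filter.eventually_cofinite]
    simp
  filter_upwards [this] with n hn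
  rw [fourierCoeffOn_of_periodic_contDiff hab (hg.of_le one_le_two) hper hn,
    fourierCoeffOn_of_periodic_contDiff hab hg1 (periodic_deriv hper) hn, ← mul_assoc, norm_mul]
  have h1 := norm_fourierCoeffOn_le hab hK n
  have h2 : ‖(N : ℂ) / (2 * Real.pi * Complex.I * n) * (N / (2 * Real.pi * Complex.I * n))‖ =
      (N / (2 * Real.pi)) ^ 2 * (1 / (n : ℝ) ^ 2) := by
    simp only [norm_mul, norm_div, Complex.norm_I, Complex.norm_intCast, Complex.norm_real,
      Real.norm_eq_abs, abs_of_pos Real.pi_pos, abs_of_pos hN, Complex.norm_ofNat, mul_one]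
    rw [← sq_abs (n : ℝ)]
    ring
  rw [h2]
  calc _ ≤ (N / (2 * Real.pi)) ^ 2 * (1 / (n : ℝ) ^ 2) * K :=
        mul_le_mul_of_nonneg_left h1 (by positivity)
    _ = _ := by ring

/-- The Fourier series of F along the horizontal line through z, on a circle of length N. The factor
of modulus e^(-2πmv) in q^m cancels against the q^(-m) inside the mode. -/
lemma hasSum_fourierMode {N : ℕ} (hN : 0 < N) {F : ℂ → ℂ}
    (hF : ContDiffOn ℝ 2 F {z : ℂ | 0 < z.im})
    (hper : ∀ z : ℂ, 0 < z.im → F (z + N) = F z) {z : ℂ} (hz : 0 < z.im) :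
    HasSum (fun n : ℤ => qExp (n / N) z * fourierMode N F (n / N) z.im) (F z) := by
  have hNr : (0 : ℝ) < N := by exact_mod_cast hN
  have hNc : (N : ℂ) ≠ 0 := by exact_mod_cast hN.ne'
  have : Fact ((0 : ℝ) < N) := ⟨hNr⟩
  set g : ℝ → ℂ := fun u => F (u + z.im * Complex.I) with hg
  have hgc : ContDiff ℝ 2 g := by
    rw [← contDiffOn_univ]
    refine hF.comp (ContDiff.contDiffOn ?_) fun u _ => ?_
    · exact (Complex.ofRealCLM.contDiff).add contDiff_const
    · rw [Set.mem_ofPred_eq, im_ofReal_add_mul_I]; exact hz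
  have hgper : Function.Periodic g N := fun u => by
    simp only [hg]
    rw [← hper (u + z.im * Complex.I) (by rw [im_ofReal_add_mul_I]; exact hz)]
    congr 1
    push_cast
    ring
  -- Basing the period interval at Re z makes the point of evaluation its left endpoint, which lies
  -- in the half-open interval.
  let f : C(AddCircle (N : ℝ), ℂ) := ⟨AddCircle.liftIco (N : ℝ) z.re g,
    AddCircle.liftIco_continuous (hgper _).symm hgc.continuous.continuousOn⟩
  have hab : z.re < z.re + N := lt_add_of_pos_right _ hNr
  have hcoef : ∀ n, fourierCoeff f n = fourierCoeffOn hab g n := fun n =>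
    fourierCoeff_liftIco_eq g n
  have hs : Summable (fourierCoeff f) := by
    rw [funext hcoef]
    exact summable_fourierCoeffOn hab hNr hgc hgper
  have h := has_pointwise_sum_fourier_series_of_summable hs (z.re : AddCircle (N : ℝ))
  have hfz : f (z.re : AddCircle (N : ℝ)) = F z := by
    have : f (z.re : AddCircle (N : ℝ)) = g z.re :=
      AddCircle.liftIco_coe_apply (f := g) (Set.left_mem_Ico.mpr hab)
    rw [this, hg]
    simp only [Complex.re_add_im]
  rw [hfz] at h
  refine h.congr_fun fun n => ?_
  rw [hcoef, fourierCoeffOn_eq_integral, fourier_coe_apply, fourierMode]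
  -- The integrand is periodic, so the interval [0, N] of `fourierMode` can be moved to the one
  -- based at Re z.
  have hqper : Function.Periodic (fun u : ℝ => F (u + z.im * Complex.I) *
      qExp (-((n : ℚ) / N)) (u + z.im * Complex.I)) N := by
    intro u
    have h1 := hgper u
    simp only [hg] at h1
    beta_reduce
    rw [h1]
    congr 1
    have : ((u + N : ℝ) : ℂ) + z.im * Complex.I = (u + z.im * Complex.I) + N := by
      push_cast; ring
    rw [this, qExp_arg_add, qExp_of_mul_int ⟨-n, ?_⟩, mul_one]
    have : (N : ℚ) ≠ 0 := by exact_mod_cast hN.ne'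
    push_cast
    field_simp
  have hshift := hqper.intervalIntegral_add_eq 0 z.re
  rw [zero_add] at hshift
  rw [hshift, ← intervalIntegral.integral_const_mul, ← intervalIntegral.integral_const_mul,
    smul_eq_mul, Complex.real_smul, ← intervalIntegral.integral_const_mul,
    ← intervalIntegral.integral_mul_const]
  refine intervalIntegral.integral_congr fun u _ => ?_
  rw [fourier_coe_apply, smul_eq_mul, add_sub_cancel_left]
  have hz' : z = z.re + z.im * Complex.I := (Complex.re_add_im z).symm
  have he : qExp ((n : ℚ) / N) z * qExp (-((n : ℚ) / N)) (u + z.im * Complex.I) =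
      Complex.exp (2 * Real.pi * Complex.I * ((-n : ℤ) : ℂ) * u / (N : ℝ)) *
      Complex.exp (2 * Real.pi * Complex.I * (n : ℂ) * z.re / (N : ℝ)) := by
    rw [qExp, qExp, ← Complex.exp_add, ← Complex.exp_add]
    congr 1
    conv_lhs => rw [hz']
    push_cast
    simp only [Complex.add_re, Complex.ofReal_re, Complex.mul_re, Complex.I_re, mul_zero,
      Complex.ofReal_im, Complex.I_im, mul_one, sub_self, add_zero, Complex.add_im,
      Complex.mul_im, zero_add]
    field_simp
    ring
  push_cast
  push_cast at he
  rw [one_div]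
  linear_combination (N : ℂ)⁻¹ * F (u + z.im * Complex.I) * he

/-! ### Consequences of the growth condition for a single Fourier coefficient -/

section Growth

variable {A : ℝ → ℂ} {κ p : ℂ} {k : ℕ} {K ε v₀ : ℝ}

/-- Fourier coefficients of non-negative index are constant by the growth condition. -/
lemma eq_zero_of_growth {m : ℝ} (hm : 0 ≤ m) (hε : 0 < ε)
    (hA : ∀ v₁ v₂ : ℝ, 0 < v₁ → 0 < v₂ → A v₂ - A v₁ =
      κ * ((∫ t in v₁..v₂, t ^ k * Real.exp (4 * Real.pi * m * t) : ℝ) : ℂ))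
    (hg : ∀ v, v₀ ≤ v → ‖A v - p‖ ≤ K * Real.exp ((2 * Real.pi * m - ε) * v)) : κ = 0 := by
  have hpi := Real.pi_pos
  -- The factor 1 + e^(2πm-ε) collects the two error bounds at heights v and v + 1.
  set K' : ℝ := K * (1 + Real.exp (2 * Real.pi * m - ε)) with hK'
  have hbound : ∀ v, max v₀ 1 ≤ v → ‖κ‖ ≤ K' * Real.exp (-ε * v) := by
    intro v hv
    have hv0 : v₀ ≤ v := (le_max_left _ _).trans hv
    have hv1 : 1 ≤ v := (le_max_right _ _).trans hv
    have hcont : Continuous fun t : ℝ => t ^ k * Real.exp (4 * Real.pi * m * t) := by fun_prop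
    -- For t ≥ v ≥ 1 and m ≥ 0 both t^k ≥ 1 and e^(4πmt) ≥ e^(4πmv). The increment of A over a unit
    -- interval is then at least |κ|e^(4πmv), whereas the growth condition allows only
    -- O(e^((2πm-ε)v)).
    have hJ : Real.exp (4 * Real.pi * m * v) ≤
        ∫ t in v..(v + 1), t ^ k * Real.exp (4 * Real.pi * m * t) := by
      have h1 : ∫ t in v..(v + 1), Real.exp (4 * Real.pi * m * v) =
          Real.exp (4 * Real.pi * m * v) := by simp
      rw [← h1]
      refine intervalIntegral.integral_mono_on (by linarith) intervalIntegrable_const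
        (hcont.intervalIntegrable _ _) fun t ht => ?_
      have h2 : 1 ≤ t ^ k := one_le_pow₀ (hv1.trans ht.1)
      have h3 : Real.exp (4 * Real.pi * m * v) ≤ Real.exp (4 * Real.pi * m * t) :=
        Real.exp_le_exp.mpr (mul_le_mul_of_nonneg_left ht.1 (by positivity))
      nlinarith [Real.exp_pos (4 * Real.pi * m * t)]
    have h1 := hA v (v + 1) (by linarith) (by linarith)
    have h2 : ‖A (v + 1) - A v‖ ≤ K * Real.exp ((2 * Real.pi * m - ε) * v) +
        K * Real.exp ((2 * Real.pi * m - ε) * (v + 1)) := by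
      have : A (v + 1) - A v = (A (v + 1) - p) - (A v - p) := by ring
      rw [this, add_comm (K * _)]
      exact (norm_sub_le _ _).trans (add_le_add (hg _ (by linarith)) (hg _ hv0))
    have h3 : ‖κ‖ * Real.exp (4 * Real.pi * m * v) ≤
        K' * Real.exp (-ε * v) * Real.exp (2 * Real.pi * m * v) := by
      calc ‖κ‖ * Real.exp (4 * Real.pi * m * v) ≤ ‖A (v + 1) - A v‖ := by
            rw [h1, norm_mul, Complex.norm_real, Real.norm_eq_abs]
            exact mul_le_mul_of_nonneg_left (hJ.trans (le_abs_self _)) (norm_nonneg _)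
        _ ≤ _ := h2
        _ = _ := by
            have e1 : Real.exp ((2 * Real.pi * m - ε) * v) =
                Real.exp (-ε * v) * Real.exp (2 * Real.pi * m * v) := by
              rw [← Real.exp_add]; congr 1; ring
            have e2 : Real.exp ((2 * Real.pi * m - ε) * (v + 1)) =
                Real.exp (2 * Real.pi * m - ε) * Real.exp ((2 * Real.pi * m - ε) * v) := by
              rw [← Real.exp_add]; congr 1; ring
            rw [hK', e2, e1]
            ring
    have hK0 : 0 ≤ K' := by
      have h4 : 0 ≤ K * Real.exp ((2 * Real.pi * m - ε) * v) := (norm_nonneg _).trans (hg v hv0)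
      have h5 : 0 ≤ K := nonneg_of_mul_nonneg_left h4 (Real.exp_pos _)
      positivity
    have h6 : Real.exp (2 * Real.pi * m * v) ≤ Real.exp (4 * Real.pi * m * v) :=
      Real.exp_le_exp.mpr (by nlinarith [mul_nonneg (mul_nonneg hpi.le hm) (by linarith : 0 ≤ v)])
    have h7 : 0 ≤ K' * Real.exp (-ε * v) := by positivity
    exact le_of_mul_le_mul_right (h3.trans (mul_le_mul_of_nonneg_left h6 h7)) (Real.exp_pos _)
  have hlim : Filter.Tendsto (fun v => K' * Real.exp (-ε * v)) Filter.atTop (nhds 0) := by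
    have h1 : Filter.Tendsto (fun v : ℝ => -ε * v) Filter.atTop Filter.atBot :=
      Filter.tendsto_id.const_mul_atTop_of_neg (by linarith)
    simpa using (Real.tendsto_exp_atBot.comp h1).const_mul K'
  have : ‖κ‖ ≤ 0 := ge_of_tendsto hlim
    (by filter_upwards [Filter.eventually_ge_atTop (max v₀ 1)] with v hv using hbound v hv)
  exact norm_le_zero_iff.mp this

lemma tendsto_mul_exp_neg_mul {r : ℝ} (hr : r < 0) (K : ℝ) :
    Filter.Tendsto (fun v => K * Real.exp (r * v)) Filter.atTop (nhds 0) := by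
  have h1 : Filter.Tendsto (fun v : ℝ => r * v) Filter.atTop Filter.atBot :=
    Filter.tendsto_id.const_mul_atTop_of_neg hr
  simpa using (Real.tendsto_exp_atBot.comp h1).const_mul K

lemma tendsto_of_growth {m : ℝ} (hr : 2 * Real.pi * m - ε < 0)
    (hg : ∀ v, v₀ ≤ v → ‖A v - p‖ ≤ K * Real.exp ((2 * Real.pi * m - ε) * v)) :
    Filter.Tendsto A Filter.atTop (nhds p) := by
  rw [tendsto_iff_norm_sub_tendsto_zero]
  refine squeeze_zero' (Filter.Eventually.of_forall fun v => norm_nonneg _) ?_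
    (tendsto_mul_exp_neg_mul hr K)
  filter_upwards [Filter.eventually_ge_atTop v₀] with v hv using hg v hv

/-- Fourier coefficients of negative index are combinations of a constant and an incomplete
Gamma function. -/
lemma eq_add_incGamma_of_growth {m : ℝ} (hm : m < 0) (hε : 0 < ε)
    (hA : ∀ v₁ v₂ : ℝ, 0 < v₁ → 0 < v₂ → A v₂ - A v₁ =
      κ * ((∫ t in v₁..v₂, t ^ k * Real.exp (4 * Real.pi * m * t) : ℝ) : ℂ))
    (hg : ∀ v, v₀ ≤ v → ‖A v - p‖ ≤ K * Real.exp ((2 * Real.pi * m - ε) * v)) {v : ℝ}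
    (hv : 0 < v) :
    A v = p + (incGamma (1 - ((-(k : ℤ) : ℤ) : ℝ)) (4 * Real.pi * |m| * v) : ℂ) *
      (-κ * (((4 * Real.pi * |m|) ^ (k + 1))⁻¹ : ℝ)) := by
  have hpi := Real.pi_pos
  have hr : 0 < 4 * Real.pi * |m| := by have := abs_pos.mpr hm.ne; positivity
  -- The rate 2πm - ε is negative, so p is the limit of A. The rest of A(v) is -κ times the tail
  -- integral from v to infinity, which rescales to the incomplete Gamma function.
  have h1 : Filter.Tendsto A Filter.atTop (nhds p) :=
    tendsto_of_growth (by nlinarith [mul_neg_of_pos_of_neg hpi hm]) hg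
  have h2 := intervalIntegral_tendsto_integral_Ioi v (integrableOn_pow_mul_exp k hr hv)
    Filter.tendsto_id
  rw [integral_pow_mul_exp k hr] at h2
  have h3 : Filter.Tendsto (fun w => A w - A v) Filter.atTop (nhds (κ *
      (((4 * Real.pi * |m|) ^ (k + 1))⁻¹ *
        incGamma (1 - ((-(k : ℤ) : ℤ) : ℝ)) (4 * Real.pi * |m| * v) : ℝ))) := by
    refine Filter.Tendsto.congr' ?_
      (((Complex.continuous_ofReal.tendsto _).comp h2).const_mul κ)
    filter_upwards [Filter.eventually_gt_atTop 0] with w hw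
    rw [hA v w hv hw, Function.comp_apply, id, abs_of_neg hm]
    congr 3
    funext t
    congr 2
    ring
  have h4 := tendsto_nhds_unique h3 (h1.sub_const (A v))
  push_cast at h4 ⊢
  linear_combination h4

end Growth

/-! ### The scalar Fourier expansion -/

section ScalarExpansion

variable {F : ℂ → ℂ} {k N : ℕ} {p : ℚ →₀ ℂ} {K ε v₀ : ℝ}

/-- For m ≥ 0 the growth condition leaves only the constant solution; for m < 0 it fixes the
constant to be p m. The latter makes the holomorphic part have finitely many negative exponents. -/
lemma exists_fourierMode_eq (hN : 0 < N) (hF : ContDiffOn ℝ ∞ F {z : ℂ | 0 < z.im})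
    (hper : ∀ z : ℂ, 0 < z.im → F (z + N) = F z)
    (hΔ : ∀ z : ℂ, 0 < z.im →
      z.im * wirtinger (wirtingerBar F) z = -Complex.I * k * wirtingerBar F z)
    (hsup : ∀ m, p m ≠ 0 → ∃ n : ℤ, (N : ℚ) * m = n) (hε : 0 < ε) (hv₀ : 0 < v₀)
    (hg : ∀ z : ℂ, v₀ ≤ z.im → ‖F z - p.sum fun r a => qExp r z * a‖ ≤ K * Real.exp (-ε * z.im))
    {m : ℚ} (hm : ∃ n : ℤ, (N : ℚ) * m = n) :
    ∃ a b : ℂ, (0 ≤ m → b = 0) ∧ (m < 0 → a = p m) ∧ ∀ v : ℝ, 0 < v → fourierMode N F m v =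
      a + (incGamma (1 - ((-(k : ℤ) : ℤ) : ℝ)) (4 * Real.pi * |(m : ℝ)| * v) : ℂ) * b := by
  obtain ⟨κ, hκ⟩ := exists_fourierMode_sub_eq hF hper hΔ hm
  have hgr : ∀ v, v₀ ≤ v → ‖fourierMode N F m v - p m‖ ≤
      K * Real.exp ((2 * Real.pi * (m : ℝ) - ε) * v) := fun v hv =>
    norm_fourierMode_sub_le hN hsup hF.continuousOn hv₀ hg hm hv
  rcases le_or_gt 0 m with h0 | h0
  · have hκ0 : κ = 0 := eq_zero_of_growth (m := (m : ℝ)) (by exact_mod_cast h0) hε hκ hgr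
    refine ⟨fourierMode N F m 1, 0, fun _ => rfl, fun h => absurd h0 (not_le.mpr h),
      fun v hv => ?_⟩
    have := hκ 1 v one_pos hv
    rw [hκ0, zero_mul, sub_eq_zero] at this
    rw [this, mul_zero, add_zero]
  · exact ⟨_, _, fun h => absurd h (not_le.mpr h0), fun _ => rfl, fun v hv =>
      eq_add_incGamma_of_growth (by exact_mod_cast h0) hε hκ hgr hv⟩

/-- Fourier expansion of a periodic function which is harmonic of weight `-k` and agrees with an
exponential polynomial up to an exponentially decaying error. -/
lemma exists_scalar_maassExpansion (hN : 0 < N) (hF : ContDiffOn ℝ ∞ F {z : ℂ | 0 < z.im})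
    (hper : ∀ z : ℂ, 0 < z.im → F (z + N) = F z)
    (hΔ : ∀ z : ℂ, 0 < z.im →
      z.im * wirtinger (wirtingerBar F) z = -Complex.I * k * wirtingerBar F z)
    (hsup : ∀ m, p m ≠ 0 → ∃ n : ℤ, (N : ℚ) * m = n) (hε : 0 < ε) (hv₀ : 0 < v₀)
    (hg : ∀ z : ℂ, v₀ ≤ z.im →
      ‖F z - p.sum fun r a => qExp r z * a‖ ≤ K * Real.exp (-ε * z.im)) :
    ∃ cp cm : ℚ → ℂ, (∀ m, cp m ≠ 0 → ∃ n : ℤ, (N : ℚ) * m = n) ∧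
      (∀ m, cm m ≠ 0 → ∃ n : ℤ, (N : ℚ) * m = n) ∧
      (∀ m, m < 0 → p m = 0 → cp m = 0) ∧ (∀ m, 0 ≤ m → cm m = 0) ∧
      (∀ z : ℂ, 0 < z.im → Summable fun m : ℚ => qExp m z * cp m) ∧
      (∀ z : ℂ, 0 < z.im → Summable fun m : ℚ =>
        (incGamma (1 - ((-(k : ℤ) : ℤ) : ℝ)) (4 * Real.pi * |(m : ℝ)| * z.im) : ℂ) *
          qExp m z * cm m) ∧
      ∀ z : ℂ, 0 < z.im → F z = (∑' m : ℚ, qExp m z * cp m) + ∑' m : ℚ,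
        (incGamma (1 - ((-(k : ℤ) : ℤ) : ℝ)) (4 * Real.pi * |(m : ℝ)| * z.im) : ℂ) *
          qExp m z * cm m := by
  classical
  -- Both coefficients are declared zero off (1/N)ℤ, which gives bounded denominators and lets the
  -- series run over all of ℚ.
  have hex : ∀ m : ℚ, ∃ ab : ℂ × ℂ, ((∃ n : ℤ, (N : ℚ) * m = n) → (0 ≤ m → ab.2 = 0) ∧
      (m < 0 → ab.1 = p m) ∧ ∀ v : ℝ, 0 < v → fourierMode N F m v = ab.1 +
        (incGamma (1 - ((-(k : ℤ) : ℤ) : ℝ)) (4 * Real.pi * |(m : ℝ)| * v) : ℂ) * ab.2) ∧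
      (¬ (∃ n : ℤ, (N : ℚ) * m = n) → ab = 0) := by
    intro m
    by_cases hm : ∃ n : ℤ, (N : ℚ) * m = n
    · obtain ⟨a, b, h1, h2, h3⟩ := exists_fourierMode_eq hN hF hper hΔ hsup hε hv₀ hg hm
      exact ⟨(a, b), fun _ => ⟨h1, h2, h3⟩, fun h => absurd hm h⟩
    · exact ⟨0, fun h => absurd h hm, fun _ => rfl⟩
  choose ab h1 h2 using hex
  have hcm : ∀ m, 0 ≤ m → (ab m).2 = 0 := by
    intro m hm
    by_cases h : ∃ n : ℤ, (N : ℚ) * m = n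
    · exact (h1 m h).1 hm
    · rw [h2 m h]; rfl
  have hcp : ∀ m, m < 0 → p m = 0 → (ab m).1 = 0 := by
    intro m hm hp
    by_cases h : ∃ n : ℤ, (N : ℚ) * m = n
    · rw [(h1 m h).2.1 hm, hp]
    · rw [h2 m h]; rfl
  have hNq : (N : ℚ) ≠ 0 := by exact_mod_cast hN.ne'
  have htot : ∀ z : ℂ, 0 < z.im → HasSum (fun m : ℚ => qExp m z * (ab m).1 +
      (incGamma (1 - ((-(k : ℤ) : ℤ) : ℝ)) (4 * Real.pi * |(m : ℝ)| * z.im) : ℂ) *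
        qExp m z * (ab m).2) (F z) := by
    intro z hz
    have hs := hasSum_fourierMode hN (hF.of_le two_le_infty) hper hz
    have hinj : Function.Injective fun n : ℤ => (n : ℚ) / N := fun a b hab => by
      have := (div_left_inj' hNq).mp hab
      exact_mod_cast this
    rw [← hinj.hasSum_iff]
    · refine hs.congr_fun fun n => ?_
      have hmem : ∃ r : ℤ, (N : ℚ) * ((n : ℚ) / N) = r := ⟨n, by field_simp⟩
      rw [(h1 _ hmem).2.2 z.im hz, Function.comp_apply]
      ring
    · intro m hm
      have : ¬ ∃ n : ℤ, (N : ℚ) * m = n := by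
        rintro ⟨n, hn⟩
        exact hm ⟨n, by simp only [← hn]; field_simp⟩
      rw [h2 m this]
      simp
  -- The combined series converges absolutely, but its two parts must be separated. For m ≥ 0 it
  -- already is the holomorphic part, and for m < 0 that part is supported on the finite set
  -- `p.support`.
  have hsp : ∀ z : ℂ, 0 < z.im → Summable fun m : ℚ => qExp m z * (ab m).1 := by
    intro z hz
    have hi := (htot z hz).summable.indicator {m : ℚ | 0 ≤ m}
    have hfin : Summable fun m : ℚ => if m < 0 then qExp m z * (ab m).1 else 0 := by
      refine summable_of_ne_finset_zero (s := p.support) fun m hm => ?_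
      split_ifs with h
      · rw [hcp m h (Finsupp.notMem_support_iff.mp hm), mul_zero]
      · rfl
    refine (hi.add hfin).congr fun m => ?_
    rcases lt_or_ge m 0 with h | h
    · rw [Set.indicator_of_notMem (by simpa using h), if_pos h, zero_add]
    · rw [Set.indicator_of_mem (by simpa using h), if_neg (not_lt.mpr h), hcm m h, mul_zero,
        add_zero, add_zero]
  have hsm : ∀ z : ℂ, 0 < z.im → Summable fun m : ℚ =>
      (incGamma (1 - ((-(k : ℤ) : ℤ) : ℝ)) (4 * Real.pi * |(m : ℝ)| * z.im) : ℂ) *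
        qExp m z * (ab m).2 := by
    intro z hz
    refine ((htot z hz).summable.sub (hsp z hz)).congr fun m => ?_
    ring
  refine ⟨fun m => (ab m).1, fun m => (ab m).2, fun m hm => ?_, fun m hm => ?_, hcp, hcm, hsp, hsm,
    fun z hz => ?_⟩
  · by_contra h
    exact hm (by beta_reduce; rw [h2 m h]; rfl)
  · by_contra h
    exact hm (by beta_reduce; rw [h2 m h]; rfl)
  · rw [← (hsp z hz).tsum_add (hsm z hz), (htot z hz).tsum_eq]

end ScalarExpansion

/-! ### Expansions of vector valued forms, coordinate by coordinate -/

lemma coe_ofComplex_of_im_pos {z : ℂ} (hz : 0 < z.im) : ((ofComplex z : ℍ) : ℂ) = z := by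
  rw [ofComplex_apply_of_im_pos hz]

lemma ofComplex_im_of_im_pos {z : ℂ} (hz : 0 < z.im) : (ofComplex z : ℍ).im = z.im := by
  rw [ofComplex_apply_of_im_pos hz]; rfl

lemma ofComplex_add_real {z : ℂ} (hz : 0 < z.im) (x : ℝ) :
    ofComplex (z + x) = x +ᵥ ofComplex z := by
  have : 0 < (z + x).im := by simpa using hz
  ext1
  rw [coe_ofComplex_of_im_pos this, UpperHalfPlane.coe_vadd, coe_ofComplex_of_im_pos hz, add_comm]

lemma exists_common_denominator {W : Type*} [AddCommGroup W] (P : ℚ →₀ W) :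
    ∃ N : ℕ, 0 < N ∧ ∀ m, P m ≠ 0 → ∃ n : ℤ, (N : ℚ) * m = n := by
  refine ⟨∏ m ∈ P.support, m.den, Finset.prod_pos fun m _ => m.den_pos, fun m hm => ?_⟩
  obtain ⟨c, hc⟩ := Finset.dvd_prod_of_mem (fun m : ℚ => m.den) (Finsupp.mem_support_iff.mpr hm)
  refine ⟨c * m.num, ?_⟩
  rw [hc]
  push_cast
  have := Rat.den_mul_eq_num m
  linear_combination (c : ℚ) * this

lemma exists_int_mul_of_dvd {N N' : ℕ} (h : N ∣ N') {m : ℚ} (hm : ∃ n : ℤ, (N : ℚ) * m = n) :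
    ∃ n : ℤ, (N' : ℚ) * m = n := by
  obtain ⟨c, rfl⟩ := h
  obtain ⟨n, hn⟩ := hm
  refine ⟨c * n, ?_⟩
  push_cast
  rw [← hn]
  ring

lemma periodic_of_dvd {W : Type*} {f : ℍ → W} {N N' : ℕ} (h : N ∣ N')
    (hf : ∀ τ : ℍ, f ((N : ℝ) +ᵥ τ) = f τ) (τ : ℍ) : f ((N' : ℝ) +ᵥ τ) = f τ := by
  obtain ⟨c, rfl⟩ := h
  induction c generalizing τ with
  | zero => simp
  | succ c ih =>
    have : ((N * (c + 1) : ℕ) : ℝ) = ((N * c : ℕ) : ℝ) + N := by push_cast; ring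
    rw [this, add_vadd, ih, hf]

section Components

variable {ι : Type*} [Fintype ι]

/-- The polynomial part of a component. -/
def componentFinsupp (P : ℚ →₀ (ι → ℂ)) (i : ι) : ℚ →₀ ℂ := P.mapRange (fun a => a i) rfl

lemma componentFinsupp_apply (P : ℚ →₀ (ι → ℂ)) (i : ι) (m : ℚ) :
    componentFinsupp P i m = P m i := rfl

lemma sum_componentFinsupp (P : ℚ →₀ (ι → ℂ)) (i : ι) (z : ℂ) :
    ((componentFinsupp P i).sum fun r a => qExp r z * a) =
      P.sum fun r a => qExp r z * a i := by
  rw [componentFinsupp, Finsupp.sum_mapRange_index]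
  simp

/-- Taking v₀ ≥ 1 keeps the bound in the region where `ofComplex` is a genuine inverse of the
coercion. -/
lemma exists_component_bound {f : ℍ → ι → ℂ} {P : ℚ →₀ (ι → ℂ)} {ε : ℝ}
    (hO : ∀ ℓ : Module.Dual ℂ (ι → ℂ),
      (fun τ : ℍ => ℓ (f τ - P.sum fun m a => qPow m τ • a)) =O[atImInfty]
        (fun τ : ℍ => Real.exp (-ε * τ.im))) (i : ι) :
    ∃ K v₀ : ℝ, 0 < v₀ ∧ ∀ z : ℂ, v₀ ≤ z.im → ‖f (ofComplex z) i -
      (componentFinsupp P i).sum fun r a => qExp r z * a‖ ≤ K * Real.exp (-ε * z.im) := by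
  obtain ⟨K, hK⟩ := (hO (LinearMap.proj i)).bound
  obtain ⟨A, -, hA⟩ := atImInfty_basis.mem_iff.mp hK
  refine ⟨K, max A 1, lt_max_of_lt_right one_pos, fun z hz => ?_⟩
  have hz0 : 0 < z.im := (lt_max_of_lt_right one_pos).trans_le hz
  have hmem : ofComplex z ∈ UpperHalfPlane.im ⁻¹' Set.Ici A := by
    rw [Set.mem_preimage, Set.mem_Ici, ofComplex_im_of_im_pos hz0]
    exact (le_max_left _ _).trans hz
  have h := hA hmem
  simp only [Set.mem_ofPred_eq, ofComplex_im_of_im_pos hz0, Real.norm_eq_abs, Real.abs_exp] at h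
  refine le_trans (le_of_eq ?_) h
  congr 1
  rw [sum_componentFinsupp]
  simp only [LinearMap.proj_apply, Pi.sub_apply, Finsupp.sum, Finset.sum_apply, Pi.smul_apply,
    smul_eq_mul, qPow_eq_qExp, coe_ofComplex_of_im_pos hz0]

lemma dual_apply_eq_sum [DecidableEq ι] (ℓ : Module.Dual ℂ (ι → ℂ)) (x : ι → ℂ) :
    ℓ x = ∑ i, x i * ℓ (Pi.single i 1) := by
  conv_lhs => rw [pi_eq_sum_univ' x]
  rw [map_sum]
  refine Finset.sum_congr rfl fun i _ => ?_
  rw [map_smul, smul_eq_mul]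

/-- The Laplacian factors as Δ_{-k} = -v² D D̄ - ikv D̄; one power of v is cancelled. -/
lemma harmonic_iff_wirtinger {h : ℍ → ℂ} {k : ℕ}
    (hs : ContDiffOn ℝ ∞ (fun z : ℂ => h (ofComplex z)) {z : ℂ | 0 < z.im})
    (hΔ : ∀ τ : ℍ, hypLaplacian (-(k : ℤ)) h τ = 0) {z : ℂ} (hz : 0 < z.im) :
    z.im * wirtinger (wirtingerBar fun z => h (ofComplex z)) z =
      -Complex.I * k * wirtingerBar (fun z => h (ofComplex z)) z := by
  have h1 := hΔ (ofComplex z)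
  simp only [hypLaplacian, coe_ofComplex_of_im_pos hz, ofComplex_im_of_im_pos hz] at h1
  rw [wirtinger_wirtingerBar (hs.of_le two_le_infty) hz]
  have hne : (z.im : ℂ) ≠ 0 := by exact_mod_cast hz.ne'
  refine mul_left_cancel₀ hne ?_
  simp only [wirtingerBar]
  simp only [partialU, partialV] at h1 ⊢
  push_cast at h1
  linear_combination -h1

/-- A harmonic Maass form which is periodic has a Fourier expansion. -/
theorem exists_hasMaassExpansion [DecidableEq ι]
    {σ : Subgroup (SL(2, ℤ) × ((ι → ℂ) ≃ₗ[ℂ] (ι → ℂ)))} {k : ℕ} {f : ℍ → ι → ℂ}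
    (hf : IsHarmonicMaassForm σ (-(k : ℤ)) f) {N : ℕ} (hN : 0 < N)
    (hper : ∀ τ : ℍ, f ((N : ℝ) +ᵥ τ) = f τ) :
    ∃ cp cm : ℚ → ι → ℂ, HasMaassExpansion (-(k : ℤ)) f cp cm := by
  obtain ⟨P, hP, ε, hε, hO⟩ := hf.growth
  obtain ⟨N₁, hN₁, hPN⟩ := exists_common_denominator P
  -- N is a period of f and N₁ clears the denominators of P, so both F and its polynomial part live
  -- on exponents in (1/(N N₁))ℤ.
  have hM : 0 < N * N₁ := Nat.mul_pos hN hN₁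
  have hsm : ∀ i, ContDiffOn ℝ ∞ (fun z : ℂ => f (ofComplex z) i) {z : ℂ | 0 < z.im} := fun i =>
    hf.smooth (LinearMap.proj i)
  have hcomp : ∀ i, ∃ cp cm : ℚ → ℂ, (∀ m, cp m ≠ 0 → ∃ n : ℤ, ((N * N₁ : ℕ) : ℚ) * m = n) ∧
      (∀ m, cm m ≠ 0 → ∃ n : ℤ, ((N * N₁ : ℕ) : ℚ) * m = n) ∧
      (∀ m, m < 0 → componentFinsupp P i m = 0 → cp m = 0) ∧ (∀ m, 0 ≤ m → cm m = 0) ∧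
      (∀ z : ℂ, 0 < z.im → Summable fun m : ℚ => qExp m z * cp m) ∧
      (∀ z : ℂ, 0 < z.im → Summable fun m : ℚ =>
        (incGamma (1 - ((-(k : ℤ) : ℤ) : ℝ)) (4 * Real.pi * |(m : ℝ)| * z.im) : ℂ) *
          qExp m z * cm m) ∧
      ∀ z : ℂ, 0 < z.im → f (ofComplex z) i = (∑' m : ℚ, qExp m z * cp m) + ∑' m : ℚ,
        (incGamma (1 - ((-(k : ℤ) : ℤ) : ℝ)) (4 * Real.pi * |(m : ℝ)| * z.im) : ℂ) *
          qExp m z * cm m := by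
    intro i
    obtain ⟨K, v₀, hv₀, hK⟩ := exists_component_bound hO i
    refine exists_scalar_maassExpansion hM (hsm i) (fun z hz => ?_)
      (fun z hz => harmonic_iff_wirtinger (h := fun τ => f τ i) (hsm i)
        (hf.harmonic (LinearMap.proj i)) hz) (fun m hm => ?_) hε hv₀ hK
    · have := ofComplex_add_real hz ((N * N₁ : ℕ) : ℝ)
      rw [Complex.ofReal_natCast] at this
      rw [this, periodic_of_dvd (Dvd.intro _ rfl) hper]
    · refine exists_int_mul_of_dvd (Dvd.intro_left _ rfl) (hPN m fun h => hm ?_)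
      rw [componentFinsupp_apply, h]; rfl
  choose cp cm h1 h2 h3 h4 h5 h6 h7 using hcomp
  have hp : ∀ (ℓ : Module.Dual ℂ (ι → ℂ)) (z : ℂ) (m : ℚ), qExp m z * ℓ (fun i => cp i m) =
      ∑ i, (qExp m z * cp i m) * ℓ (Pi.single i 1) := fun ℓ z m => by
    rw [dual_apply_eq_sum ℓ, Finset.mul_sum]
    exact Finset.sum_congr rfl fun i _ => by ring
  have hm : ∀ (ℓ : Module.Dual ℂ (ι → ℂ)) (z : ℂ) (m : ℚ),
      (incGamma (1 - ((-(k : ℤ) : ℤ) : ℝ)) (4 * Real.pi * |(m : ℝ)| * z.im) : ℂ) * qExp m z *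
        ℓ (fun i => cm i m) = ∑ i, ((incGamma (1 - ((-(k : ℤ) : ℤ) : ℝ))
          (4 * Real.pi * |(m : ℝ)| * z.im) : ℂ) * qExp m z * cm i m) * ℓ (Pi.single i 1) :=
    fun ℓ z m => by
      rw [dual_apply_eq_sum ℓ, Finset.mul_sum]
      exact Finset.sum_congr rfl fun i _ => by ring
  have hsp : ∀ (ℓ : Module.Dual ℂ (ι → ℂ)) (τ : ℍ), HasSum
      (fun m : ℚ => qPow m τ * ℓ (fun i => cp i m))
      (∑ i, (∑' m : ℚ, qExp m τ * cp i m) * ℓ (Pi.single i 1)) := fun ℓ τ => by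
    simp only [qPow_eq_qExp, hp]
    exact hasSum_sum fun i _ => (h5 i τ τ.im_pos).hasSum.mul_right _
  have hsm' : ∀ (ℓ : Module.Dual ℂ (ι → ℂ)) (τ : ℍ), HasSum
      (fun m : ℚ => (incGamma (1 - ((-(k : ℤ) : ℤ) : ℝ)) (4 * Real.pi * |(m : ℝ)| * τ.im) : ℂ) *
        qPow m τ * ℓ (fun i => cm i m))
      (∑ i, (∑' m : ℚ, (incGamma (1 - ((-(k : ℤ) : ℤ) : ℝ))
        (4 * Real.pi * |(m : ℝ)| * τ.im) : ℂ) * qExp m τ * cm i m) *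
          ℓ (Pi.single i 1)) := fun ℓ τ => by
    have := fun m => hm ℓ τ m
    simp only [qPow_eq_qExp, UpperHalfPlane.coe_im] at this ⊢
    simp only [this]
    exact hasSum_sum fun i _ => (h6 i τ τ.im_pos).hasSum.mul_right _
  refine ⟨fun m i => cp i m, fun m i => cm i m, ?_⟩
  constructor
  · refine ⟨N * N₁, hM, fun m hm => ?_⟩
    obtain ⟨i, hi⟩ := Function.ne_iff.mp hm
    exact h1 i m hi
  · refine ⟨N * N₁, hM, fun m hm => ?_⟩
    obtain ⟨i, hi⟩ := Function.ne_iff.mp hm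
    exact h2 i m hi
  -- Below both 0 and the support of P, the holomorphic coefficients coincide with those of P and
  -- vanish.
  · obtain ⟨m₁, hm₁⟩ := P.support.bddBelow
    refine ⟨min m₁ 0, fun m hm => funext fun i => h3 i m (hm.trans_le (min_le_right _ _)) ?_⟩
    have : P m = 0 := by
      by_contra h
      have := hm₁ (Finset.mem_coe.mpr (Finsupp.mem_support_iff.mpr h))
      exact absurd (hm.trans_le (min_le_left _ _)) (not_lt.mpr this)
    rw [componentFinsupp_apply, this]; rfl
  · exact fun m hm => funext fun i => h4 i m hm
  · exact fun ℓ τ => (hsp ℓ τ).summable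
  · exact fun ℓ τ => (hsm' ℓ τ).summable
  · intro ℓ τ
    rw [(hsp ℓ τ).tsum_eq, (hsm' ℓ τ).tsum_eq, dual_apply_eq_sum ℓ, ← Finset.sum_add_distrib]
    refine Finset.sum_congr rfl fun i _ => ?_
    have := h7 i τ τ.im_pos
    rw [ofComplex_apply] at this
    rw [this, add_mul]
    rfl

lemma hasSum_rat_of_hasSum_nat {N : ℕ} (hN : 0 < N) (a : ℕ → ℂ) {τ : ℍ} {x : ℂ}
    (h : HasSum (fun n : ℕ => a n • Function.Periodic.qParam N (τ : ℂ) ^ n) x) :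
    HasSum (fun m : ℚ => qPow m τ * Function.extend (fun n : ℕ => (n : ℚ) / N) a 0 m) x := by
  have hNq : (N : ℚ) ≠ 0 := by exact_mod_cast hN.ne'
  have hinj : Function.Injective fun n : ℕ => (n : ℚ) / N := fun a b hab => by
    have := (div_left_inj' hNq).mp hab
    exact_mod_cast this
  rw [← hinj.hasSum_iff]
  · refine h.congr_fun fun n => ?_
    rw [Function.comp_apply, hinj.extend_apply, Function.Periodic.qParam, ← Complex.exp_nat_mul,
      smul_eq_mul, mul_comm, qPow]
    congr 2
    push_cast
    ring
  · intro m hm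
    rw [Function.extend_apply' _ _ _ (by simpa using hm)]
    simp

lemma dual_eq_sum_proj [DecidableEq ι] (x : Module.Dual ℂ (ι → ℂ)) :
    x = ∑ i, x (Pi.single i 1) • (LinearMap.proj i : Module.Dual ℂ (ι → ℂ)) := by
  ext i
  simp [Pi.single_apply]

/-- A holomorphic form which is periodic has a `q`-expansion. -/
theorem exists_hasQExpansion [DecidableEq ι]
    {σ : Subgroup (SL(2, ℤ) × (Module.Dual ℂ (ι → ℂ) ≃ₗ[ℂ] Module.Dual ℂ (ι → ℂ)))} {k : ℤ}
    {g : ℍ → Module.Dual ℂ (ι → ℂ)} (hg : IsHolomorphicForm σ k g) {N : ℕ} (hN : 0 < N)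
    (hper : ∀ τ : ℍ, g ((N : ℝ) +ᵥ τ) = g τ) :
    ∃ b : ℚ → Module.Dual ℂ (ι → ℂ), HasQExpansion g b := by
  have hNr : (0 : ℝ) < N := by exact_mod_cast hN
  have hcomp : ∀ i, ∃ a : ℕ → ℂ, ∀ τ : ℍ, HasSum
      (fun m : ℚ => qPow m τ * Function.extend (fun n : ℕ => (n : ℚ) / N) a 0 m)
      (g τ (Pi.single i 1)) := by
    intro i
    have hper' : Function.Periodic ((fun τ : ℍ => g τ (Pi.single i 1)) ∘ ofComplex)
        ((N : ℝ) : ℂ) := by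
      intro z
      simp only [Function.comp_apply]
      by_cases hz : 0 < z.im
      · rw [ofComplex_add_real hz, hper]
      -- Off the upper half plane `ofComplex` takes one default value, so periodicity is trivial
      -- there.
      · have hz' : ¬ 0 < (z + (N : ℝ)).im := by simpa using hz
        rw [ofComplex_apply_of_im_nonpos (not_lt.mp hz),
          ofComplex_apply_of_im_nonpos (not_lt.mp hz')]
    have hmd := (UpperHalfPlane.mdifferentiable_iff (f := fun τ : ℍ => g τ (Pi.single i 1))).mpr
        (hg.holomorphic (Module.Dual.eval ℂ (ι → ℂ) (Pi.single i 1)))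
    exact ⟨_, fun τ => hasSum_rat_of_hasSum_nat hN _ (UpperHalfPlane.hasSum_qExpansion hNr hper' hmd
      (hg.bounded (Module.Dual.eval ℂ (ι → ℂ) (Pi.single i 1))) τ)⟩
  choose a ha using hcomp
  set c : ι → ℚ → ℂ := fun i => Function.extend (fun n : ℕ => (n : ℚ) / N) (a i) 0 with hc
  have hNq : (N : ℚ) ≠ 0 := by exact_mod_cast hN.ne'
  have hc0 : ∀ m : ℚ, (¬ ∃ n : ℕ, (n : ℚ) / N = m) → ∀ i, c i m = 0 := fun m hm i => by
    simp only [hc]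
    rw [Function.extend_apply' _ _ _ hm]
    rfl
  refine ⟨fun m => ∑ i, c i m • (LinearMap.proj i : Module.Dual ℂ (ι → ℂ)), ⟨N, hN, fun m hm => ?_⟩,
    fun m hm => ?_, fun ℓ τ => ?_⟩
  · by_contra h
    refine hm (Finset.sum_eq_zero fun i _ => ?_)
    rw [hc0 m (fun ⟨n, hn⟩ => h ⟨n, by rw [← hn]; push_cast; field_simp⟩) i, zero_smul]
  · refine Finset.sum_eq_zero fun i _ => ?_
    rw [hc0 m (fun ⟨n, hn⟩ => not_le.mpr hm (by rw [← hn]; positivity)) i, zero_smul]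
  · rw [dual_eq_sum_proj (g τ), map_sum]
    simp only [map_sum, map_smul, smul_eq_mul, Finset.mul_sum]
    refine hasSum_sum fun i _ => ?_
    refine ((ha i τ).mul_right (ℓ (LinearMap.proj i))).congr_fun fun m => ?_
    rw [mul_assoc]

end Components

/-! ### Constant terms as limits of horizontal integrals -/

section Scalar

variable {b : ℚ → ℂ} {B : ℂ → ℂ}

/-- With non-negative exponents |q^m| decreases in Im z, so the absolutely convergent series at z =
i dominates. -/
lemma exists_bound_of_hasSum_qExp (hb : ∀ m < 0, b m = 0)
    (hB : ∀ z : ℂ, 0 < z.im → HasSum (fun m : ℚ => qExp m z * b m) (B z)) :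
    ∃ K : ℝ, 0 ≤ K ∧ ∀ z : ℂ, 1 ≤ z.im → ‖B z‖ ≤ K := by
  have hs : Summable fun m : ℚ => ‖qExp m Complex.I * b m‖ := (hB Complex.I (by simp)).summable.norm
  refine ⟨∑' m : ℚ, ‖qExp m Complex.I * b m‖, tsum_nonneg fun m => norm_nonneg _, fun z hz => ?_⟩
  rw [← (hB z (one_pos.trans_le hz)).tsum_eq]
  refine tsum_of_norm_bounded hs.hasSum fun m => ?_
  rcases lt_or_ge m 0 with hm | hm
  · rw [hb m hm]; simp
  · rw [norm_mul, norm_mul]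
    refine mul_le_mul_of_nonneg_right ?_ (norm_nonneg _)
    rw [norm_qExp, norm_qExp, Complex.I_im]
    refine Real.exp_le_exp.mpr ?_
    have hm' : (0 : ℝ) ≤ m := by exact_mod_cast hm
    nlinarith [mul_nonneg Real.pi_pos.le hm', mul_nonneg (mul_nonneg Real.pi_pos.le hm')
      (sub_nonneg.mpr hz)]

lemma continuousOn_of_hasSum_qExp
    (hB : ∀ z : ℂ, 0 < z.im → HasSum (fun m : ℚ => qExp m z * b m) (B z)) :
    DifferentiableOn ℂ B {z : ℂ | 0 < z.im} :=
  (differentiableOn_tsum_qExp (c := b) fun τ => (hB τ τ.im_pos).summable).congr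
    fun z hz => (hB z hz).tsum_eq.symm

/-- The constant term of the product of a function close to an exponential polynomial with a
`q`-series. -/
lemma tendsto_integral_mul {N : ℕ} (hN : 0 < N) {p : ℚ →₀ ℂ}
    (hsup : ∀ m, p m ≠ 0 → ∃ n : ℤ, (N : ℚ) * m = n) {h : ℂ → ℂ}
    (hh : ContinuousOn h {z : ℂ | 0 < z.im}) {K ε v₀ : ℝ} (hε : 0 < ε)
    (hg : ∀ z : ℂ, v₀ ≤ z.im → ‖h z - p.sum fun r a => qExp r z * a‖ ≤ K * Real.exp (-ε * z.im))
    (hb : ∀ m < 0, b m = 0) (hbN : ∀ m, b m ≠ 0 → ∃ n : ℤ, (N : ℚ) * m = n)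
    (hB : ∀ z : ℂ, 0 < z.im → HasSum (fun m : ℚ => qExp m z * b m) (B z)) :
    Filter.Tendsto (fun v : ℝ => (N : ℂ)⁻¹ * ∫ u in (0 : ℝ)..N,
      h (u + v * Complex.I) * B (u + v * Complex.I)) Filter.atTop
      (nhds (p.sum fun m a => a * b (-m))) := by
  obtain ⟨KB, hKB0, hKB⟩ := exists_bound_of_hasSum_qExp hb hB
  have hNr : (0 : ℝ) < N := by exact_mod_cast hN
  have hNc : (N : ℂ) ≠ 0 := by exact_mod_cast hN.ne'
  have hBc := (continuousOn_of_hasSum_qExp hB).continuousOn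
  rw [tendsto_iff_norm_sub_tendsto_zero]
  refine squeeze_zero' (Filter.Eventually.of_forall fun v => norm_nonneg _) ?_
    (tendsto_mul_exp_neg_mul (neg_lt_zero.mpr hε) (K * KB))
  filter_upwards [Filter.eventually_ge_atTop (max v₀ 1)] with v hv
  have hv0 : v₀ ≤ v := (le_max_left _ _).trans hv
  have hv1 : 1 ≤ v := (le_max_right _ _).trans hv
  have hvp : 0 < v := one_pos.trans_le hv1
  have hBv := continuous_horizontal hBc hvp
  -- For the polynomial the value is exact at every height: q^r extracts the coefficient of q^(-r)
  -- from the series. Only the error term, of size K·KB·e^(-εv), depends on v.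
  have hpoly : (N : ℂ)⁻¹ * ∫ u in (0 : ℝ)..N, (p.sum fun r a => qExp r (u + v * Complex.I) * a) *
      B (u + v * Complex.I) = p.sum fun m a => a * b (-m) := by
    simp only [Finsupp.sum, Finset.sum_mul]
    rw [intervalIntegral.integral_finsetSum, Finset.mul_sum]
    · refine Finset.sum_congr rfl fun r hr => ?_
      have hrN := hsup r (Finsupp.mem_support_iff.mp hr)
      have hmode := fourierMode_of_hasSum hN (v := v) hbN
        (fun u => hB (u + v * Complex.I) (by rw [im_ofReal_add_mul_I]; exact hvp))
        (m := -r) (by obtain ⟨n, hn⟩ := hrN; exact ⟨-n, by push_cast; rw [← hn]; ring⟩)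
      rw [fourierMode, neg_neg] at hmode
      have hint : ∫ u in (0 : ℝ)..N, qExp r (u + v * Complex.I) * p r * B (u + v * Complex.I) =
          p r * ∫ u in (0 : ℝ)..N, B (u + v * Complex.I) * qExp r (u + v * Complex.I) := by
        rw [← intervalIntegral.integral_const_mul]
        refine intervalIntegral.integral_congr fun u _ => ?_
        ring
      rw [hint, ← hmode]
      ring
    · intro r _
      refine Continuous.intervalIntegrable ?_ _ _
      exact (((continuous_qExp _).comp (by fun_prop)).mul continuous_const).mul hBv
  have hc1 : Continuous fun u : ℝ => h (u + v * Complex.I) * B (u + v * Complex.I) :=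
    (continuous_horizontal hh hvp).mul hBv
  have hc2 : Continuous fun u : ℝ => (p.sum fun r a => qExp r (u + v * Complex.I) * a) *
      B (u + v * Complex.I) := by
    refine Continuous.mul ?_ hBv
    refine continuous_finsetSum _ fun r _ => ?_
    exact ((continuous_qExp _).comp (by fun_prop)).mul continuous_const
  rw [← hpoly, ← mul_sub, ← intervalIntegral.integral_sub (hc1.intervalIntegrable _ _)
    (hc2.intervalIntegrable _ _), norm_mul, norm_inv, Complex.norm_natCast, inv_mul_le_iff₀ hNr]
  have hbd : ‖∫ u in (0 : ℝ)..N, (h (u + v * Complex.I) * B (u + v * Complex.I) -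
      (p.sum fun r a => qExp r (u + v * Complex.I) * a) * B (u + v * Complex.I))‖ ≤
      (K * KB * Real.exp (-ε * v)) * |(N : ℝ) - 0| := by
    refine intervalIntegral.norm_integral_le_of_norm_le_const fun u _ => ?_
    have him : ((u : ℂ) + v * Complex.I).im = v := im_ofReal_add_mul_I u v
    rw [← sub_mul, norm_mul]
    have h1 := hg (u + v * Complex.I) (by rw [him]; exact hv0)
    have h2 := hKB (u + v * Complex.I) (by rw [him]; exact hv1)
    rw [him] at h1
    refine (mul_le_mul h1 h2 (norm_nonneg _) ((norm_nonneg _).trans h1)).trans (le_of_eq ?_)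
    ring
  refine hbd.trans (le_of_eq ?_)
  rw [sub_zero, abs_of_pos hNr, mul_comm]

end Scalar

/-- The components of f and g have only some period N, while their pairing has period 1. This passes
from N-periods, where the q^m are orthogonal, to the upper edge of the fundamental domain. -/
lemma natCast_mul_integral_of_periodic {F : ℝ → ℂ} (hF : Function.Periodic F 1)
    (hc : Continuous F) (N : ℕ) :
    ∫ u in (0 : ℝ)..N, F u = N * ∫ u in (-(1 / 2) : ℝ)..(1 / 2), F u := by
  have h1 := hF.intervalIntegral_add_zsmul_eq (N : ℤ) 0
  have h2 := hF.intervalIntegral_add_eq 0 (-(1 / 2))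
  have e : (-(1 / 2) : ℝ) + 1 = 1 / 2 := by norm_num
  rw [e] at h2
  rw [h2] at h1
  simpa using h1 fun _ _ => hc.intervalIntegrable _ _

section Pairing

variable {ι : Type*} [Fintype ι] [DecidableEq ι] {f : ℍ → ι → ℂ} {P : ℚ →₀ (ι → ℂ)} {ε : ℝ}

lemma HasQExpansion.hasSum_component {G : ℍ → Module.Dual ℂ (ι → ℂ)}
    {b : ℚ → Module.Dual ℂ (ι → ℂ)} (hG : HasQExpansion G b) (i : ι) {z : ℂ} (hz : 0 < z.im) :
    HasSum (fun m : ℚ => qExp m z * b m (Pi.single i 1)) (G (ofComplex z) (Pi.single i 1)) := by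
  have := hG.hasSum (Module.Dual.eval ℂ (ι → ℂ) (Pi.single i 1)) (ofComplex z)
  simpa only [qPow_eq_qExp, coe_ofComplex_of_im_pos hz, Module.Dual.eval_apply] using this

lemma tendsto_integral_component (hε : 0 < ε)
    (hfc : ∀ i, ContinuousOn (fun z => f (ofComplex z) i) {z : ℂ | 0 < z.im})
    (hO : ∀ ℓ : Module.Dual ℂ (ι → ℂ),
      (fun τ : ℍ => ℓ (f τ - P.sum fun m a => qPow m τ • a)) =O[atImInfty]
        (fun τ : ℍ => Real.exp (-ε * τ.im)))
    {G : ℍ → Module.Dual ℂ (ι → ℂ)} {b : ℚ → Module.Dual ℂ (ι → ℂ)} (hG : HasQExpansion G b)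
    {N : ℕ} (hN : 0 < N) (hPN : ∀ m, P m ≠ 0 → ∃ n : ℤ, (N : ℚ) * m = n)
    (hbN : ∀ m, b m ≠ 0 → ∃ n : ℤ, (N : ℚ) * m = n) (i : ι) :
    Filter.Tendsto (fun v : ℝ => (N : ℂ)⁻¹ * ∫ u in (0 : ℝ)..N,
      f (ofComplex (u + v * Complex.I)) i *
        G (ofComplex (u + v * Complex.I)) (Pi.single i 1)) Filter.atTop
      (nhds ((componentFinsupp P i).sum fun m a => a * b (-m) (Pi.single i 1))) := by
  obtain ⟨K, v₀, -, hK⟩ := exists_component_bound hO i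
  have h1 : ∀ m, componentFinsupp P i m ≠ 0 → ∃ n : ℤ, (N : ℚ) * m = n := fun m hm =>
    hPN m fun h => hm (by rw [componentFinsupp_apply, h]; rfl)
  have h2 : ∀ m < 0, b m (Pi.single i 1) = 0 := fun m hm => by rw [hG.nonneg m hm]; rfl
  have h3 : ∀ m, b m (Pi.single i 1) ≠ 0 → ∃ n : ℤ, (N : ℚ) * m = n := fun m hm =>
    hbN m fun h => hm (by rw [h]; rfl)
  have h4 : ∀ z : ℂ, 0 < z.im → HasSum (fun m : ℚ => qExp m z * b m (Pi.single i 1))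
      (G (ofComplex z) (Pi.single i 1)) := fun z hz => hG.hasSum_component i hz
  exact tendsto_integral_mul (b := fun m => b m (Pi.single i 1))
      (B := fun z => G (ofComplex z) (Pi.single i 1)) (p := componentFinsupp P i)
      (h := fun z => f (ofComplex z) i) hN h1 (hfc i) hε hK h2 h3 h4

/-- The constant term of the pairing of a function with polynomial part `P` and a `q`-series. -/
lemma tendsto_integral_pairing (hε : 0 < ε)
    (hfc : ∀ i, ContinuousOn (fun z => f (ofComplex z) i) {z : ℂ | 0 < z.im})
    (hO : ∀ ℓ : Module.Dual ℂ (ι → ℂ),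
      (fun τ : ℍ => ℓ (f τ - P.sum fun m a => qPow m τ • a)) =O[atImInfty]
        (fun τ : ℍ => Real.exp (-ε * τ.im)))
    {G : ℍ → Module.Dual ℂ (ι → ℂ)} {b : ℚ → Module.Dual ℂ (ι → ℂ)} (hG : HasQExpansion G b)
    (hper : ∀ τ : ℍ, G ((1 : ℝ) +ᵥ τ) (f ((1 : ℝ) +ᵥ τ)) = G τ (f τ)) :
    Filter.Tendsto (fun v : ℝ => ∫ u in (-(1 / 2) : ℝ)..(1 / 2),
      G (ofComplex (u + v * Complex.I)) (f (ofComplex (u + v * Complex.I)))) Filter.atTop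
      (nhds (P.sum fun m a => b (-m) a)) := by
  obtain ⟨N, hN, hPN, hbN⟩ : ∃ N : ℕ, 0 < N ∧ (∀ m, P m ≠ 0 → ∃ n : ℤ, (N : ℚ) * m = n) ∧
      ∀ m, b m ≠ 0 → ∃ n : ℤ, (N : ℚ) * m = n := by
    obtain ⟨N₁, hN₁, hPN⟩ := exists_common_denominator P
    obtain ⟨N₂, hN₂, hbN⟩ := hG.denom
    exact ⟨N₁ * N₂, Nat.mul_pos hN₁ hN₂,
      fun m hm => exists_int_mul_of_dvd (Dvd.intro _ rfl) (hPN m hm),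
      fun m hm => exists_int_mul_of_dvd (Dvd.intro_left _ rfl) (hbN m hm)⟩
  have hNc : (N : ℂ) ≠ 0 := by exact_mod_cast hN.ne'
  have hlim : Filter.Tendsto (fun v : ℝ => ∑ i, (N : ℂ)⁻¹ *
      ∫ u in (0 : ℝ)..N, f (ofComplex (u + v * Complex.I)) i *
        G (ofComplex (u + v * Complex.I)) (Pi.single i 1)) Filter.atTop
      (nhds (∑ i, (componentFinsupp P i).sum fun m a => a * b (-m) (Pi.single i 1))) := by
    exact tendsto_finsetSum _ fun i _ => tendsto_integral_component hε hfc hO hG hN hPN hbN i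
  have hval : ∑ i, (componentFinsupp P i).sum (fun m a => a * b (-m) (Pi.single i 1)) =
      P.sum fun m a => b (-m) a := by
    have : ∀ i, (componentFinsupp P i).sum (fun m a => a * b (-m) (Pi.single i 1)) =
        P.sum fun m a => a i * b (-m) (Pi.single i 1) := fun i => by
      rw [componentFinsupp, Finsupp.sum_mapRange_index]
      simp
    rw [Finset.sum_congr rfl fun i _ => this i]
    simp only [Finsupp.sum]
    rw [Finset.sum_comm]
    exact Finset.sum_congr rfl fun m _ => (dual_apply_eq_sum _ _).symm
  rw [hval] at hlim
  refine hlim.congr' ?_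
  filter_upwards [Filter.eventually_gt_atTop 0] with v hv
  have hcont : ∀ i, Continuous fun u : ℝ => f (ofComplex (u + v * Complex.I)) i *
      G (ofComplex (u + v * Complex.I)) (Pi.single i 1) := fun i =>
    (continuous_horizontal (hfc i) hv).mul (continuous_horizontal
      (h := fun z => G (ofComplex z) (Pi.single i 1))
      (continuousOn_of_hasSum_qExp fun z hz => hG.hasSum_component i hz).continuousOn hv)
  rw [← Finset.mul_sum, ← intervalIntegral.integral_finsetSum
    (fun i _ => (hcont i).intervalIntegrable _ _)]
  have hF : Function.Periodic (fun u : ℝ => G (ofComplex (u + v * Complex.I))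
      (f (ofComplex (u + v * Complex.I)))) 1 := by
    intro u
    have e : ((u + 1 : ℝ) : ℂ) + v * Complex.I = (u + v * Complex.I) + (1 : ℝ) := by
      push_cast; ring
    beta_reduce
    rw [e, ofComplex_add_real (by rw [im_ofReal_add_mul_I]; exact hv), hper]
  have hsum : (fun u : ℝ => G (ofComplex (u + v * Complex.I)) (f (ofComplex (u + v * Complex.I)))) =
      fun u : ℝ => ∑ i, f (ofComplex (u + v * Complex.I)) i *
        G (ofComplex (u + v * Complex.I)) (Pi.single i 1) := funext fun u =>
    dual_apply_eq_sum _ _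
  have h1 := natCast_mul_integral_of_periodic hF
    (by rw [hsum]; exact continuous_finsetSum _ fun i _ => hcont i) N
  rw [inv_mul_eq_iff_eq_mul₀ hNc, ← h1, hsum]

/-- The principal part of the holomorphic part of a harmonic Maass form is the Fourier polynomial
in the growth condition. -/
lemma HasMaassExpansion.eq_polynomial {k : ℕ} {cp cm : ℚ → ι → ℂ}
    (hexp : HasMaassExpansion (-(k : ℤ)) f cp cm) (hε : 0 < ε)
    (hfc : ∀ i, ContinuousOn (fun z => f (ofComplex z) i) {z : ℂ | 0 < z.im})
    (hO : ∀ ℓ : Module.Dual ℂ (ι → ℂ),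
      (fun τ : ℍ => ℓ (f τ - P.sum fun m a => qPow m τ • a)) =O[atImInfty]
        (fun τ : ℍ => Real.exp (-ε * τ.im))) {m : ℚ} (hm : m ≤ 0) : cp m = P m := by
  obtain ⟨N₁, hN₁, hPN⟩ := exists_common_denominator P
  obtain ⟨N₂, hN₂, hcpN⟩ := hexp.denom_cp
  obtain ⟨N₃, hN₃, hcmN⟩ := hexp.denom_cm
  -- The factor `m.den` places m itself in (1/N)ℤ, so that its mode can be read off even when no
  -- series is supported at m.
  set N := N₁ * N₂ * N₃ * m.den with hNdef
  have hN : 0 < N := by have := m.den_pos; positivity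
  have d1 : N₁ ∣ N := ⟨N₂ * N₃ * m.den, by rw [hNdef]; ring⟩
  have d2 : N₂ ∣ N := ⟨N₁ * N₃ * m.den, by rw [hNdef]; ring⟩
  have d3 : N₃ ∣ N := ⟨N₁ * N₂ * m.den, by rw [hNdef]; ring⟩
  have d4 : m.den ∣ N := ⟨N₁ * N₂ * N₃, by rw [hNdef]; ring⟩
  have hmN : ∃ n : ℤ, (N : ℚ) * m = n :=
    exists_int_mul_of_dvd d4 ⟨m.num, Rat.den_mul_eq_num m⟩
  funext i
  obtain ⟨K, v₀, hv₀, hK⟩ := exists_component_bound hO i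
  have hgr : ∀ v, v₀ ≤ v → ‖fourierMode N (fun z => f (ofComplex z) i) m v -
      componentFinsupp P i m‖ ≤ K * Real.exp ((2 * Real.pi * (m : ℝ) - ε) * v) := fun v hv =>
    norm_fourierMode_sub_le hN (fun r hr => exists_int_mul_of_dvd d1 (hPN r fun h => hr (by
      rw [componentFinsupp_apply, h]; rfl))) (hfc i) hv₀ hK hmN hv
  have hm' : (m : ℝ) ≤ 0 := by exact_mod_cast hm
  -- For m ≤ 0 the rate 2πm - ε is negative, so the mode tends to P(m). It also tends to c⁺(m): the
  -- incomplete Gamma function decays for m < 0, and c⁻(0) = 0.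
  have hlim := tendsto_of_growth
    (by nlinarith [mul_nonpos_of_nonneg_of_nonpos Real.pi_pos.le hm']) hgr
  have hmode : ∀ v : ℝ, 0 < v → fourierMode N (fun z => f (ofComplex z) i) m v = cp m i +
      (incGamma (1 - ((-(k : ℤ) : ℤ) : ℝ)) (4 * Real.pi * |(m : ℝ)| * v) : ℂ) * cm m i := by
    intro v hv
    refine fourierMode_of_hasSum (C := fun m => cp m i +
      (incGamma (1 - ((-(k : ℤ) : ℤ) : ℝ)) (4 * Real.pi * |(m : ℝ)| * v) : ℂ) * cm m i) hN
      (fun r hr => ?_) (fun u => ?_) hmN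
    · by_cases h : cp r = 0
      · refine exists_int_mul_of_dvd d3 (hcmN r fun h' => hr ?_)
        rw [h, h']; simp
      · exact exists_int_mul_of_dvd d2 (hcpN r h)
    · have hz : 0 < ((u : ℂ) + v * Complex.I).im := by rw [im_ofReal_add_mul_I]; exact hv
      have him : (ofComplex ((u : ℂ) + v * Complex.I) : ℍ).im = v := by
        rw [ofComplex_im_of_im_pos hz, im_ofReal_add_mul_I]
      have h1 := (hexp.summable_cp (LinearMap.proj i) (ofComplex (u + v * Complex.I))).hasSum
      have h2 := (hexp.summable_cm (LinearMap.proj i) (ofComplex (u + v * Complex.I))).hasSum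
      have h3 := h1.add h2
      rw [← hexp.eq] at h3
      refine h3.congr_fun fun r => ?_
      simp only [qPow_eq_qExp, coe_ofComplex_of_im_pos hz, him, LinearMap.proj_apply]
      ring
  have hlim2 : Filter.Tendsto (fun v : ℝ => cp m i +
      (incGamma (1 - ((-(k : ℤ) : ℤ) : ℝ)) (4 * Real.pi * |(m : ℝ)| * v) : ℂ) * cm m i)
      Filter.atTop (nhds (cp m i)) := by
    rcases hm.eq_or_lt with h0 | h0
    · rw [hexp.cm_neg m h0.ge]
      simp
    · have hr : 0 < 4 * Real.pi * |(m : ℝ)| := by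
        have : (m : ℝ) ≠ 0 := by exact_mod_cast h0.ne
        have := abs_pos.mpr this
        positivity
      have h1 := (tendsto_incGamma_atTop k).comp (Filter.tendsto_id.const_mul_atTop hr)
      have h2 := (((Complex.continuous_ofReal.tendsto _).comp h1).mul_const (cm m i)).const_add
        (cp m i)
      simpa using h2
  have hlim3 : Filter.Tendsto (fun v => fourierMode N (fun z => f (ofComplex z) i) m v)
      Filter.atTop (nhds (cp m i)) := by
    refine hlim2.congr' ?_
    filter_upwards [Filter.eventually_gt_atTop 0] with v hv using (hmode v hv).symm
  exact tendsto_nhds_unique hlim3 hlim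

end Pairing

/-- After m ↦ -m, the terms with m > 0 vanish because b has no negative exponents, and for m ≤ 0 the
coefficients are those of P. The `finsum` therefore has finite support and carries its intended
value. -/
lemma constTerm_pairSeries_eq_sum {W : Type*} [AddCommGroup W] [Module ℂ W] {P : ℚ →₀ W}
    {cp : ℚ → W} {b : ℚ → Module.Dual ℂ W} (hb : ∀ m < 0, b m = 0)
    (hcp : ∀ m, m ≤ 0 → cp m = P m) :
    constTerm (pairSeries cp b) = P.sum fun m a => b (-m) a := by
  have h : ∀ m : ℚ, b (-m) (cp (0 - -m)) = b (-m) (P m) := by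
    intro m
    rcases le_or_gt m 0 with hm | hm
    · rw [zero_sub, neg_neg, hcp m hm]
    · rw [hb _ (by simpa using hm)]; rfl
  rw [constTerm, pairSeries, ← finsum_comp_equiv (Equiv.neg ℚ)]
  simp only [Equiv.neg_apply, h]
  refine finsum_eq_sum_of_support_subset _ fun m hm => ?_
  rw [Finset.mem_coe, Finsupp.mem_support_iff]
  exact fun h0 => hm (by beta_reduce; rw [h0, map_zero])

/-! ### Integrals over the truncated domain and the decay of the boundary term -/

lemma integrableOn_truncatedDomain {F : ℂ → ℂ} (hF : ContinuousOn F {z : ℂ | 0 < z.im}) (T : ℝ) :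
    IntegrableOn (fun τ : ℍ => F τ) (truncatedDomain T) :=
  (hF.comp_continuous UpperHalfPlane.continuous_coe
    fun τ => τ.im_pos).continuousOn.integrableOn_compact (ModularGroup.isCompact_truncatedFundamentalDomain T)

lemma im_pos_of_mem_above_arc {u v T : ℝ} (hu : u ∈ Set.uIcc (-(1 / 2) : ℝ) (1 / 2))
    (hT : 1 ≤ T) (hv : v ∈ Set.uIcc (√(1 - u ^ 2)) T) : 0 < v := by
  rw [Set.uIcc_of_le (by norm_num)] at hu
  exact (lt_min (Real.sqrt_pos.mpr (one_sub_sq_pos_of_mem hu)) (one_pos.trans_le hT)).trans_le hv.1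

/-- The factor v² cancels the density of the invariant measure, turning `truncatedDomain` integrals
into the euclidean ones of Stokes' theorem. -/
lemma setIntegral_im_sq_mul {F : ℂ → ℂ} (hF : ContinuousOn F {z : ℂ | 0 < z.im}) {T : ℝ}
    (hT : 1 ≤ T) : ∫ τ in truncatedDomain T, ((τ : ℂ).im : ℂ) ^ 2 * F τ =
      ∫ u in (-(1 / 2) : ℝ)..(1 / 2), ∫ v in (√(1 - u ^ 2))..T, F (u + v * Complex.I) := by
  rw [setIntegral_truncatedDomain (F := fun z => (z.im : ℂ) ^ 2 * F z) (by fun_prop) hT]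
  refine intervalIntegral.integral_congr fun u hu => ?_
  refine intervalIntegral.integral_congr fun v hv => ?_
  have hne : (v : ℂ) ≠ 0 := by exact_mod_cast (im_pos_of_mem_above_arc hu hT hv).ne'
  simp only [im_ofReal_add_mul_I]
  field_simp

lemma continuous_integral_horizontal {F : ℂ → ℂ} (hF : ContinuousOn F {z : ℂ | 0 < z.im})
    (a b : ℝ) : ContinuousOn (fun v : ℝ => ∫ u in a..b, F (u + v * Complex.I)) (Set.Ioi 0) := by
  have hc : ContinuousOn (fun p : ℝ × ℝ => F (p.2 + p.1 * Complex.I))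
      (Set.Ioi 0 ×ˢ Set.univ) := by
    refine hF.comp (by fun_prop) fun p hp => ?_
    rw [Set.mem_ofPred_eq, im_ofReal_add_mul_I]
    exact hp.1
  intro v hv
  have h : ContinuousOn (fun v : ℝ => ∫ u in a..b, F (u + v * Complex.I)) (Set.Ioi 0) := by
    rw [continuousOn_iff_continuous_domRestrict]
    refine intervalIntegral.continuous_parametric_intervalIntegral_of_continuous' ?_ a b
    exact hc.comp_continuous (f := fun p : Set.Ioi (0 : ℝ) × ℝ => ((p.1 : ℝ), p.2)) (by fun_prop)
      fun p => ⟨p.1.2, Set.mem_univ _⟩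
  exact h v hv

/-- A family of horizontal integrals whose increments and whose averages over unit intervals tend
to zero tends to zero. -/
lemma tendsto_zero_of_average {E Q C : ℝ → ℂ} (hE : ContinuousOn E (Set.Ioi 0)) {κ q c : ℂ}
    (hQ : Filter.Tendsto Q Filter.atTop (nhds q)) (hC : Filter.Tendsto C Filter.atTop (nhds c))
    (hdiff : ∀ v₁ v₂ : ℝ, 0 < v₁ → 0 < v₂ → E v₂ - E v₁ =
      2 * (Q v₁ - Q v₂) + κ * ∫ v in v₁..v₂, ((v : ℂ) ^ 2)⁻¹ * C v)
    (havg : ∀ v₁ v₂ : ℝ, 0 < v₁ → 0 < v₂ → C v₁ - C v₂ = Complex.I * ∫ v in v₁..v₂, E v) :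
    Filter.Tendsto E Filter.atTop (nhds 0) := by
  rw [Metric.tendsto_atTop]
  intro δ hδ
  -- The tolerances give 2|Q(T) - Q(t)| ≤ δ/4 and K/T ≤ δ/8, so E moves by at most δ/2 on [T, T+1].
  -- Its mean there is at most δ/8, hence |E(T)| < δ. The cap by 1 bounds |C| by |c| + 1.
  obtain ⟨A₁, hA₁⟩ := Metric.tendsto_atTop.mp hQ (δ / 16) (by positivity)
  obtain ⟨A₂, hA₂⟩ := Metric.tendsto_atTop.mp hC (min (δ / 16) 1)
    (lt_min (by positivity) one_pos)
  set K : ℝ := ‖κ‖ * (‖c‖ + 1) with hK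
  have hK0 : 0 ≤ K := by positivity
  refine ⟨max (max A₁ A₂) (max 1 (8 * K / δ)), fun T hT => ?_⟩
  simp only [ge_iff_le, max_le_iff] at hT
  obtain ⟨⟨hT1, hT2⟩, hT3, hT4⟩ := hT
  have hT0 : 0 < T := one_pos.trans_le hT3
  have hKT : K / T ≤ δ / 8 := by
    rw [div_le_iff₀ hδ] at hT4
    rw [div_le_iff₀ hT0]
    linarith
  have hinc : ∀ t ∈ Set.Icc T (T + 1), ‖E t - E T‖ ≤ δ / 2 := by
    intro t ht
    have ht0 : 0 < t := hT0.trans_le ht.1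
    rw [hdiff T t hT0 ht0]
    have h1 : ‖Q T - Q t‖ ≤ δ / 8 := by
      rw [← dist_eq_norm]
      have := dist_triangle_right (Q T) (Q t) q
      linarith [hA₁ T hT1, hA₁ t (hT1.trans ht.1)]
    have h2 : ‖∫ v in T..t, ((v : ℂ) ^ 2)⁻¹ * C v‖ ≤ (T⁻¹ * (‖c‖ + 1)) * |t - T| := by
      refine intervalIntegral.norm_integral_le_of_norm_le_const fun v hv => ?_
      rw [Set.uIoc_of_le ht.1] at hv
      have hv0 : 0 < v := hT0.trans hv.1
      rw [norm_mul, norm_inv, norm_pow, Complex.norm_real, Real.norm_of_nonneg hv0.le]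
      refine mul_le_mul ?_ ?_ (norm_nonneg _) (by positivity)
      · refine inv_anti₀ hT0 ?_
        nlinarith [hv.1]
      · have h3 := (hA₂ v (hT2.trans hv.1.le)).le.trans (min_le_right _ _)
        rw [dist_eq_norm] at h3
        calc ‖C v‖ = ‖(C v - c) + c‖ := by rw [sub_add_cancel]
          _ ≤ ‖C v - c‖ + ‖c‖ := norm_add_le _ _
          _ ≤ ‖c‖ + 1 := by linarith
    have h3 : |t - T| ≤ 1 := by
      rw [abs_of_nonneg (by linarith [ht.1])]; linarith [ht.2]
    have h4 : ‖κ * ∫ v in T..t, ((v : ℂ) ^ 2)⁻¹ * C v‖ ≤ K / T := by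
      rw [norm_mul]
      calc ‖κ‖ * ‖∫ v in T..t, ((v : ℂ) ^ 2)⁻¹ * C v‖ ≤ ‖κ‖ * ((T⁻¹ * (‖c‖ + 1)) * 1) := by
            refine mul_le_mul_of_nonneg_left (h2.trans ?_) (norm_nonneg _)
            exact mul_le_mul_of_nonneg_left h3 (by positivity)
        _ = K / T := by rw [hK]; field_simp
    have h5 := norm_add_le (2 * (Q T - Q t)) (κ * ∫ v in T..t, ((v : ℂ) ^ 2)⁻¹ * C v)
    have h6 : ‖2 * (Q T - Q t)‖ = 2 * ‖Q T - Q t‖ := by rw [norm_mul]; simp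
    linarith
  have hle : T ≤ T + 1 := by linarith
  have hEi : IntervalIntegrable E volume T (T + 1) := by
    refine ContinuousOn.intervalIntegrable (hE.mono ?_)
    rw [Set.uIcc_of_le hle]
    exact fun t ht => hT0.trans_le ht.1
  have h1 : ‖∫ t in T..(T + 1), (E t - E T)‖ ≤ δ / 2 * |T + 1 - T| := by
    refine intervalIntegral.norm_integral_le_of_norm_le_const fun t ht => ?_
    rw [Set.uIoc_of_le hle] at ht
    exact hinc t ⟨ht.1.le, ht.2⟩
  rw [intervalIntegral.integral_sub hEi intervalIntegrable_const,
    intervalIntegral.integral_const, add_sub_cancel_left, abs_one, mul_one, one_smul] at h1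
  have h2 : ‖∫ t in T..(T + 1), E t‖ ≤ δ / 8 := by
    have h3 := congrArg norm (havg T (T + 1) hT0 (by linarith))
    rw [norm_mul, Complex.norm_I, one_mul] at h3
    rw [← h3, ← dist_eq_norm]
    have := dist_triangle_right (C T) (C (T + 1)) c
    have h4 := (hA₂ T hT2).le.trans (min_le_left _ _)
    have h5 := (hA₂ (T + 1) (hT2.trans hle)).le.trans (min_le_left _ _)
    linarith
  rw [dist_zero_right]
  have h3 : E T = (∫ t in T..(T + 1), E t) - ((∫ t in T..(T + 1), E t) - E T) := by ring
  rw [h3]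
  refine (norm_sub_le _ _).trans_lt ?_
  linarith

/-- Periodicity of the Wirtinger derivative. -/
lemma wirtingerBar_add_one {F : ℂ → ℂ} (hF : ∀ z : ℂ, 0 < z.im → F (z + 1) = F z) {z : ℂ}
    (hz : 0 < z.im) : wirtingerBar F (z + 1) = wirtingerBar F z := by
  have h1 : (fun w => F (w + 1)) =ᶠ[nhds z] F := by
    filter_upwards [isOpen_im_pos.mem_nhds hz] with w hw using hF w hw
  rw [← wirtingerBar_congr h1, wirtingerBar, wirtingerBar, fderiv_comp_add_right]

lemma im_neg_inv (z : ℂ) : (-z⁻¹).im = z.im / Complex.normSq z := by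
  rw [Complex.neg_im, Complex.inv_im]; ring

lemma im_neg_inv_pos {z : ℂ} (hz : 0 < z.im) : 0 < (-z⁻¹).im := by
  rw [im_neg_inv]
  have : z ≠ 0 := fun h => by simp [h] at hz
  exact div_pos hz (Complex.normSq_pos.mpr this)

lemma hasDerivAt_neg_inv {z : ℂ} (hz : z ≠ 0) : HasDerivAt (fun w : ℂ => -w⁻¹) ((z ^ 2)⁻¹) z := by
  have h := (hasDerivAt_inv hz).neg
  rw [neg_neg] at h
  exact h

/-- The Wirtinger derivative of an invariant function is a form of type `(0, 1)`. -/
lemma wirtingerBar_neg_inv {F : ℂ → ℂ} (hd : ∀ z : ℂ, 0 < z.im → DifferentiableAt ℝ F z)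
    (hF : ∀ z : ℂ, 0 < z.im → F (-z⁻¹) = F z) {z : ℂ} (hz : 0 < z.im) :
    wirtingerBar F (-z⁻¹) = (starRingEnd ℂ z) ^ 2 * wirtingerBar F z := by
  have hz0 : z ≠ 0 := fun h => by simp [h] at hz
  have h1 : (fun w => F (-w⁻¹)) =ᶠ[nhds z] F := by
    filter_upwards [isOpen_im_pos.mem_nhds hz] with w hw using hF w hw
  have hd1 := ((hd _ (im_neg_inv_pos hz)).hasFDerivAt.comp z
    ((hasDerivAt_neg_inv hz0).hasFDerivAt.restrictScalars ℝ)).fderiv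
  have h2 : wirtingerBar F z = wirtingerBar (fun w => F (-w⁻¹)) z := (wirtingerBar_congr h1).symm
  set A := fderiv ℝ F (-z⁻¹) with hA
  have hlin : ∀ w : ℂ, A w = w.re * A 1 + w.im * A Complex.I := by
    intro w
    conv_lhs => rw [show w = w.re • (1 : ℂ) + w.im • Complex.I by
      simp [Complex.re_add_im]]
    rw [map_add, map_smul, map_smul]
    simp
  -- The map -w⁻¹ is holomorphic with derivative z⁻², so D̄ of the composite picks up the conjugate
  -- of z⁻² alone.
  have hcomp : ∀ w : ℂ, fderiv ℝ (fun w => F (-w⁻¹)) z w = A (w * (z ^ 2)⁻¹) := by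
    intro w
    have : fderiv ℝ (fun w => F (-w⁻¹)) z = _ := hd1
    rw [this]
    simp [hA]
  rw [h2, wirtingerBar, wirtingerBar, hcomp, hcomp, hlin (1 * _), hlin (Complex.I * _), ← hA]
  set w := (z ^ 2)⁻¹ with hw
  have hconj : (starRingEnd ℂ z) ^ 2 * (w.re - w.im * Complex.I) = 1 := by
    have h3 : starRingEnd ℂ w = w.re - w.im * Complex.I := by
      apply Complex.ext <;> simp
    rw [← h3, hw, ← map_pow, ← map_mul, mul_inv_cancel₀ (pow_ne_zero 2 hz0), map_one]
  simp only [one_mul, Complex.mul_re, Complex.mul_im, Complex.I_re, Complex.I_im, zero_mul, one_mul,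
    zero_sub, zero_add, add_zero]
  push_cast
  linear_combination (-(A 1 + Complex.I * A Complex.I)) * hconj +
    (-(starRingEnd ℂ z) ^ 2 * w.im * A Complex.I) * Complex.I_sq

/-- Stokes' theorem on a rectangle, for the other Wirtinger operator. -/
lemma integral_sub_integral_of_periodic_wirtinger {Ψ : ℂ → ℂ}
    (hΨ : ContDiffOn ℝ 1 Ψ {z : ℂ | 0 < z.im}) {a b : ℝ}
    (hper : ∀ v : ℝ, 0 < v → Ψ (b + v * Complex.I) = Ψ (a + v * Complex.I))
    {v₁ v₂ : ℝ} (h₁ : 0 < v₁) (h₂ : 0 < v₂) :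
    (∫ u in a..b, Ψ (u + v₁ * Complex.I)) - ∫ u in a..b, Ψ (u + v₂ * Complex.I) =
      -Complex.I * ∫ v in v₁..v₂, ∫ u in a..b, wirtinger Ψ (u + v * Complex.I) := by
  have h := integral_sub_integral_of_periodic (Φ := fun z => (starRingEnd ℂ) (Ψ z))
    (Complex.conjCLE.contDiff.comp_contDiffOn hΨ) (a := a) (b := b)
    (fun v hv => by rw [hper v hv]) h₁ h₂
  rw [intervalIntegral_conj, intervalIntegral_conj] at h
  have h2 : ∫ v in v₁..v₂, ∫ u in a..b,
      wirtingerBar (fun z => (starRingEnd ℂ) (Ψ z)) (u + v * Complex.I) =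
      (starRingEnd ℂ) (∫ v in v₁..v₂, ∫ u in a..b, wirtinger Ψ (u + v * Complex.I)) := by
    rw [← intervalIntegral_conj]
    refine intervalIntegral.integral_congr fun v hv => ?_
    rw [← intervalIntegral_conj]
    refine intervalIntegral.integral_congr fun u _ => ?_
    refine wirtingerBar_conj (hΨ.differentiableAt_im_pos one_ne_zero ?_)
    rw [im_ofReal_add_mul_I]
    exact (lt_min h₁ h₂).trans_le hv.1
  rw [h2] at h
  have h3 := congrArg (starRingEnd ℂ) h
  rw [map_sub, map_mul, Complex.conj_conj, Complex.conj_conj, Complex.conj_conj,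
    Complex.conj_I] at h3
  exact h3

/-! ### Regularized integrals of invariant functions -/

section Stokes

variable {F H : ℂ → ℂ}

/-- The modular completion of the derivative of a form. -/
def completedDerivative (κ : ℂ) (F H : ℂ → ℂ) (z : ℂ) : ℂ :=
  H z + κ / (2 * Complex.I) * (imZpow (-1) z * F z)

/-- D̄(v⁻¹) = -iv⁻² is the point: the non-holomorphic correction produces the invariant density
v⁻²F. -/
lemma wirtingerBar_completedDerivative (κ : ℂ) {z : ℂ} (hz : 0 < z.im)
    (hF : DifferentiableAt ℝ F z) (hH : DifferentiableAt ℝ H z) :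
    wirtingerBar (completedDerivative κ F H) z = wirtingerBar H z +
      κ / (2 * Complex.I) * (-Complex.I * ((z.im : ℂ) ^ 2)⁻¹ * F z +
        (z.im : ℂ)⁻¹ * wirtingerBar F z) := by
  have hv := differentiableAt_imZpow (-1) hz
  have hp : DifferentiableAt ℝ (fun z => imZpow (-1) z * F z) z := hv.mul hF
  have h2 := wirtingerBar_mul hv hF
  have e1 : imZpow (-1) z = (z.im : ℂ)⁻¹ := by simp [imZpow]
  have e2 : imZpow (-1 - 1) z = ((z.im : ℂ) ^ 2)⁻¹ := by
    rw [imZpow]; norm_num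
  rw [wirtingerBar_imZpow _ hz, e1, e2] at h2
  have h3 : wirtingerBar (completedDerivative κ F H) z = wirtingerBar H z +
      κ / (2 * Complex.I) * wirtingerBar (fun z => imZpow (-1) z * F z) z := by
    change fderiv ℝ (fun z => H z + κ / (2 * Complex.I) * (imZpow (-1) z * F z)) z 1 +
      Complex.I * fderiv ℝ (fun z => H z + κ / (2 * Complex.I) * (imZpow (-1) z * F z)) z Complex.I
      = _
    rw [fderiv_fun_add hH (hp.const_mul _), fderiv_const_mul hp]
    simp only [wirtingerBar, ContinuousLinearMap.add_apply, ContinuousLinearMap.smul_apply,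
      smul_eq_mul]
    ring
  rw [h3, h2]
  push_cast
  ring

lemma contDiffOn_completedDerivative (κ : ℂ) (hF : ContDiffOn ℝ 1 F {z : ℂ | 0 < z.im})
    (hH : ContDiffOn ℝ 1 H {z : ℂ | 0 < z.im}) :
    ContDiffOn ℝ 1 (completedDerivative κ F H) {z : ℂ | 0 < z.im} :=
  hH.add (contDiffOn_const.mul ((contDiffOn_imZpow (-1)).mul hF))

lemma completedDerivative_add_one {κ : ℂ} (hFT : ∀ z : ℂ, 0 < z.im → F (z + 1) = F z)
    (hHT : ∀ z : ℂ, 0 < z.im → H (z + 1) = H z) {z : ℂ} (hz : 0 < z.im) :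
    completedDerivative κ F H (z + 1) = completedDerivative κ F H z := by
  rw [completedDerivative, completedDerivative, hFT z hz, hHT z hz]
  simp [imZpow]

/-- Im(-z⁻¹)⁻¹ = z(z - 2iv)/v. The term -2iv, multiplied by κ/(2iv), gives -κzF and cancels the
anomaly of H. -/
lemma completedDerivative_neg_inv {κ : ℂ} (hFS : ∀ z : ℂ, 0 < z.im → F (-z⁻¹) = F z)
    (hHS : ∀ z : ℂ, 0 < z.im → H (-z⁻¹) = z ^ 2 * H z + κ * z * F z) {z : ℂ} (hz : 0 < z.im) :
    completedDerivative κ F H (-z⁻¹) = z ^ 2 * completedDerivative κ F H z := by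
  have hne : (z.im : ℂ) ≠ 0 := by exact_mod_cast hz.ne'
  rw [completedDerivative, completedDerivative, hFS z hz, hHS z hz]
  simp only [imZpow, im_neg_inv]
  have h1 : ((Complex.normSq z : ℝ) : ℂ) = z * (z - 2 * Complex.I * z.im) := by
    rw [Complex.normSq_eq_conj_mul_self, mul_comm]
    congr 1
    apply Complex.ext <;> simp; ring
  have h2 : (((z.im / Complex.normSq z) ^ (-1 : ℤ) : ℝ) : ℂ) =
      (z.im : ℂ)⁻¹ * (z * (z - 2 * Complex.I * z.im)) := by
    rw [← h1]
    push_cast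
    rw [zpow_neg_one, inv_div, div_eq_inv_mul]
  have h3 : ((z.im ^ (-1 : ℤ) : ℝ) : ℂ) = (z.im : ℂ)⁻¹ := by simp
  rw [h2, h3]
  have := Complex.I_ne_zero
  field_simp
  ring

/-- The correction is v⁻¹ times a convergent integral, so it does not affect the limit. -/
lemma tendsto_integral_completedDerivative {κ : ℂ} (hF : ContinuousOn F {z : ℂ | 0 < z.im})
    (hH : ContinuousOn H {z : ℂ | 0 < z.im}) {a b : ℝ} {c d : ℂ}
    (hc : Filter.Tendsto (fun v : ℝ => ∫ u in a..b, F (u + v * Complex.I)) Filter.atTop (nhds c))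
    (hd : Filter.Tendsto (fun v : ℝ => ∫ u in a..b, H (u + v * Complex.I)) Filter.atTop (nhds d)) :
    Filter.Tendsto (fun v : ℝ => ∫ u in a..b, completedDerivative κ F H (u + v * Complex.I))
      Filter.atTop (nhds d) := by
  have h1 : Filter.Tendsto (fun v : ℝ => (((v⁻¹ : ℝ) : ℂ))) Filter.atTop (nhds 0) :=
    (Complex.continuous_ofReal.tendsto' 0 0 Complex.ofReal_zero).comp tendsto_inv_atTop_zero
  have h2 := hd.add ((h1.const_mul (κ / (2 * Complex.I))).mul hc)
  rw [mul_zero, zero_mul, add_zero] at h2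
  refine h2.congr' ?_
  filter_upwards [Filter.eventually_gt_atTop 0] with v hv
  have hH' := continuous_horizontal hH hv
  have hF' := continuous_horizontal hF hv
  rw [← intervalIntegral.integral_const_mul,
    ← intervalIntegral.integral_add (hH'.intervalIntegrable _ _)
      ((hF'.intervalIntegrable _ _).const_mul _)]
  refine intervalIntegral.integral_congr fun u _ => ?_
  simp only [completedDerivative, imZpow, im_ofReal_add_mul_I, zpow_neg_one]
  ring

variable {k : ℕ}

/-- The exactness of k F dμ. In 2 D̄q the contributions of D̄H and v⁻¹D̄F cancel those in the
equation for D D̄F, and -k v⁻²F is left over. -/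
lemma wirtinger_wirtingerBar_sub (hF : ContDiffOn ℝ ∞ F {z : ℂ | 0 < z.im})
    (hH : ContDiffOn ℝ 1 H {z : ℂ | 0 < z.im})
    (hΔ : ∀ z : ℂ, 0 < z.im → z.im * wirtinger (wirtingerBar F) z =
      -Complex.I * k * wirtingerBar F z + 2 * z.im * wirtingerBar H z) {z : ℂ} (hz : 0 < z.im) :
    k * (((z.im : ℂ) ^ 2)⁻¹ * F z) =
      wirtinger (wirtingerBar F) z - 2 * wirtingerBar (completedDerivative k F H) z := by
  have hne : (z.im : ℂ) ≠ 0 := by exact_mod_cast hz.ne'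
  rw [wirtingerBar_completedDerivative k hz (hF.differentiableAt_im_pos (by simp) hz)
    (hH.differentiableAt_im_pos one_ne_zero hz)]
  have h3 := hΔ z hz
  have h4 : wirtinger (wirtingerBar F) z = -Complex.I * k * wirtingerBar F z / z.im +
      2 * wirtingerBar H z := by
    field_simp
    linear_combination h3
  rw [h4]
  field_simp
  linear_combination ((k : ℂ) * z.im * wirtingerBar F z) * Complex.I_sq

/-- The regularized integral of an invariant function as the limit of a boundary integral. -/
theorem tendsto_setIntegral_truncatedDomain (hk : 0 < k)
    (hF : ContDiffOn ℝ ∞ F {z : ℂ | 0 < z.im}) (hH : ContDiffOn ℝ 1 H {z : ℂ | 0 < z.im})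
    (hFT : ∀ z : ℂ, 0 < z.im → F (z + 1) = F z) (hFS : ∀ z : ℂ, 0 < z.im → F (-z⁻¹) = F z)
    (hHT : ∀ z : ℂ, 0 < z.im → H (z + 1) = H z)
    (hHS : ∀ z : ℂ, 0 < z.im → H (-z⁻¹) = z ^ 2 * H z + k * z * F z)
    (hΔ : ∀ z : ℂ, 0 < z.im → z.im * wirtinger (wirtingerBar F) z =
      -Complex.I * k * wirtingerBar F z + 2 * z.im * wirtingerBar H z) {c d : ℂ}
    (hc : Filter.Tendsto (fun v : ℝ => ∫ u in (-(1 / 2) : ℝ)..(1 / 2), F (u + v * Complex.I))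
      Filter.atTop (nhds c))
    (hd : Filter.Tendsto (fun v : ℝ => ∫ u in (-(1 / 2) : ℝ)..(1 / 2), H (u + v * Complex.I))
      Filter.atTop (nhds d)) :
    Filter.Tendsto (fun T : ℝ => ∫ τ in truncatedDomain T, F τ) Filter.atTop
      (nhds (-2 * Complex.I / k * d)) := by
  have hkc : (k : ℂ) ≠ 0 := by exact_mod_cast hk.ne'
  set q := completedDerivative k F H with hq
  have hqC : ContDiffOn ℝ 1 q {z : ℂ | 0 < z.im} :=
    contDiffOn_completedDerivative _ (hF.of_le (by exact_mod_cast le_top)) hH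
  have hDF : ContDiffOn ℝ 1 (wirtingerBar F) {z : ℂ | 0 < z.im} :=
    hF.wirtingerBar (by rw [one_add_one_eq_two]; exact two_le_infty)
  have hqT : ∀ z : ℂ, 0 < z.im → q (z + 1) = q z := fun z hz =>
    completedDerivative_add_one hFT hHT hz
  have hDFT : ∀ z : ℂ, 0 < z.im → wirtingerBar F (z + 1) = wirtingerBar F z := fun z hz =>
    wirtingerBar_add_one hFT hz
  have hper : ∀ {Φ : ℂ → ℂ}, (∀ z : ℂ, 0 < z.im → Φ (z + 1) = Φ z) → ∀ v : ℝ, 0 < v →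
      Φ (((1 / 2 : ℝ) : ℂ) + v * Complex.I) = Φ (((-(1 / 2) : ℝ) : ℂ) + v * Complex.I) := by
    intro Φ hΦ v hv
    rw [← hΦ (((-(1 / 2) : ℝ) : ℂ) + v * Complex.I) (by rw [im_ofReal_add_mul_I]; exact hv)]
    congr 1
    push_cast
    ring
  set C : ℝ → ℂ := fun v => ∫ u in (-(1 / 2) : ℝ)..(1 / 2), F (u + v * Complex.I) with hCdef
  set E : ℝ → ℂ := fun v => ∫ u in (-(1 / 2) : ℝ)..(1 / 2), wirtingerBar F (u + v * Complex.I)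
    with hEdef
  set Q : ℝ → ℂ := fun v => ∫ u in (-(1 / 2) : ℝ)..(1 / 2), q (u + v * Complex.I) with hQdef
  have hQ : Filter.Tendsto Q Filter.atTop (nhds d) :=
    tendsto_integral_completedDerivative hF.continuousOn hH.continuousOn hc hd
  -- Integrating the exactness identity over a rectangle controls the increments of E: those of Q
  -- become small and v⁻²C is integrable at infinity.
  have hstrip : ∀ v₁ v₂ : ℝ, 0 < v₁ → 0 < v₂ → E v₂ - E v₁ =
      2 * (Q v₁ - Q v₂) + (Complex.I * k) * ∫ v in v₁..v₂, ((v : ℂ) ^ 2)⁻¹ * C v := by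
    intro v₁ v₂ h₁ h₂
    have hpos : ∀ v ∈ Set.uIcc v₁ v₂, 0 < v := fun v hv => (lt_min h₁ h₂).trans_le hv.1
    have e1 := integral_sub_integral_of_periodic_wirtinger hDF (hper hDFT) h₁ h₂
    have e2 := integral_sub_integral_of_periodic hqC (hper hqT) h₁ h₂
    have hW1 : ContinuousOn (wirtinger (wirtingerBar F)) {z : ℂ | 0 < z.im} :=
      (hDF.continuousOn_fderiv_im_pos 1).sub
        (continuousOn_const.mul (hDF.continuousOn_fderiv_im_pos Complex.I))
    have hW2 := hqC.continuousOn_wirtingerBar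
    have e3 : (k : ℂ) * ∫ v in v₁..v₂, ((v : ℂ) ^ 2)⁻¹ * C v =
        (∫ v in v₁..v₂, ∫ u in (-(1 / 2) : ℝ)..(1 / 2),
          wirtinger (wirtingerBar F) (u + v * Complex.I)) - 2 *
        ∫ v in v₁..v₂, ∫ u in (-(1 / 2) : ℝ)..(1 / 2), wirtingerBar q (u + v * Complex.I) := by
      rw [← intervalIntegral.integral_const_mul, ← intervalIntegral.integral_const_mul,
        ← intervalIntegral.integral_sub
          ((continuous_integral_horizontal hW1 _ _).mono hpos).intervalIntegrable
          (((continuous_integral_horizontal hW2 _ _).mono hpos).intervalIntegrable.const_mul _)]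
      refine intervalIntegral.integral_congr fun v hv => ?_
      have hv0 := hpos v hv
      rw [hCdef, ← intervalIntegral.integral_const_mul, ← intervalIntegral.integral_const_mul,
        ← intervalIntegral.integral_const_mul, ← intervalIntegral.integral_sub
          ((continuous_horizontal hW1 hv0).intervalIntegrable _ _)
          (((continuous_horizontal hW2 hv0).intervalIntegrable _ _).const_mul _)]
      refine intervalIntegral.integral_congr fun u _ => ?_
      have := wirtinger_wirtingerBar_sub hF hH hΔ (z := u + v * Complex.I)
        (by rw [im_ofReal_add_mul_I]; exact hv0)
      rw [im_ofReal_add_mul_I] at this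
      exact this
    simp only [hEdef, hQdef]
    linear_combination -e1 - 2 * e2 - Complex.I * e3
  have hE : Filter.Tendsto E Filter.atTop (nhds 0) :=
    tendsto_zero_of_average (continuous_integral_horizontal hDF.continuousOn _ _) hQ hc hstrip
      fun v₁ v₂ h₁ h₂ => integral_sub_integral_of_periodic (hF.of_le (by exact_mod_cast le_top))
        (hper hFT) h₁ h₂
  -- The same identity on the truncated domain. D̄F dz̄ and q dz are both invariant, so each
  -- contributes only its integral over the upper edge.
  have hdom : ∀ T : ℝ, 1 < T → ∫ τ in truncatedDomain T, F τ =
      (k : ℂ)⁻¹ * (-Complex.I * E T - 2 * (Complex.I * Q T)) := by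
    intro T hT
    have hW1 : ContinuousOn (wirtinger (wirtingerBar F)) {z : ℂ | 0 < z.im} :=
      (hDF.continuousOn_fderiv_im_pos 1).sub
        (continuousOn_const.mul (hDF.continuousOn_fderiv_im_pos Complex.I))
    have hW2 := hqC.continuousOn_wirtingerBar
    have e1 := integral_wirtinger_fundamentalDomain hDF hDFT
      (fun z hz =>
        wirtingerBar_neg_inv (fun z hz => hF.differentiableAt_im_pos (by simp) hz) hFS hz) hT
    have e2 := integral_wirtingerBar_fundamentalDomain hqC hqT
      (fun z hz => completedDerivative_neg_inv hFS hHS hz) hT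
    rw [← setIntegral_im_sq_mul hW1 hT.le] at e1
    rw [← setIntegral_im_sq_mul hW2 hT.le] at e2
    rw [eq_inv_mul_iff_mul_eq₀ hkc, ← e1, ← e2, ← integral_const_mul, ← integral_const_mul,
      ← integral_sub]
    · refine integral_congr_ae (Filter.Eventually.of_forall fun τ => ?_)
      have hne : (((τ : ℂ).im : ℝ) : ℂ) ≠ 0 := by exact_mod_cast τ.im_pos.ne'
      have h := wirtinger_wirtingerBar_sub hF hH hΔ (z := τ) τ.im_pos
      beta_reduce
      have h2 : (k : ℂ) * F τ = (((τ : ℂ).im : ℝ) : ℂ) ^ 2 *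
          (k * (((((τ : ℂ).im : ℝ) : ℂ) ^ 2)⁻¹ * F τ)) := by field_simp
      rw [h2, h]
      ring
    · exact integrableOn_truncatedDomain (F := fun z => ((z.im : ℝ) : ℂ) ^ 2 *
        wirtinger (wirtingerBar F) z) (by fun_prop) T
    · exact (integrableOn_truncatedDomain (F := fun z => ((z.im : ℝ) : ℂ) ^ 2 *
        wirtingerBar q z) (by fun_prop) T).const_mul 2
  have hlim := ((hE.const_mul (-Complex.I)).sub ((hQ.const_mul Complex.I).const_mul 2)).const_mul
    (k : ℂ)⁻¹
  have e : (k : ℂ)⁻¹ * (-Complex.I * 0 - 2 * (Complex.I * d)) = -2 * Complex.I / k * d := by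
    field_simp; ring
  rw [e] at hlim
  refine hlim.congr' ?_
  filter_upwards [Filter.eventually_gt_atTop 1] with T hT using (hdom T hT).symm

end Stokes

/-! ### The pairing of vector valued forms -/

section Laws

variable {W : Type*} [AddCommGroup W] [Module ℂ W] {k : ℤ}

lemma IsModular.vadd_one {σ : Subgroup (SL(2, ℤ) × (W ≃ₗ[ℂ] W))} {f : ℍ → W}
    (hf : IsModular σ k f) {B : W ≃ₗ[ℂ] W} (hB : (ModularGroup.T, B) ∈ σ) (τ : ℍ) :
    f ((1 : ℝ) +ᵥ τ) = B (f τ) := by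
  have h := hf _ _ hB τ
  rw [modular_T_smul] at h
  simpa [ModularGroup.T] using h

lemma IsModular.smul_S {σ : Subgroup (SL(2, ℤ) × (W ≃ₗ[ℂ] W))} {f : ℍ → W}
    (hf : IsModular σ k f) {A : W ≃ₗ[ℂ] W} (hA : (ModularGroup.S, A) ∈ σ) (τ : ℍ) :
    f (ModularGroup.S • τ) = (τ : ℂ) ^ k • A (f τ) := by
  have h := hf _ _ hA τ
  simpa [ModularGroup.S] using h

lemma mem_dualRep {σ : Subgroup (SL(2, ℤ) × (W ≃ₗ[ℂ] W))} {γ : SL(2, ℤ)} {A : W ≃ₗ[ℂ] W}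
    (h : (γ, A) ∈ σ) : (γ, contragredient A) ∈ dualRep σ :=
  Subgroup.mem_map.mpr ⟨(γ, A), h, rfl⟩

lemma ofComplex_neg_inv {z : ℂ} (hz : 0 < z.im) :
    ofComplex (-z⁻¹) = ModularGroup.S • ofComplex z := by
  rw [modular_S_smul, ofComplex_apply_of_im_pos (im_neg_inv_pos hz)]
  ext1
  simp [coe_ofComplex_of_im_pos hz, inv_neg]

lemma ofComplex_add_one {z : ℂ} (hz : 0 < z.im) : ofComplex (z + 1) = (1 : ℝ) +ᵥ ofComplex z := by
  have := ofComplex_add_real hz 1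
  rwa [Complex.ofReal_one] at this

variable {σ : Subgroup (SL(2, ℤ) × (W ≃ₗ[ℂ] W))} {f : ℍ → W} {g : ℍ → Module.Dual ℂ W}

lemma pairing_vadd_one (hf : IsModular σ (-k) f) (hg : IsModular (dualRep σ) k g)
    {B : W ≃ₗ[ℂ] W} (hB : (ModularGroup.T, B) ∈ σ) (τ : ℍ) :
    g ((1 : ℝ) +ᵥ τ) (f ((1 : ℝ) +ᵥ τ)) = g τ (f τ) := by
  rw [hf.vadd_one hB, hg.vadd_one (mem_dualRep hB), contragredient_apply,
    LinearEquiv.symm_apply_apply]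

/-- The automorphy factors of weights -k and k cancel, and the contragredient undoes the
representation. -/
lemma pairing_smul_S (hf : IsModular σ (-k) f) (hg : IsModular (dualRep σ) k g)
    {A : W ≃ₗ[ℂ] W} (hA : (ModularGroup.S, A) ∈ σ) (τ : ℍ) :
    g (ModularGroup.S • τ) (f (ModularGroup.S • τ)) = g τ (f τ) := by
  rw [hf.smul_S hA, hg.smul_S (mem_dualRep hA), map_smul, LinearMap.smul_apply,
    contragredient_apply, LinearEquiv.symm_apply_apply, smul_smul, zpow_neg,
    inv_mul_cancel₀ (zpow_ne_zero _ τ.ne_zero), one_smul]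

end Laws

/-! ### The derivative of a holomorphic form -/

section Derivative

variable {ι : Type*} [Fintype ι] [DecidableEq ι]

/-- The derivative of a form with values in the dual of a coordinate space. -/
def derivForm (g : ℍ → Module.Dual ℂ (ι → ℂ)) (z : ℂ) : Module.Dual ℂ (ι → ℂ) :=
  ∑ i, deriv (fun z => g (ofComplex z) (Pi.single i 1)) z •
    (LinearMap.proj i : Module.Dual ℂ (ι → ℂ))

variable {g : ℍ → Module.Dual ℂ (ι → ℂ)}

lemma hasDerivAt_derivForm
    (hg : ∀ w : ι → ℂ, DifferentiableOn ℂ (fun z => g (ofComplex z) w) {z : ℂ | 0 < z.im})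
    {z : ℂ} (hz : 0 < z.im) (w : ι → ℂ) :
    HasDerivAt (fun z => g (ofComplex z) w) (derivForm g z w) z := by
  have h1 : (fun z => g (ofComplex z) w) =
      fun z => ∑ i, w i * g (ofComplex z) (Pi.single i 1) := funext fun z => dual_apply_eq_sum _ _
  have h2 : derivForm g z w = ∑ i, w i * deriv (fun z => g (ofComplex z) (Pi.single i 1)) z := by
    simp [derivForm, mul_comm]
  rw [h1, h2]
  refine HasDerivAt.fun_sum fun i _ => ?_
  exact (((hg (Pi.single i 1)).differentiableAt (isOpen_im_pos.mem_nhds hz)).hasDerivAt).const_mul _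

lemma differentiableOn_derivForm
    (hg : ∀ w : ι → ℂ, DifferentiableOn ℂ (fun z => g (ofComplex z) w) {z : ℂ | 0 < z.im})
    (w : ι → ℂ) : DifferentiableOn ℂ (fun z => derivForm g z w) {z : ℂ | 0 < z.im} :=
  ((hg w).deriv isOpen_im_pos).congr fun _ hz => ((hasDerivAt_derivForm hg hz w).deriv).symm

/-- The `q`-expansion of the derivative. -/
lemma HasQExpansion.derivForm {b : ℚ → Module.Dual ℂ (ι → ℂ)} (hb : HasQExpansion g b) :
    HasQExpansion (fun τ : ℍ => (2 * Real.pi * Complex.I : ℂ)⁻¹ • derivForm g τ) (thetaOp b) := by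
  obtain ⟨N, hN, hbN⟩ := hb.denom
  have hpi : (2 * Real.pi * Complex.I : ℂ) ≠ 0 := Complex.two_pi_I_ne_zero
  refine ⟨⟨N, hN, fun m hm => hbN m fun h => hm (by rw [thetaOp, h, smul_zero])⟩,
    fun m hm => by rw [thetaOp, hb.nonneg m hm, smul_zero], fun ℓ τ => ?_⟩
  have hd : ∀ i, HasSum (fun m : ℚ => qExp m τ * (2 * Real.pi * Complex.I * (m : ℂ) *
      b m (Pi.single i 1))) (deriv (fun z => g (ofComplex z) (Pi.single i 1)) τ) := by
    intro i
    have hs : ∀ τ : ℍ, HasSum (fun m : ℚ => qPow m τ * b m (Pi.single i 1))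
        (g τ (Pi.single i 1)) := fun τ => by
      have := hb.hasSum_component i τ.im_pos
      rwa [ofComplex_apply] at this
    have h1 := hasSum_deriv_tsum_qExp (fun τ => (hs τ).summable) τ.im_pos
    have h2 : (fun z => g (ofComplex z) (Pi.single i 1)) =ᶠ[nhds (τ : ℂ)]
        fun z => ∑' m : ℚ, qExp m z * b m (Pi.single i 1) := by
      filter_upwards [isOpen_im_pos.mem_nhds τ.im_pos] with z hz
      exact (hb.hasSum_component i hz).tsum_eq.symm
    rw [h2.deriv_eq]
    exact h1
  have h3 : ℓ ((2 * Real.pi * Complex.I : ℂ)⁻¹ • _root_.derivForm g τ) =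
      ∑ i, (2 * Real.pi * Complex.I : ℂ)⁻¹ *
        deriv (fun z => g (ofComplex z) (Pi.single i 1)) τ * ℓ (LinearMap.proj i) := by
    simp only [_root_.derivForm, map_smul, map_sum, smul_eq_mul, Finset.mul_sum, mul_assoc]
  rw [h3]
  have h4 := hasSum_sum (s := Finset.univ) fun i _ =>
    (((hd i).mul_left (2 * Real.pi * Complex.I : ℂ)⁻¹).mul_right (ℓ (LinearMap.proj i)))
  refine h4.congr_fun fun m => ?_
  rw [thetaOp, map_smul, qPow_eq_qExp, smul_eq_mul]
  conv_lhs => rw [dual_eq_sum_proj (b m)]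
  simp only [map_sum, map_smul, smul_eq_mul, Finset.mul_sum]
  refine Finset.sum_congr rfl fun i _ => ?_
  field_simp

variable {σ : Subgroup (SL(2, ℤ) × ((ι → ℂ) ≃ₗ[ℂ] (ι → ℂ)))} {k : ℤ}

lemma derivForm_add_one
    (hg : ∀ w : ι → ℂ, DifferentiableOn ℂ (fun z => g (ofComplex z) w) {z : ℂ | 0 < z.im})
    (hmod : IsModular (dualRep σ) k g) {B : (ι → ℂ) ≃ₗ[ℂ] (ι → ℂ)}
    (hB : (ModularGroup.T, B) ∈ σ) {z : ℂ} (hz : 0 < z.im) (w : ι → ℂ) :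
    derivForm g (z + 1) w = derivForm g z (B.symm w) := by
  have hz1 : 0 < (z + 1).im := by simpa using hz
  have h1 := (hasDerivAt_derivForm hg hz1 w).comp_add_const z 1
  have h2 : (fun z => g (ofComplex (z + 1)) w) =ᶠ[nhds z]
      fun z => g (ofComplex z) (B.symm w) := by
    filter_upwards [isOpen_im_pos.mem_nhds hz] with z hz
    rw [ofComplex_add_one hz, hmod.vadd_one (mem_dualRep hB), contragredient_apply]
  exact (h1.congr_of_eventuallyEq h2.symm).unique (hasDerivAt_derivForm hg hz _)

/-- Differentiate the law of g under S. The outer z² comes from d(-z⁻¹) = z⁻² dz, and the derivative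
of z^k produces the term that the completion later removes. -/
lemma derivForm_neg_inv
    (hg : ∀ w : ι → ℂ, DifferentiableOn ℂ (fun z => g (ofComplex z) w) {z : ℂ | 0 < z.im})
    (hmod : IsModular (dualRep σ) k g) {A : (ι → ℂ) ≃ₗ[ℂ] (ι → ℂ)}
    (hA : (ModularGroup.S, A) ∈ σ) {z : ℂ} (hz : 0 < z.im) (w : ι → ℂ) :
    derivForm g (-z⁻¹) w = z ^ 2 * (k * z ^ (k - 1) * g (ofComplex z) (A.symm w) +
      z ^ k * derivForm g z (A.symm w)) := by
  have hz0 : z ≠ 0 := fun h => by simp [h] at hz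
  have h1 := (hasDerivAt_derivForm hg (im_neg_inv_pos hz) w).comp z (hasDerivAt_neg_inv hz0)
  have h2 : (fun z => g (ofComplex z) w) ∘ (fun z => -z⁻¹) =ᶠ[nhds z]
      fun z => z ^ k * g (ofComplex z) (A.symm w) := by
    filter_upwards [isOpen_im_pos.mem_nhds hz] with z hz
    rw [Function.comp_apply, ofComplex_neg_inv hz, hmod.smul_S (mem_dualRep hA),
      coe_ofComplex_of_im_pos hz, LinearMap.smul_apply, contragredient_apply, smul_eq_mul]
  have h3 := (hasDerivAt_zpow k z (Or.inl hz0)).mul (hasDerivAt_derivForm hg hz (A.symm w))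
  have h4 := (h1.congr_of_eventuallyEq h2.symm).unique h3
  rw [← h4]
  field_simp

end Derivative

/-! ### The differential equation of the pairing -/

section Sums

variable {ι : Type*} [Fintype ι] {f g : ι → ℂ → ℂ} {z : ℂ}

lemma wirtingerBar_sum (hf : ∀ i, DifferentiableAt ℝ (f i) z) :
    wirtingerBar (fun z => ∑ i, f i z) z = ∑ i, wirtingerBar (f i) z := by
  simp only [wirtingerBar]
  rw [fderiv_fun_sum fun i _ => hf i]
  simp [Finset.sum_add_distrib, Finset.mul_sum]

lemma wirtinger_sum (hf : ∀ i, DifferentiableAt ℝ (f i) z) :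
    wirtinger (fun z => ∑ i, f i z) z = ∑ i, wirtinger (f i) z := by
  simp only [wirtinger]
  rw [fderiv_fun_sum fun i _ => hf i]
  simp [Finset.sum_sub_distrib, Finset.mul_sum]

lemma wirtinger_eq_two_mul_deriv {F : ℂ → ℂ} {a : ℂ} (h : HasDerivAt F a z) :
    wirtinger F z = 2 * a := by
  rw [wirtinger, (h.hasFDerivAt.restrictScalars ℝ).fderiv]
  simp
  linear_combination (-a) * Complex.I_sq

lemma wirtinger_congr {F G : ℂ → ℂ} (h : F =ᶠ[nhds z] G) : wirtinger F z = wirtinger G z := by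
  rw [wirtinger, wirtinger, h.fderiv_eq]

lemma wirtingerBar_sum_mul_of_holomorphic (hf : ∀ i, DifferentiableAt ℝ (f i) z)
    (hg : ∀ i, DifferentiableAt ℂ (g i) z) :
    wirtingerBar (fun z => ∑ i, f i z * g i z) z = ∑ i, wirtingerBar (f i) z * g i z := by
  rw [wirtingerBar_sum (f := fun i z => f i z * g i z)
    fun i => (hf i).mul ((hg i).restrictScalars ℝ)]
  refine Finset.sum_congr rfl fun i _ => ?_
  rw [wirtingerBar_mul (hf i) ((hg i).restrictScalars ℝ),
    wirtingerBar_eq_zero_of_differentiableAt (hg i), mul_zero, add_zero]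

/-- The differential equation of the pairing of a harmonic form with a holomorphic form. -/
lemma wirtinger_wirtingerBar_sum_mul {k : ℕ} {g' : ι → ℂ → ℂ}
    (hf : ∀ i, ContDiffOn ℝ ∞ (f i) {z : ℂ | 0 < z.im})
    (hΔ : ∀ i, ∀ z : ℂ, 0 < z.im →
      z.im * wirtinger (wirtingerBar (f i)) z = -Complex.I * k * wirtingerBar (f i) z)
    (hg : ∀ i, ∀ z : ℂ, 0 < z.im → HasDerivAt (g i) (g' i z) z)
    (hg' : ∀ i, DifferentiableOn ℂ (g' i) {z : ℂ | 0 < z.im}) (hz : 0 < z.im) :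
    z.im * wirtinger (wirtingerBar fun z => ∑ i, f i z * g i z) z =
      -Complex.I * k * wirtingerBar (fun z => ∑ i, f i z * g i z) z +
        2 * z.im * wirtingerBar (fun z => ∑ i, f i z * g' i z) z := by
  have hfd : ∀ i, ∀ z : ℂ, 0 < z.im → DifferentiableAt ℝ (f i) z := fun i z hz =>
    (hf i).differentiableAt_im_pos (by simp) hz
  have hDfd : ∀ i, DifferentiableAt ℝ (wirtingerBar (f i)) z := fun i =>
    ((hf i).wirtingerBar (m := 1)
      (by rw [one_add_one_eq_two]; exact two_le_infty)).differentiableAt_im_pos one_ne_zero hz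
  have hgd : ∀ i, DifferentiableAt ℝ (g i) z := fun i =>
    (hg i z hz).differentiableAt.restrictScalars ℝ
  have h1 : wirtingerBar (fun z => ∑ i, f i z * g i z) =ᶠ[nhds z]
      fun z => ∑ i, wirtingerBar (f i) z * g i z := by
    filter_upwards [isOpen_im_pos.mem_nhds hz] with w hw
    exact wirtingerBar_sum_mul_of_holomorphic (fun i => hfd i w hw)
      fun i => (hg i w hw).differentiableAt
  rw [wirtinger_congr h1, h1.eq_of_nhds, wirtingerBar_sum_mul_of_holomorphic (fun i => hfd i z hz)
    fun i => (hg' i).differentiableAt (isOpen_im_pos.mem_nhds hz),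
    wirtinger_sum (f := fun i z => wirtingerBar (f i) z * g i z) fun i => (hDfd i).mul (hgd i),
    Finset.mul_sum, Finset.mul_sum, Finset.mul_sum, ← Finset.sum_add_distrib]
  refine Finset.sum_congr rfl fun i _ => ?_
  -- Applying D to D̄f·g, the derivative of g gives 2 D̄f·g', which is 2 D̄(f g') because g' is
  -- holomorphic.
  rw [wirtinger_mul (hDfd i) (hgd i), wirtinger_eq_two_mul_deriv (hg i z hz)]
  linear_combination g i z * hΔ i z hz

end Sums

/-! ### The regularized pairing in positive weight -/

section PositiveWeight

variable {ι : Type*} [Fintype ι] [DecidableEq ι]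
  {σ : Subgroup (SL(2, ℤ) × ((ι → ℂ) ≃ₗ[ℂ] (ι → ℂ)))} {k : ℕ} {f : ℍ → ι → ℂ}
  {g : ℍ → Module.Dual ℂ (ι → ℂ)}

/-- The regularized pairing in positive weight. -/
theorem hasRegPairing_of_pos (hk : 0 < k) (hf : IsHarmonicMaassForm σ (-(k : ℤ)) f)
    (hg : IsHolomorphicForm (dualRep σ) (k : ℤ) g) {A B : (ι → ℂ) ≃ₗ[ℂ] (ι → ℂ)}
    (hA : (ModularGroup.S, A) ∈ σ) (hB : (ModularGroup.T, B) ∈ σ) {cp cm : ℚ → ι → ℂ}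
    {b : ℚ → Module.Dual ℂ (ι → ℂ)} (hexp : HasMaassExpansion (-(k : ℤ)) f cp cm)
    (hb : HasQExpansion g b) :
    HasRegPairing f g (4 * Real.pi / k * constTerm (pairSeries cp (thetaOp b))) := by
  obtain ⟨P, hP, ε, hε, hO⟩ := hf.growth
  have hsm : ∀ i, ContDiffOn ℝ ∞ (fun z : ℂ => f (ofComplex z) i) {z : ℂ | 0 < z.im} := fun i =>
    hf.smooth (LinearMap.proj i)
  have hfc := fun i => (hsm i).continuousOn
  have hgd : ∀ w : ι → ℂ, DifferentiableOn ℂ (fun z => g (ofComplex z) w) {z : ℂ | 0 < z.im} :=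
    fun w => hg.holomorphic (Module.Dual.eval ℂ (ι → ℂ) w)
  have hΔ : ∀ i, ∀ z : ℂ, 0 < z.im → z.im * wirtinger (wirtingerBar fun z => f (ofComplex z) i) z =
      -Complex.I * k * wirtingerBar (fun z => f (ofComplex z) i) z := fun i z hz =>
    harmonic_iff_wirtinger (h := fun τ => f τ i) (hsm i) (hf.harmonic (LinearMap.proj i)) hz
  have hF : (fun z => g (ofComplex z) (f (ofComplex z))) =
      fun z => ∑ i, f (ofComplex z) i * g (ofComplex z) (Pi.single i 1) :=
    funext fun z => dual_apply_eq_sum _ _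
  have hH : (fun z => derivForm g z (f (ofComplex z))) =
      fun z => ∑ i, f (ofComplex z) i * derivForm g z (Pi.single i 1) :=
    funext fun z => dual_apply_eq_sum _ _
  have hgi : ∀ i, ∀ z : ℂ, 0 < z.im → HasDerivAt (fun z => g (ofComplex z) (Pi.single i 1))
      (derivForm g z (Pi.single i 1)) z := fun i z hz => hasDerivAt_derivForm hgd hz _
  have hFT : ∀ τ : ℍ, g ((1 : ℝ) +ᵥ τ) (f ((1 : ℝ) +ᵥ τ)) = g τ (f τ) :=
    pairing_vadd_one hf.modular hg.modular hB
  have hHT : ∀ z : ℂ, 0 < z.im → derivForm g (z + 1) (f (ofComplex (z + 1))) =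
      derivForm g z (f (ofComplex z)) := fun z hz => by
    rw [derivForm_add_one hgd hg.modular hB hz, ofComplex_add_one hz, hf.modular.vadd_one hB,
      LinearEquiv.symm_apply_apply]
  have hHS : ∀ z : ℂ, 0 < z.im → derivForm g (-z⁻¹) (f (ofComplex (-z⁻¹))) =
      z ^ 2 * derivForm g z (f (ofComplex z)) + k * z * g (ofComplex z) (f (ofComplex z)) := by
    intro z hz
    have hz0 : z ≠ 0 := fun h => by simp [h] at hz
    rw [derivForm_neg_inv hgd hg.modular hA hz, ofComplex_neg_inv hz, hf.modular.smul_S hA,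
      coe_ofComplex_of_im_pos hz, map_smul, LinearEquiv.symm_apply_apply, map_smul, map_smul,
      zpow_neg, zpow_natCast, zpow_sub_one₀ hz0, zpow_natCast, smul_eq_mul, smul_eq_mul]
    push_cast
    field_simp
    ring
  -- The expansion enters only here: its coefficients at m ≤ 0 are those of P, so the constant term
  -- is the finite sum that the horizontal integrals approach.
  have hval := constTerm_pairSeries_eq_sum (P := P) (cp := cp) hb.derivForm.nonneg
    fun m hm => hexp.eq_polynomial hε hfc hO hm
  have hc := tendsto_integral_pairing hε hfc hO hb hFT
  have hd := tendsto_integral_pairing hε hfc hO hb.derivForm (fun τ => by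
    have h := hHT τ τ.im_pos
    rw [ofComplex_add_one τ.im_pos, ofComplex_apply] at h
    rw [LinearMap.smul_apply, LinearMap.smul_apply, ← h, UpperHalfPlane.coe_vadd, add_comm,
      Complex.ofReal_one])
  have hd' := hd.const_mul (2 * Real.pi * Complex.I)
  have hd2 : Filter.Tendsto (fun v : ℝ => ∫ u in (-(1 / 2) : ℝ)..(1 / 2),
      derivForm g (u + v * Complex.I) (f (ofComplex (u + v * Complex.I)))) Filter.atTop
      (nhds (2 * Real.pi * Complex.I * constTerm (pairSeries cp (thetaOp b)))) := by
    rw [hval]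
    refine hd'.congr' ?_
    filter_upwards [Filter.eventually_gt_atTop 0] with v hv
    rw [← intervalIntegral.integral_const_mul]
    refine intervalIntegral.integral_congr fun u _ => ?_
    rw [coe_ofComplex_of_im_pos (by rw [im_ofReal_add_mul_I]; exact hv), LinearMap.smul_apply,
      smul_eq_mul, mul_inv_cancel_left₀ Complex.two_pi_I_ne_zero]
  have key := tendsto_setIntegral_truncatedDomain (F := fun z => g (ofComplex z) (f (ofComplex z)))
    (H := fun z => derivForm g z (f (ofComplex z))) hk
    (by
      rw [hF]
      exact ContDiffOn.sum fun i _ => (hsm i).mul (contDiffOn_of_differentiableOn_im_pos (hgd _)))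
    (by
      rw [hH]
      exact ContDiffOn.sum fun i _ => ((hsm i).of_le (by exact_mod_cast le_top)).mul
        (contDiffOn_of_differentiableOn_im_pos (differentiableOn_derivForm hgd _)))
    (fun z hz => by rw [ofComplex_add_one hz, hFT])
    (fun z hz => by rw [ofComplex_neg_inv hz, pairing_smul_S hf.modular hg.modular hA]) hHT hHS
    (fun z hz => by
      rw [hF, hH]
      exact wirtinger_wirtingerBar_sum_mul hsm hΔ hgi
        (fun i => differentiableOn_derivForm hgd _) hz) hc hd2
  -- The factor 2πi converts ϑ into d/dz, and (-2i)(2πi) = 4π.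
  have e : -2 * Complex.I / k * (2 * Real.pi * Complex.I * constTerm (pairSeries cp (thetaOp b))) =
      4 * Real.pi / k * constTerm (pairSeries cp (thetaOp b)) := by
    linear_combination (-4 * Real.pi / k * constTerm (pairSeries cp (thetaOp b))) * Complex.I_sq
  rw [e] at key
  simpa only [HasRegPairing, ofComplex_apply] using key

end PositiveWeight

/-- The theta operator kills m = 0, and negative exponents do not occur in b. -/
lemma constTerm_pairSeries_thetaOp {W : Type*} [AddCommGroup W] [Module ℂ W]
    (cp : ℚ → W) {b : ℚ → Module.Dual ℂ W} (hb : ∀ m < 0, b m = 0) :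
    constTerm (pairSeries cp (thetaOp b)) = ∑ᶠ (m : ℚ) (_ : 0 < m), (m : ℂ) * b m (cp (-m)) := by
  rw [constTerm, pairSeries]
  refine finsum_congr fun m => ?_
  rw [finsum_eq_if, zero_sub, thetaOp, LinearMap.smul_apply, smul_eq_mul]
  split_ifs with hm
  · rfl
  · rcases (not_lt.mp hm).eq_or_lt with h | h
    · rw [h]; simp
    · rw [hb m h]; simp

/-! ### Forms of weight zero -/

section Constant

/-- A function on the upper half plane invariant under `S` and `T` is invariant under `SL₂(ℤ)`. -/
lemma eq_of_invariant_generators {X : Type*} {Φ : ℍ → X}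
    (hT : ∀ τ : ℍ, Φ ((1 : ℝ) +ᵥ τ) = Φ τ) (hS : ∀ τ : ℍ, Φ (ModularGroup.S • τ) = Φ τ)
    (γ : SL(2, ℤ)) : ∀ τ : ℍ, Φ (γ • τ) = Φ τ := by
  have hγ : γ ∈ Subgroup.closure {ModularGroup.S, ModularGroup.T} := by
    rw [SpecialLinearGroup.SL2Z_generators]; exact Subgroup.mem_top γ
  induction hγ using Subgroup.closure_induction with
  | mem x hx =>
    rcases hx with rfl | rfl
    · exact hS
    · intro τ
      rw [modular_T_smul, hT]
  | one => simp
  | mul x y _ _ hx hy => intro τ; rw [mul_smul, hx, hy]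
  | inv x _ hx => intro τ; rw [← hx (x⁻¹ • τ), smul_inv_smul]

/-- A vector valued bounded holomorphic function of period `N` whose euclidean norm is invariant
under `SL₂(ℤ)` is constant. -/
theorem eq_const_of_norm_invariant {ι : Type*} [Fintype ι] {h : ℍ → ι → ℂ} {N : ℕ} (hN : 0 < N)
    (hper : ∀ τ : ℍ, h ((N : ℝ) +ᵥ τ) = h τ)
    (hol : ∀ i, DifferentiableOn ℂ (fun z => h (ofComplex z) i) {z : ℂ | 0 < z.im})
    (hbd : ∀ i, IsBoundedAtImInfty fun τ => h τ i)
    (hT : ∀ τ : ℍ, ∑ i, ‖h ((1 : ℝ) +ᵥ τ) i‖ ^ 2 = ∑ i, ‖h τ i‖ ^ 2)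
    (hS : ∀ τ : ℍ, ∑ i, ‖h (ModularGroup.S • τ) i‖ ^ 2 = ∑ i, ‖h τ i‖ ^ 2) :
    ∃ c : ι → ℂ, ∀ τ, h τ = c := by
  have hNr : (0 : ℝ) < N := by exact_mod_cast hN
  -- In the coordinate q = e^(2πiτ/N), boundedness at the cusp extends h holomorphically over q = 0.
  -- The euclidean norm makes the target strictly convex, which the vector valued maximum principle
  -- needs.
  set G : ℂ → EuclideanSpace ℂ ι := fun q =>
    WithLp.toLp 2 fun i => UpperHalfPlane.cuspFunction N (fun τ => h τ i) q with hG
  have hper' : ∀ i, Function.Periodic ((fun τ : ℍ => h τ i) ∘ ofComplex) ((N : ℝ) : ℂ) := by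
    intro i z
    simp only [Function.comp_apply]
    by_cases hz : 0 < z.im
    · rw [ofComplex_add_real hz, hper]
    · have hz' : ¬ 0 < (z + (N : ℝ)).im := by simpa using hz
      rw [ofComplex_apply_of_im_nonpos (not_lt.mp hz), ofComplex_apply_of_im_nonpos (not_lt.mp hz')]
  have hGτ : ∀ τ : ℍ, G (Function.Periodic.qParam N τ) = WithLp.toLp 2 (h τ) := fun τ => by
    exact congrArg (WithLp.toLp 2) (funext fun i =>
      UpperHalfPlane.eq_cuspFunction τ hNr.ne' (hper' i))
  have hdiff : DifferentiableOn ℂ G (Metric.ball 0 1) := by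
    rw [differentiableOn_euclidean]
    intro i
    exact UpperHalfPlane.differentiableOn_cuspFunction_ball hNr (hper' i)
      (UpperHalfPlane.mdifferentiable_iff.mpr (hol i)) (hbd i)
  have hinv : ∀ (γ : SL(2, ℤ)) (τ : ℍ), ‖(WithLp.toLp 2 (h (γ • τ)) : EuclideanSpace ℂ ι)‖ =
      ‖(WithLp.toLp 2 (h τ) : EuclideanSpace ℂ ι)‖ := fun γ τ => by
    rw [EuclideanSpace.norm_eq, EuclideanSpace.norm_eq]
    exact congrArg _ (eq_of_invariant_generators (Φ := fun τ => ∑ i, ‖h τ i‖ ^ 2) hT hS γ τ)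
  -- Every orbit meets Im τ ≥ 1/2, that is |q| ≤ e^(-π/N). The invariant norm thus takes all its
  -- values in a smaller closed disc, and the maximum principle applies.
  have hconst := Complex.eq_const_of_exists_le (f := G) (r := Real.exp (-Real.pi / N)) (b := 1)
    hdiff
    (Real.exp_nonneg _) (by
      rw [Real.exp_lt_one_iff]
      exact div_neg_of_neg_of_pos (neg_lt_zero.mpr Real.pi_pos) hNr) (fun q hq => by
      rcases eq_or_ne q 0 with rfl | hq0
      · exact ⟨0, by simpa using Real.exp_nonneg _, le_rfl⟩
      · have hq1 : ‖q‖ < 1 := mem_ball_zero_iff.mp hq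
        set τ : ℍ := ⟨_, Function.Periodic.im_invQParam_pos_of_norm_lt_one hNr hq1 hq0⟩ with hτ
        have hqτ : Function.Periodic.qParam N τ = q :=
          Function.Periodic.qParam_right_inv hNr.ne' hq0
        obtain ⟨γ, hγ⟩ := ModularGroup.exists_one_half_le_im_smul τ
        refine ⟨Function.Periodic.qParam N ((γ • τ : ℍ) : ℂ), ?_, ?_⟩
        · rw [mem_closedBall_zero_iff, Function.Periodic.norm_qParam, Real.exp_le_exp]
          refine div_le_div_of_nonneg_right ?_ hNr.le
          have : 1 / 2 ≤ ((γ • τ : ℍ) : ℂ).im := hγ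
          nlinarith [Real.pi_pos]
        · rw [hGτ, hinv, ← hGτ, hqτ])
  refine ⟨fun i => G 0 i, fun τ => funext fun i => ?_⟩
  have h1 := hconst (x := Function.Periodic.qParam N τ)
    (mem_ball_zero_iff.mpr (Function.Periodic.norm_qParam_lt_one hNr τ.im_pos))
  rw [hGτ, Function.const_apply] at h1
  rw [← h1]

end Constant

/-! ### Unitarity of the Weil representation and forms of weight zero -/

namespace EvenLattice

variable {V : Type*} [AddCommGroup V] [Module ℚ V] (L : EvenLattice V)

lemma norm_eQ (μ : L.Disc) : ‖L.eQ μ‖ = 1 := by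
  induction μ using Submodule.Quotient.induction_on with
  | _ x =>
    rw [eQ_mk, expRat, Complex.norm_exp]
    simp

lemma norm_eB (μ ν : L.Disc) : ‖L.eB μ ν‖ = 1 := by
  rw [eB, norm_div, norm_mul, norm_eQ, norm_eQ, norm_eQ]
  norm_num

lemma eB_neg_mul (μ ν : L.Disc) : L.eB (-μ) ν * L.eB μ ν = 1 := by
  rw [L.eB_comm, L.eB_comm μ, ← eB_add, neg_add_cancel, eB_zero]

lemma conj_eB_neg (μ ν : L.Disc) : (starRingEnd ℂ) (L.eB (-μ) ν) = L.eB μ ν := by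
  have h1 : L.eB (-μ) ν ≠ 0 := left_ne_zero_of_mul_eq_one (L.eB_neg_mul μ ν)
  refine mul_left_cancel₀ h1 ?_
  rw [Complex.mul_conj, Complex.normSq_eq_norm_sq, norm_eB, eB_neg_mul]
  norm_num

/-- Parseval's identity on the discriminant group. -/
lemma sum_norm_sq_fourier (x : L.Disc → ℂ) :
    ∑ μ, ‖∑ ν, L.eB (-μ) ν * x ν‖ ^ 2 = Fintype.card L.Disc * ∑ ν, ‖x ν‖ ^ 2 := by
  classical
  have hsq : ∀ w : ℂ, ((‖w‖ ^ 2 : ℝ) : ℂ) = (starRingEnd ℂ) w * w := fun w => by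
    rw [mul_comm, Complex.mul_conj, Complex.normSq_eq_norm_sq]
  have key : ((∑ μ, ‖∑ ν, L.eB (-μ) ν * x ν‖ ^ 2 : ℝ) : ℂ) =
      ((Fintype.card L.Disc * ∑ ν, ‖x ν‖ ^ 2 : ℝ) : ℂ) := by
    rw [Complex.ofReal_sum, Complex.ofReal_mul, Complex.ofReal_sum]
    simp only [hsq, map_sum, map_mul, conj_eB_neg, Finset.sum_mul_sum]
    rw [Finset.sum_comm, Finset.mul_sum]
    refine Finset.sum_congr rfl fun ν _ => ?_
    rw [Finset.sum_comm]
    have h1 : ∀ ν', ∑ μ, L.eB μ ν * (starRingEnd ℂ) (x ν) * (L.eB (-μ) ν' * x ν') =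
        (if ν - ν' = 0 then (Fintype.card L.Disc : ℂ) else 0) * ((starRingEnd ℂ) (x ν) * x ν') := by
      intro ν'
      rw [← sum_eB, Finset.sum_mul]
      refine Finset.sum_congr rfl fun μ _ => ?_
      have h2 : L.eB (-μ) ν' = L.eB μ (-ν') := by
        have h3 : L.eB μ ν' ≠ 0 := right_ne_zero_of_mul_eq_one (L.eB_neg_mul μ ν')
        refine mul_right_cancel₀ h3 ?_
        rw [eB_neg_mul, ← eB_add, neg_add_cancel, eB_zero]
      rw [h2, L.eB_comm (ν - ν'), sub_eq_add_neg, eB_add]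
      ring
    rw [Finset.sum_congr rfl fun ν' _ => h1 ν']
    simp [sub_eq_zero, ite_mul]
  exact_mod_cast key

open scoped Classical in
lemma weilT_symm_single (μ : L.Disc) :
    L.weilT.symm (Pi.single μ 1) = L.eQ μ • (Pi.single μ 1 : L.Disc → ℂ) := by
  funext ν
  change L.eQ ν * (Pi.single μ 1 : L.Disc → ℂ) ν = L.eQ μ * (Pi.single μ 1 : L.Disc → ℂ) ν
  rcases eq_or_ne ν μ with rfl | h
  · rfl
  · simp [h]

open scoped Classical in
lemma weilS_symm_single (μ : L.Disc) : L.weilS.symm (Pi.single μ 1) =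
    fun ν => (L.weilConst * Fintype.card L.Disc)⁻¹ * L.eB (-μ) ν := by
  funext ν
  change (L.weilConst * Fintype.card L.Disc)⁻¹ *
    ∑ ρ, L.eB (-ρ) ν * (Pi.single μ 1 : L.Disc → ℂ) ρ = _
  simp [Pi.single_apply]

/-- Together with Parseval's identity this makes ω_M(S) unitary. The signature enters the constant
only through a phase. -/
lemma norm_weilConst_sq : ‖L.weilConst‖ ^ 2 * Fintype.card L.Disc = 1 := by
  have hc : (0 : ℝ) < Fintype.card L.Disc := by exact_mod_cast Fintype.card_pos
  have h1 : ‖Complex.exp (2 * Real.pi * Complex.I *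
      (((sigPos L.Q : ℂ) - (sigNeg L.Q : ℂ)) / 8))‖ = 1 := by
    have : (2 * Real.pi * Complex.I * (((sigPos L.Q : ℂ) - (sigNeg L.Q : ℂ)) / 8)) =
        ((2 * Real.pi * (((sigPos L.Q : ℝ) - (sigNeg L.Q : ℝ)) / 8) : ℝ) : ℂ) * Complex.I := by
      push_cast; ring
    rw [this, Complex.norm_exp_ofReal_mul_I]
  rw [weilConst, norm_div, h1, Complex.norm_real, Real.norm_of_nonneg (Real.sqrt_nonneg _), div_pow,
    Real.sq_sqrt hc.le]
  field_simp

/-- A natural number `N` with `e(N Q(μ)) = 1` for all `μ`. -/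
lemma exists_eQ_pow_eq_one : ∃ N : ℕ, 0 < N ∧ ∀ μ, L.eQ μ ^ N = 1 := by
  have h : ∀ μ, ∃ n : ℕ, 0 < n ∧ L.eQ μ ^ n = 1 := by
    intro μ
    induction μ using Submodule.Quotient.induction_on with
    | _ x =>
      refine ⟨(L.Q (x : V)).den, (L.Q (x : V)).den_pos, ?_⟩
      rw [eQ_mk, expRat, ← Complex.exp_nat_mul, Complex.exp_eq_one_iff]
      refine ⟨(L.Q (x : V)).num, ?_⟩
      have h1 := Rat.den_mul_eq_num (L.Q (x : V))
      have h2 : ((L.Q (x : V)).den : ℂ) * (L.Q (x : V) : ℂ) = ((L.Q (x : V)).num : ℂ) := by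
        exact_mod_cast h1
      rw [← h2]
      ring
  choose n hn hn1 using h
  refine ⟨∏ μ, n μ, Finset.prod_pos fun μ _ => hn μ, fun μ => ?_⟩
  obtain ⟨c, hc⟩ := Finset.dvd_prod_of_mem n (Finset.mem_univ μ)
  rw [hc, pow_mul, hn1, one_pow]

variable {L}

lemma periodic_of_vadd_one {f : ℍ → L.S} (hf : ∀ τ : ℍ, f ((1 : ℝ) +ᵥ τ) = L.weilT (f τ)) {N : ℕ}
    (hN : ∀ μ, L.eQ μ ^ N = 1) (τ : ℍ) : f ((N : ℝ) +ᵥ τ) = f τ := by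
  have h : ∀ n : ℕ, ∀ μ, f ((n : ℝ) +ᵥ τ) μ = (L.eQ μ ^ n)⁻¹ * f τ μ := by
    intro n
    induction n with
    | zero => simp
    | succ n ih =>
      intro μ
      rw [Nat.cast_succ, add_comm, add_vadd, hf]
      change (L.eQ μ)⁻¹ * f ((n : ℝ) +ᵥ τ) μ = _
      rw [ih, pow_succ, mul_inv]
      ring
  funext μ
  rw [h, hN, inv_one, one_mul]

open scoped Classical in
lemma apply_single_vadd_one {g : ℍ → Module.Dual ℂ L.S}
    (hg : ∀ τ : ℍ, g ((1 : ℝ) +ᵥ τ) = contragredient L.weilT (g τ)) (τ : ℍ) (μ : L.Disc) :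
    g ((1 : ℝ) +ᵥ τ) (Pi.single μ 1) = L.eQ μ * g τ (Pi.single μ 1) := by
  rw [hg, contragredient_apply, weilT_symm_single, map_smul, smul_eq_mul]

lemma dual_periodic_of_vadd_one {g : ℍ → Module.Dual ℂ L.S}
    (hg : ∀ τ : ℍ, g ((1 : ℝ) +ᵥ τ) = contragredient L.weilT (g τ)) {N : ℕ}
    (hN : ∀ μ, L.eQ μ ^ N = 1) (τ : ℍ) : g ((N : ℝ) +ᵥ τ) = g τ := by
  classical
  have h : ∀ n : ℕ, ∀ μ, g ((n : ℝ) +ᵥ τ) (Pi.single μ 1) =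
      L.eQ μ ^ n * g τ (Pi.single μ 1) := by
    intro n
    induction n with
    | zero => simp
    | succ n ih =>
      intro μ
      rw [Nat.cast_succ, add_comm, add_vadd, apply_single_vadd_one hg, ih, pow_succ]
      ring
  refine LinearMap.ext fun w => ?_
  rw [dual_apply_eq_sum, dual_apply_eq_sum (g τ)]
  refine Finset.sum_congr rfl fun μ _ => ?_
  rw [h, hN, one_mul]

/-- Holomorphic forms of weight zero for the dual Weil representation are constant. -/
theorem exists_eq_const_of_weight_zero {g : ℍ → Module.Dual ℂ L.S}
    (hg : IsHolomorphicForm (dualRep L.weilRep) 0 g) : ∃ g₀, ∀ τ, g τ = g₀ := by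
  classical
  have hT : ∀ τ : ℍ, g ((1 : ℝ) +ᵥ τ) = contragredient L.weilT (g τ) :=
    hg.modular.vadd_one (mem_dualRep (Subgroup.subset_closure (by simp)))
  have hS : ∀ τ : ℍ, g (ModularGroup.S • τ) = (τ : ℂ) ^ (0 : ℤ) • contragredient L.weilS (g τ) :=
    hg.modular.smul_S (mem_dualRep (Subgroup.subset_closure (by simp)))
  obtain ⟨N, hN, hNQ⟩ := L.exists_eQ_pow_eq_one
  obtain ⟨c, hc⟩ := eq_const_of_norm_invariant (h := fun τ μ => g τ (Pi.single μ 1)) hN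
    (fun τ => by simp only [dual_periodic_of_vadd_one hT hNQ])
    (fun μ => hg.holomorphic (Module.Dual.eval ℂ L.S (Pi.single μ 1)))
    (fun μ => hg.bounded (Module.Dual.eval ℂ L.S (Pi.single μ 1)))
    (fun τ => Finset.sum_congr rfl fun μ _ => by
      rw [apply_single_vadd_one hT, norm_mul, norm_eQ, one_mul])
    (fun τ => by
      have h1 : ∀ μ, g (ModularGroup.S • τ) (Pi.single μ 1) =
          (L.weilConst * Fintype.card L.Disc)⁻¹ * ∑ ν, L.eB (-μ) ν * g τ (Pi.single ν 1) := by
        intro μ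
        rw [hS, zpow_zero, one_smul, contragredient_apply, weilS_symm_single, dual_apply_eq_sum,
          Finset.mul_sum]
        exact Finset.sum_congr rfl fun ν _ => by ring
      have hcard : (0 : ℝ) < Fintype.card L.Disc := by exact_mod_cast Fintype.card_pos
      have h2 := L.norm_weilConst_sq
      have h3 : ‖L.weilConst‖ ^ 2 ≠ 0 := left_ne_zero_of_mul_eq_one h2
      simp only [h1, norm_mul, mul_pow, ← Finset.mul_sum]
      rw [sum_norm_sq_fourier, norm_inv, norm_mul, Complex.norm_natCast, inv_pow, mul_pow,
        ← mul_assoc]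
      -- Parseval contributes one factor |M'/M|, and |M'/M|·|weilConst|² = 1 balances the
      -- normalization of the inverse Fourier transform.
      have h4 : (‖L.weilConst‖ ^ 2 * (Fintype.card L.Disc : ℝ) ^ 2)⁻¹ * Fintype.card L.Disc =
          1 := by
        rw [sq (Fintype.card L.Disc : ℝ), ← mul_assoc, h2, one_mul, inv_mul_cancel₀ hcard.ne']
      rw [h4, one_mul])
  refine ⟨g UpperHalfPlane.I, fun τ => LinearMap.ext fun w => ?_⟩
  rw [dual_apply_eq_sum, dual_apply_eq_sum (g UpperHalfPlane.I)]
  refine Finset.sum_congr rfl fun μ _ => ?_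
  rw [show g τ (Pi.single μ 1) = c μ from congrFun (hc τ) μ,
    show g UpperHalfPlane.I (Pi.single μ 1) = c μ from congrFun (hc UpperHalfPlane.I) μ]

end EvenLattice

/-! ### Vanishing of the antiholomorphic part -/

section Antiholomorphic

variable {X Y A K F : ℂ → ℂ}

/-- A function that is holomorphic and antiholomorphic is constant. -/
lemma eq_of_add_conj_eq_zero (hX : DifferentiableOn ℂ X {z : ℂ | 0 < z.im})
    (hY : DifferentiableOn ℂ Y {z : ℂ | 0 < z.im})
    (h : ∀ z : ℂ, 0 < z.im → X z + (starRingEnd ℂ) (Y z) = 0) {z w : ℂ} (hz : 0 < z.im)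
    (hw : 0 < w.im) : Y z = Y w := by
  refine isOpen_im_pos.is_const_of_deriv_eq_zero
    (convex_halfSpace_im_gt 0).isPreconnected hY (fun x hx => ?_) hz hw
  have hx' : 0 < x.im := hx
  have hYx := hY.differentiableAt (isOpen_im_pos.mem_nhds hx)
  have h1 : (fun z => (starRingEnd ℂ) (Y z)) =ᶠ[nhds x] fun z => -X z := by
    filter_upwards [isOpen_im_pos.mem_nhds hx] with y hy
    linear_combination h y hy
  have h2 := wirtingerBar_congr h1
  have h3 : wirtingerBar (fun z => -X z) x = 0 := wirtingerBar_eq_zero_of_differentiableAt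
    (hX.differentiableAt (isOpen_im_pos.mem_nhds hx)).neg
  rw [wirtingerBar_conj (hYx.restrictScalars ℝ), wirtinger_eq_two_mul_deriv hYx.hasDerivAt,
    h3, map_eq_zero] at h2
  simpa using h2

/-- If an invariant function is the sum of a holomorphic function and the conjugate of a
holomorphic function vanishing at the cusp, then the latter is zero. -/
theorem antiholomorphic_part_eq_zero (hA : DifferentiableOn ℂ A {z : ℂ | 0 < z.im})
    (hK : DifferentiableOn ℂ K {z : ℂ | 0 < z.im})
    (hF : ∀ z : ℂ, 0 < z.im → F z = A z + (starRingEnd ℂ) (K z))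
    (hT : ∀ z : ℂ, 0 < z.im → F (z + 1) = F z) (hS : ∀ z : ℂ, 0 < z.im → F (-z⁻¹) = F z)
    (hlim : Filter.Tendsto (fun τ : ℍ => K τ) atImInfty (nhds 0)) {z : ℂ} (hz : 0 < z.im) :
    K z = 0 := by
  have hmap1 : Set.MapsTo (fun z : ℂ => z + 1) {z : ℂ | 0 < z.im} {z : ℂ | 0 < z.im} :=
    fun z hz => by simpa using hz
  have hmapS : Set.MapsTo (fun z : ℂ => -z⁻¹) {z : ℂ | 0 < z.im} {z : ℂ | 0 < z.im} :=
    fun z hz => im_neg_inv_pos hz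
  have hdS : DifferentiableOn ℂ (fun z : ℂ => -z⁻¹) {z : ℂ | 0 < z.im} := fun z hz =>
    (hasDerivAt_neg_inv fun h => by simp [h] at hz).differentiableAt.differentiableWithinAt
  have hd1 : DifferentiableOn ℂ (fun z : ℂ => z + 1) {z : ℂ | 0 < z.im} := by fun_prop
  have hvadd : Filter.Tendsto (fun τ : ℍ => (1 : ℝ) +ᵥ τ) atImInfty atImInfty := by
    rw [atImInfty, Filter.tendsto_comap_iff]
    refine Filter.tendsto_comap.congr fun τ => ?_
    simp
  have hKT : ∀ τ : ℍ, K (((1 : ℝ) +ᵥ τ : ℍ) : ℂ) = K τ := by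
    have hc : ∀ τ : ℍ, K (((1 : ℝ) +ᵥ τ : ℍ) : ℂ) - K τ = K (Complex.I + 1) - K Complex.I := by
      intro τ
      have := eq_of_add_conj_eq_zero (X := fun z => A (z + 1) - A z)
        (Y := fun z => K (z + 1) - K z) ((hA.comp hd1 hmap1).sub hA) ((hK.comp hd1 hmap1).sub hK)
        (fun z hz => by
          have h1 := hT z hz
          rw [hF _ (hmap1 hz), hF z hz] at h1
          rw [map_sub]
          linear_combination h1) τ.im_pos (w := Complex.I) (by simp)
      rw [UpperHalfPlane.coe_vadd, add_comm, Complex.ofReal_one]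
      exact this
    -- K(z+1) - K(z) is both holomorphic and antiholomorphic up to sign, hence constant. It tends to
    -- zero at the cusp, so the constant is zero.
    have h0 := (hlim.comp hvadd).sub hlim
    rw [sub_zero] at h0
    have h1 : K (Complex.I + 1) - K Complex.I = 0 :=
      tendsto_nhds_unique (tendsto_const_nhds.congr fun τ => (hc τ).symm) h0
    intro τ
    rw [← sub_eq_zero, hc, h1]
  have hKS : ∀ τ : ℍ, K ((ModularGroup.S • τ : ℍ) : ℂ) = K τ := by
    intro τ
    have := eq_of_add_conj_eq_zero (X := fun z => A (-z⁻¹) - A z)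
        (Y := fun z => K (-z⁻¹) - K z) ((hA.comp hdS hmapS).sub hA) ((hK.comp hdS hmapS).sub hK)
        (fun z hz => by
          have h1 := hS z hz
          rw [hF _ (hmapS hz), hF z hz] at h1
          rw [map_sub]
          linear_combination h1) τ.im_pos (w := Complex.I) (by simp)
    rw [modular_S_smul]
    -- For S the constant is evaluated at its fixed point i, where the difference is zero.
    simp only [Complex.inv_I, neg_neg, sub_self] at this
    rw [UpperHalfPlane.coe_mk, inv_neg]
    exact sub_eq_zero.mp this
  -- K itself is now invariant under both generators, so the one-dimensional case with period 1
  -- applies.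
  obtain ⟨c, hc⟩ := eq_const_of_norm_invariant (h := fun (τ : ℍ) (_ : Unit) => K τ) one_pos
    (fun τ => by funext _; rw [Nat.cast_one]; exact hKT τ)
    (fun _ => hK.congr fun z hz => by rw [coe_ofComplex_of_im_pos hz])
    (fun _ => hlim.isBigO_one ℝ) (fun τ => by simp only [hKT]) (fun τ => by simp only [hKS])
  have hcK : ∀ τ : ℍ, K τ = c () := fun τ => congrFun (hc τ) ()
  have h0 : c () = 0 := tendsto_nhds_unique (tendsto_const_nhds.congr fun τ => (hcK τ).symm) hlim
  exact (hcK ⟨z, hz⟩).trans h0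

/-- A `q`-series with positive exponents of bounded denominators vanishes at the cusp. -/
lemma tendsto_zero_of_hasSum_qExp {b : ℚ → ℂ} {B : ℂ → ℂ} {N : ℕ} (hN : 0 < N)
    (hb : ∀ m ≤ 0, b m = 0) (hbN : ∀ m, b m ≠ 0 → ∃ n : ℤ, (N : ℚ) * m = n)
    (hB : ∀ z : ℂ, 0 < z.im → HasSum (fun m : ℚ => qExp m z * b m) (B z)) :
    Filter.Tendsto (fun τ : ℍ => B τ) atImInfty (nhds 0) := by
  have hNq : (0 : ℚ) < N := by exact_mod_cast hN
  have hNr : (0 : ℝ) < N := by exact_mod_cast hN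
  -- Positive exponents in (1/N)ℤ are at least 1/N. Dividing by q^(1/N) leaves a series with
  -- non-negative exponents, bounded for Im z ≥ 1, whence the decay.
  set r : ℚ := (N : ℚ)⁻¹ with hr
  have hr0 : (0 : ℝ) < (r : ℝ) := by
    have : 0 < r := inv_pos.mpr hNq
    exact_mod_cast this
  have hshift : ∀ z : ℂ, 0 < z.im → HasSum (fun m : ℚ => qExp m z * b (m + r))
      (qExp (-r) z * B z) := by
    intro z hz
    have h1 := ((Equiv.addRight r).hasSum_iff.mpr (hB z hz)).mul_left (qExp (-r) z)
    refine h1.congr_fun fun m => ?_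
    rw [Function.comp_apply, Equiv.coe_addRight, ← mul_assoc, ← qExp_add]
    congr 2
    ring
  obtain ⟨C, hC0, hC⟩ := exists_bound_of_hasSum_qExp (b := fun m => b (m + r)) (fun m hm => by
    by_contra h
    obtain ⟨n, hn⟩ := hbN _ h
    have h1 : 0 < m + r := by
      by_contra h2
      exact h (hb _ (not_lt.mp h2))
    have h3 : (0 : ℚ) < n := by rw [← hn]; positivity
    have h4 : (1 : ℚ) ≤ n := by exact_mod_cast h3
    have h5 : (N : ℚ) * (m + r) < 1 := by
      rw [mul_add, hr, mul_inv_cancel₀ hNq.ne']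
      have := mul_neg_of_pos_of_neg hNq hm
      linarith
    rw [hn] at h5
    exact absurd h4 (not_le.mpr h5)) hshift
  have hbound : ∀ᶠ τ : ℍ in atImInfty, ‖B τ‖ ≤ C * Real.exp (-(2 * Real.pi * r) * τ.im) := by
    refine atImInfty_mem _ |>.mpr ⟨1, fun τ hτ => ?_⟩
    have h1 : B τ = qExp r τ * (qExp (-r) τ * B τ) := by
      rw [← mul_assoc, ← qExp_add, add_neg_cancel, qExp_zero, one_mul]
    have h2 := hC τ hτ
    rw [Set.mem_ofPred_eq, h1, norm_mul, mul_comm]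
    refine mul_le_mul h2 (le_of_eq ?_) (norm_nonneg _) hC0
    rw [norm_qExp]
    congr 1
    rw [UpperHalfPlane.coe_im]
    ring
  refine squeeze_zero_norm' hbound ?_
  have h := tendsto_mul_exp_neg_mul
    (neg_lt_zero.mpr (by positivity : 0 < 2 * Real.pi * (r : ℝ))) C
  exact h.comp Filter.tendsto_comap

end Antiholomorphic

/-! ### Holomorphy of the pairing in weight zero -/

section WeightZero

lemma incGamma_one (x : ℝ) : incGamma (1 - ((-((0 : ℕ) : ℤ) : ℤ) : ℝ)) x = Real.exp (-x) := by
  rw [incGamma_eq 0]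
  simp only [pow_zero, mul_one]
  exact integral_exp_neg_Ioi x

variable {ι : Type*} [Fintype ι] {σ : Subgroup (SL(2, ℤ) × ((ι → ℂ) ≃ₗ[ℂ] (ι → ℂ)))}
  {f : ℍ → ι → ℂ} {cp cm : ℚ → ι → ℂ}

/-- In weight zero, the pairing of a harmonic Maass form with an invariant functional is
holomorphic. -/
lemma differentiableOn_pairing_of_weight_zero
    (hexp : HasMaassExpansion (-((0 : ℕ) : ℤ)) f cp cm) (g₀ : Module.Dual ℂ (ι → ℂ))
    (hT : ∀ z : ℂ, 0 < z.im → g₀ (f (ofComplex (z + 1))) = g₀ (f (ofComplex z)))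
    (hS : ∀ z : ℂ, 0 < z.im → g₀ (f (ofComplex (-z⁻¹))) = g₀ (f (ofComplex z))) :
    DifferentiableOn ℂ (fun z => g₀ (f (ofComplex z))) {z : ℂ | 0 < z.im} := by
  obtain ⟨N, hN, hcm⟩ := hexp.denom_cm
  set b : ℚ → ℂ := fun m => (starRingEnd ℂ) (g₀ (cm (-m))) with hb
  set A : ℂ → ℂ := fun z => ∑' m : ℚ, qExp m z * g₀ (cp m) with hA
  set K : ℂ → ℂ := fun z => ∑' m : ℚ, qExp m z * b m with hK
  -- Since Γ(1, x) = e^(-x), the factor e^(-4π|m|v) turns q^m, for m < 0, into the conjugate of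
  -- q^(-m). The second series is thus the conjugate of a q-series with positive exponents.
  have hterm : ∀ (m : ℚ) (z : ℂ), 0 < z.im →
      (incGamma (1 - ((-((0 : ℕ) : ℤ) : ℤ) : ℝ)) (4 * Real.pi * |(m : ℝ)| * z.im) : ℂ) * qExp m z *
        g₀ (cm m) = (starRingEnd ℂ) (qExp (-m) z * b (-m)) := by
    intro m z hz
    rcases le_or_gt 0 m with hm | hm
    · rw [hb]
      beta_reduce
      rw [neg_neg, hexp.cm_neg m hm]
      simp
    · have hm' : (m : ℝ) < 0 := by exact_mod_cast hm
      have hconj := conj_qExp (-m) z.re z.im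
      rw [Complex.re_add_im, neg_neg] at hconj
      rw [incGamma_one, map_mul, hconj, hb, Complex.conj_conj, neg_neg, abs_of_neg hm']
      push_cast
      ring_nf
  have hterm' : ∀ (τ : ℍ) (m : ℚ),
      (incGamma (1 - ((-((0 : ℕ) : ℤ) : ℤ) : ℝ)) (4 * Real.pi * |(m : ℝ)| * τ.im) : ℂ) * qPow m τ *
        g₀ (cm m) = (starRingEnd ℂ) (qExp (-m) τ * b (-m)) := fun τ m => hterm m τ τ.im_pos
  have hsK : ∀ τ : ℍ, Summable fun m : ℚ => qPow m τ * b m := by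
    intro τ
    have h1 := hexp.summable_cm g₀ τ
    simp only [hterm'] at h1
    have h2 := (Equiv.neg ℚ).summable_iff.mpr h1
    have h3 := h2.map (starRingEnd ℂ) Complex.continuous_conj
    refine h3.congr fun m => ?_
    simp [qPow_eq_qExp]
  have hBK : ∀ z : ℂ, 0 < z.im → HasSum (fun m : ℚ => qExp m z * b m) (K z) := fun z hz =>
    (hsK ⟨z, hz⟩).hasSum
  have hAd : DifferentiableOn ℂ A {z : ℂ | 0 < z.im} := differentiableOn_tsum_qExp
    (hexp.summable_cp g₀)
  have hKd : DifferentiableOn ℂ K {z : ℂ | 0 < z.im} := differentiableOn_tsum_qExp hsK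
  have hF : ∀ z : ℂ, 0 < z.im → g₀ (f (ofComplex z)) = A z + (starRingEnd ℂ) (K z) := by
    intro z hz
    have h1 := hexp.eq g₀ (ofComplex z)
    rw [tsum_congr (hterm' (ofComplex z))] at h1
    simp only [coe_ofComplex_of_im_pos hz, qPow_eq_qExp] at h1
    rw [h1]
    congr 1
    have h2 := (Equiv.neg ℚ).hasSum_iff.mpr (hBK z hz)
    exact (h2.map (starRingEnd ℂ) Complex.continuous_conj).tsum_eq
  have hlim := tendsto_zero_of_hasSum_qExp hN (fun m hm => by
      rw [hb]; beta_reduce; rw [hexp.cm_neg _ (neg_nonneg.mpr hm), map_zero, map_zero])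
    (fun m hm => by
      obtain ⟨n, hn⟩ := hcm (-m) fun h => hm (by rw [hb]; beta_reduce; rw [h, map_zero, map_zero])
      exact ⟨-n, by push_cast; rw [← hn]; ring⟩) hBK
  refine hAd.congr fun z hz => ?_
  rw [hF z hz, antiholomorphic_part_eq_zero hAd hKd hF hT hS hlim hz, map_zero, add_zero]

end WeightZero

/-! ### The Eisenstein series of weight two -/

section EisensteinSeries

open EisensteinSeries

lemma eisensteinTwo_natCast (n : ℕ) : eisensteinTwo n = -24 * sigmaOne n := by
  simp [eisensteinTwo]

lemma eisensteinTwo_eq_extend : eisensteinTwo = Function.extend (fun n : ℕ => (n : ℚ) / (1 : ℕ))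
    (fun n : ℕ => (if n = 0 then 1 else -24 * (ArithmeticFunction.sigma 1 n : ℕ) : ℂ)) 0 := by
  have hinj : Function.Injective fun n : ℕ => (n : ℚ) / (1 : ℕ) := fun a b h => by
    simpa using h
  funext m
  by_cases hm : ∃ n : ℕ, (n : ℚ) / (1 : ℕ) = m
  · obtain ⟨n, rfl⟩ := hm
    rw [hinj.extend_apply]
    simp only [Nat.cast_one, div_one]
    rw [eisensteinTwo_natCast, sigmaOne]
    split_ifs <;> norm_num
  · rw [Function.extend_apply' _ _ _ hm, eisensteinTwo, if_neg]
    · rfl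
    · rintro ⟨h1, h2⟩
      refine hm ⟨m.num.toNat, ?_⟩
      have h3 : ((m.num.toNat : ℕ) : ℤ) = m.num := Int.toNat_of_nonneg (Rat.num_nonneg.mpr h2)
      have h4 : ((m.num.toNat : ℕ) : ℚ) = (m.num : ℚ) := by exact_mod_cast h3
      rw [h4, Nat.cast_one, div_one]
      exact Rat.coe_int_num_of_den_eq_one h1

lemma hasSum_eisensteinTwo (τ : ℍ) :
    HasSum (fun m : ℚ => qPow m τ * eisensteinTwo m) (E2 τ) := by
  rw [eisensteinTwo_eq_extend]
  refine hasSum_rat_of_hasSum_nat one_pos _ ?_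
  refine (hasSum_qExpansion_E2 τ).congr_fun fun n => ?_
  simp [Function.Periodic.qParam]

lemma eisensteinTwo_eq_zero_of_neg {m : ℚ} (hm : m < 0) : eisensteinTwo m = 0 := by
  rw [eisensteinTwo, if_neg fun h => not_le.mpr hm h.2]

lemma hasQExpansion_E2_smul {W : Type*} [AddCommGroup W] [Module ℂ W] (w : W) :
    HasQExpansion (fun τ => E2 τ • w) (fun m => eisensteinTwo m • w) := by
  refine ⟨⟨1, one_pos, fun m hm => ⟨m.num, ?_⟩⟩, fun m hm => ?_, fun ℓ τ => ?_⟩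
  · have h : m.den = 1 := by
      by_contra h
      exact hm (by beta_reduce; rw [eisensteinTwo, if_neg fun h' => h h'.1, zero_smul])
    rw [Nat.cast_one, one_mul, Rat.coe_int_num_of_den_eq_one h]
  · rw [eisensteinTwo_eq_zero_of_neg hm, zero_smul]
  · simp only [map_smul, smul_eq_mul, ← mul_assoc]
    exact (hasSum_eisensteinTwo τ).mul_right _

lemma E2_vadd_one (τ : ℍ) : E2 ((1 : ℝ) +ᵥ τ) = E2 τ := by
  refine (hasSum_qExpansion_E2 _).unique ((hasSum_qExpansion_E2 τ).congr_fun fun n => ?_)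
  congr 2
  rw [UpperHalfPlane.coe_vadd, Complex.ofReal_one, mul_add, mul_one, Complex.exp_add,
    Complex.exp_two_pi_mul_I, one_mul]

/-- The quasi-modular anomaly of E₂. Its constant -6i/π = 12/(2πi) comes from ζ(2) = π²/6. -/
lemma E2_smul_S (τ : ℍ) :
    E2 (ModularGroup.S • τ) = (τ : ℂ) ^ 2 * E2 τ + -6 * Complex.I / Real.pi * τ := by
  have h := congrFun (E2_slash_action ModularGroup.S) τ
  rw [SlashInvariantForm.slash_S_apply, ← modular_S_smul, Pi.sub_apply, Pi.smul_apply, D2_S,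
    riemannZeta_two, smul_eq_mul] at h
  have hτ := τ.ne_zero
  have hpi : (Real.pi : ℂ) ≠ 0 := by exact_mod_cast Real.pi_ne_zero
  have h2 : E2 (ModularGroup.S • τ) = (τ : ℂ) ^ 2 *
      (E2 (ModularGroup.S • τ) * (τ : ℂ) ^ (-2 : ℤ)) := by
    rw [zpow_neg]
    field_simp
  rw [h2, h]
  field_simp
  ring

lemma differentiableOn_E2 : DifferentiableOn ℂ (fun z => E2 (ofComplex z)) {z : ℂ | 0 < z.im} :=
  UpperHalfPlane.mdifferentiable_iff.mp E2_mdifferentiable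

end EisensteinSeries

/-! ### The regularized pairing in weight zero -/

section WeightZero

variable {ι : Type*} [Fintype ι] [DecidableEq ι]
  {σ : Subgroup (SL(2, ℤ) × ((ι → ℂ) ≃ₗ[ℂ] (ι → ℂ)))} {f : ℍ → ι → ℂ} {cp cm : ℚ → ι → ℂ}

/-- The regularized pairing in weight zero. -/
theorem hasRegPairing_of_weight_zero (hf : IsHarmonicMaassForm σ (-((0 : ℕ) : ℤ)) f)
    {g₀ : Module.Dual ℂ (ι → ℂ)} (hg : IsModular (dualRep σ) ((0 : ℕ) : ℤ) fun _ => g₀)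
    {A B : (ι → ℂ) ≃ₗ[ℂ] (ι → ℂ)}
    (hA : (ModularGroup.S, A) ∈ σ) (hB : (ModularGroup.T, B) ∈ σ)
    (hexp : HasMaassExpansion (-((0 : ℕ) : ℤ)) f cp cm) :
    HasRegPairing f (fun _ => g₀)
      (Real.pi / 3 * constTerm (pairSeries cp fun m => eisensteinTwo m • g₀)) := by
  obtain ⟨P, hP, ε, hε, hO⟩ := hf.growth
  have hfc : ∀ i, ContinuousOn (fun z : ℂ => f (ofComplex z) i) {z : ℂ | 0 < z.im} := fun i =>
    (hf.smooth (LinearMap.proj i)).continuousOn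
  have hpi : (Real.pi : ℂ) ≠ 0 := by exact_mod_cast Real.pi_ne_zero
  have hFT' : ∀ τ : ℍ, g₀ (f ((1 : ℝ) +ᵥ τ)) = g₀ (f τ) := pairing_vadd_one hf.modular hg hB
  have hFT : ∀ z : ℂ, 0 < z.im → g₀ (f (ofComplex (z + 1))) = g₀ (f (ofComplex z)) :=
    fun z hz => by rw [ofComplex_add_one hz, hFT']
  have hFS : ∀ z : ℂ, 0 < z.im → g₀ (f (ofComplex (-z⁻¹))) = g₀ (f (ofComplex z)) :=
    fun z hz => by
      rw [ofComplex_neg_inv hz]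
      exact pairing_smul_S hf.modular hg hA (ofComplex z)
  have hFd := differentiableOn_pairing_of_weight_zero hexp g₀ hFT hFS
  set F : ℂ → ℂ := fun z => g₀ (f (ofComplex z)) with hF
  set H : ℂ → ℂ := fun z => EisensteinSeries.E2 (ofComplex z) * F z with hH
  have hHd : DifferentiableOn ℂ H {z : ℂ | 0 < z.im} := differentiableOn_E2.mul hFd
  -- With this κ the coefficient κ/(2i) is -3/π, so Φ = (E₂ - 3/(πv))F.
  set κ : ℂ := -6 * Complex.I / Real.pi with hκ
  set Φ := completedDerivative κ F H with hΦ
  have hHT : ∀ z : ℂ, 0 < z.im → H (z + 1) = H z := fun z hz => by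
    have h1 : F (z + 1) = F z := hFT z hz
    simp only [hH]
    rw [h1, ofComplex_add_one hz, E2_vadd_one]
  have hHS : ∀ z : ℂ, 0 < z.im → H (-z⁻¹) = z ^ 2 * H z + κ * z * F z := fun z hz => by
    have h1 : F (-z⁻¹) = F z := hFS z hz
    simp only [hH]
    rw [h1, ofComplex_neg_inv hz, E2_smul_S, coe_ofComplex_of_im_pos hz]
    ring
  have hΦC : ContDiffOn ℝ 1 Φ {z : ℂ | 0 < z.im} := contDiffOn_completedDerivative _
    (contDiffOn_of_differentiableOn_im_pos hFd) (contDiffOn_of_differentiableOn_im_pos hHd)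
  -- The constant g₀ is viewed as a q-series supported at m = 0; only the existence of the limit
  -- matters.
  have hc : Filter.Tendsto (fun v : ℝ => ∫ u in (-(1 / 2) : ℝ)..(1 / 2), F (u + v * Complex.I))
      Filter.atTop _ := tendsto_integral_pairing (G := fun _ => g₀)
        (b := fun m => if m = 0 then g₀ else 0) hε hfc hO
        ⟨⟨1, one_pos, fun m hm => ⟨0, by
          by_contra h
          exact hm (if_neg fun h' => h (by rw [h']; simp))⟩⟩,
          fun m hm => if_neg hm.ne, fun ℓ τ => by
            have h := hasSum_single (f := fun m : ℚ => qPow m τ * ℓ (if m = 0 then g₀ else 0)) 0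
              fun m hm => by rw [if_neg hm, map_zero, mul_zero]
            simpa [qPow_eq_qExp, qExp_zero] using h⟩ hFT'
  have hE := hasQExpansion_E2_smul g₀
  have hd : Filter.Tendsto (fun v : ℝ => ∫ u in (-(1 / 2) : ℝ)..(1 / 2), H (u + v * Complex.I))
      Filter.atTop (nhds (constTerm (pairSeries cp fun m => eisensteinTwo m • g₀))) := by
    rw [constTerm_pairSeries_eq_sum (P := P) hE.nonneg
      fun m hm => hexp.eq_polynomial hε hfc hO hm]
    exact tendsto_integral_pairing hε hfc hO hE fun τ => by
      rw [E2_vadd_one, LinearMap.smul_apply, LinearMap.smul_apply, hFT']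
  have hQ := tendsto_integral_completedDerivative (κ := κ) hFd.continuousOn hHd.continuousOn hc hd
  have hdom : ∀ T : ℝ, 1 < T → ∫ τ in truncatedDomain T, g₀ (f τ) =
      Real.pi / 3 * ∫ u in (-(1 / 2) : ℝ)..(1 / 2), Φ (u + T * Complex.I) := by
    intro T hT
    have h1 := integral_wirtingerBar_fundamentalDomain hΦC
      (fun z hz => completedDerivative_add_one hFT hHT hz)
      (fun z hz => completedDerivative_neg_inv hFS hHS hz) hT
    rw [← setIntegral_im_sq_mul hΦC.continuousOn_wirtingerBar hT.le] at h1
    -- F and H are holomorphic, so D̄ sees only v⁻¹, giving (κ/2i)(-i)v⁻²F = (3i/π)v⁻²F.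
    have h2 : ∫ τ in truncatedDomain T, (((τ : ℂ).im : ℝ) : ℂ) ^ 2 * wirtingerBar Φ τ =
        3 * Complex.I / Real.pi * ∫ τ in truncatedDomain T, g₀ (f τ) := by
      rw [← integral_const_mul]
      refine integral_congr_ae (Filter.Eventually.of_forall fun τ => ?_)
      have hne : (((τ : ℂ).im : ℝ) : ℂ) ≠ 0 := by exact_mod_cast τ.im_pos.ne'
      have hFτ := hFd.differentiableAt (isOpen_im_pos.mem_nhds τ.im_pos)
      have hHτ := hHd.differentiableAt (isOpen_im_pos.mem_nhds τ.im_pos)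
      have h3 : F τ = g₀ (f τ) := by rw [hF]; beta_reduce; rw [ofComplex_apply]
      beta_reduce
      rw [hΦ, wirtingerBar_completedDerivative κ τ.im_pos (hFτ.restrictScalars ℝ)
        (hHτ.restrictScalars ℝ), wirtingerBar_eq_zero_of_differentiableAt hFτ,
        wirtingerBar_eq_zero_of_differentiableAt hHτ, h3, hκ]
      field_simp
      ring
    rw [h2] at h1
    refine mul_left_cancel₀ (mul_ne_zero three_ne_zero (div_ne_zero Complex.I_ne_zero hpi)) ?_
    rw [show 3 * (Complex.I / Real.pi) = 3 * Complex.I / Real.pi by ring, h1]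
    field_simp
  refine (hQ.const_mul (Real.pi / 3 : ℂ)).congr' ?_
  filter_upwards [Filter.eventually_gt_atTop 1] with T hT using (hdom T hT).symm

end WeightZero

/-- The coefficients of E₂ live on the natural numbers, and (π/3)(-24) = -8π. -/
lemma constTerm_pairSeries_eisensteinTwo {W : Type*} [AddCommGroup W] [Module ℂ W] (cp : ℚ → W)
    (g₀ : Module.Dual ℂ W) :
    Real.pi / 3 * constTerm (pairSeries cp fun m => eisensteinTwo m • g₀) =
      -8 * Real.pi * ∑ᶠ m : ℕ, sigmaOne m * g₀ (cp (-(m : ℚ))) := by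
  classical
  have h1 : constTerm (pairSeries cp fun m => eisensteinTwo m • g₀) =
      ∑ᶠ m ∈ Set.range fun n : ℕ => (n : ℚ), eisensteinTwo m * g₀ (cp (-m)) := by
    rw [constTerm, pairSeries]
    refine finsum_congr fun m => ?_
    rw [finsum_eq_if, zero_sub, LinearMap.smul_apply, smul_eq_mul]
    split_ifs with hm
    · rfl
    · rw [eisensteinTwo_eq_extend, Function.extend_apply' _ _ _ fun ⟨n, hn⟩ =>
        hm ⟨n, by rw [← hn]; simp⟩]
      simp
  rw [h1, finsum_mem_range Nat.cast_injective]
  have h2 : ∀ n : ℕ, eisensteinTwo n * g₀ (cp (-(n : ℚ))) =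
      (-24 : ℂ) • (sigmaOne n * g₀ (cp (-(n : ℚ)))) := fun n => by
    rw [eisensteinTwo_natCast, smul_eq_mul, mul_assoc]
  rw [finsum_congr h2, ← smul_finsum, smul_eq_mul]
  ring

end

/-! ### The main theorem -/

theorem theorem4p11 {V : Type*} [AddCommGroup V] [Module ℚ V] (L : EvenLattice V)
    (hrank : Even (Module.finrank ℚ V)) (k : ℕ)
    (f : ℍ → L.S) (hf : IsHarmonicMaassForm L.weilRep (-(k : ℤ)) f)
    (g : ℍ → Module.Dual ℂ L.S) (hg : IsHolomorphicForm (dualRep L.weilRep) (k : ℤ) g) :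
    (∃ cp cm : ℚ → L.S, HasMaassExpansion (-(k : ℤ)) f cp cm) ∧
    (∃ b : ℚ → Module.Dual ℂ L.S, HasQExpansion g b) ∧
    ∀ (cp cm : ℚ → L.S) (b : ℚ → Module.Dual ℂ L.S),
      HasMaassExpansion (-(k : ℤ)) f cp cm → HasQExpansion g b →
      (0 < k →
        HasRegPairing f g (4 * Real.pi / k * constTerm (pairSeries cp (thetaOp b))) ∧
        4 * Real.pi / k * constTerm (pairSeries cp (thetaOp b)) =
          4 * Real.pi / k * ∑ᶠ (m : ℚ) (_ : 0 < m), (m : ℂ) * b m (cp (-m))) ∧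
      (k = 0 →
        ∃ g₀ : Module.Dual ℂ L.S, (∀ τ, g τ = g₀) ∧
          HasRegPairing f g
            (Real.pi / 3 * constTerm (pairSeries cp fun m => eisensteinTwo m • g₀)) ∧
          Real.pi / 3 * constTerm (pairSeries cp fun m => eisensteinTwo m • g₀) =
            -8 * Real.pi * ∑ᶠ m : ℕ, sigmaOne m * g₀ (cp (-(m : ℚ)))) := by
  classical
  have hSmem : (ModularGroup.S, L.weilS) ∈ L.weilRep := Subgroup.subset_closure (by simp)
  have hTmem : (ModularGroup.T, L.weilT) ∈ L.weilRep := Subgroup.subset_closure (by simp)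
  -- ω_M(T) has finite order dividing N, because the discriminant group is finite and Q has rational
  -- values. Both f and g therefore have period N.
  obtain ⟨N, hN, hNQ⟩ := L.exists_eQ_pow_eq_one
  refine ⟨exists_hasMaassExpansion hf hN
      (EvenLattice.periodic_of_vadd_one (hf.modular.vadd_one hTmem) hNQ),
    exists_hasQExpansion hg hN (EvenLattice.dual_periodic_of_vadd_one
      (hg.modular.vadd_one (mem_dualRep hTmem)) hNQ), fun cp cm b hexp hb => ⟨fun hk => ?_, ?_⟩⟩
  · exact ⟨hasRegPairing_of_pos hk hf hg hSmem hTmem hexp hb,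
      by rw [constTerm_pairSeries_thetaOp cp hb.nonneg]⟩
  · rintro rfl
    obtain ⟨g₀, hg₀⟩ := EvenLattice.exists_eq_const_of_weight_zero hg
    obtain rfl : g = fun _ => g₀ := funext hg₀
    exact ⟨g₀, hg₀, hasRegPairing_of_weight_zero hf hg.modular hSmem hTmem hexp,
      constTerm_pairSeries_eisensteinTwo cp g₀⟩
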